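/- Let $d\ge 1$ and let $\Omega\subset\mathbb{R}^d$ be a bounded open set with Lipschitz boundary. Let $A=A(x)$ be a measurable, symmetric $d\times d$ real matrix on $\mathbb{R}^d$ such that, for constants $a_*>0$ and $a^*$, $a_*|z|^2\le A(x)z\cdot z\le a^*|z|^2$ for a.e. $x\in\mathbb{R}^d$ and all $z\in\mathbb{R}^d$. For $0<s<1$ and $\Phi\in C_c^\infty(\mathbb{R}^d)^d$ put \[D^s\cdot\Phi(x)=c_{d,s}\int_{\mathbb{R}^d}\frac{\Phi(x)-\Phi(y)}{|x-y|^{d+s}}\cdot\frac{x-y}{|x-y|}\,dy,\qquad c_{d,s}=2^s\pi^{-\frac d2}\frac{\Gamma\left(\frac{d+s+1}{2}\right)}{\Gamma\left(\frac{1-s}{2}\right)},\] and let $D^1\cdot\Phi$ be the classical divergence. For $0<s\le1$ and $u\in L^2(\mathbb{R}^d)$, the distributional Riesz fractional gradient $D^su$ is the field $w\in L^2(\mathbb{R}^d)^d$, if it exists, with $\int_{\mathbb{R}^d}w\cdot\Phi=-\int_{\mathbb{R}^d}u\,(D^s\cdot\Phi)$ for all $\Phi\in C_c^\infty(\mathbb{R}^d)^d$.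 Let $H^s_0(\Omega)$ be the closure of $C_c^\infty(\Omega)$ for the norm $\left(\|u\|_{L^2(\mathbb{R}^d)}^2+\|D^su\|_{L^2(\mathbb{R}^d)^d}^2\right)^{1/2}$, functions on $\Omega$ being extended by $0$ to $\mathbb{R}^d$. Let $\sigma>0$. For every $s\in[\sigma,1]$ and every $h\in L^2(\Omega)$ there is a unique $u^s\in H^s_0(\Omega)$ with \[\int_{\mathbb{R}^d}A\,D^su^s\cdot D^sv\,dx=\int_\Omega h\,v\,dx\qquad\forall v\in H^s_0(\Omega),\] and $T^s:h\mapsto u^s$ is a bounded linear operator $L^2(\Omega)\to L^2(\Omega)$. Moreover, for every $r\in[\sigma,1]$, $T^s\to T^r$ in the operator norm of $L^2(\Omega)$ as $s\to r$, $s\in[\sigma,1]$, i.e. \[\lim_{s\to r,\ s\in[\sigma,1]}\ \sup_{\|h\|_{L^2(\Omega)}\le1}\|T^sh-T^rh\|_{L^2(\Omega)}=0.\] -/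

import Mathlib

open MeasureTheory Filter Topology Set
open scoped ContDiff ENNReal NNReal Matrix

noncomputable section

namespace RieszDirichlet

/-- Euclidean space `ℝ^d`. -/
abbrev E (d : ℕ) := EuclideanSpace ℝ (Fin d)

/-- The real Hilbert space `L²(Ω)`, with Lebesgue measure. -/
abbrev L2 {d : ℕ} (Ω : Set (E d)) := Lp ℝ 2 (volume.restrict Ω)

/-- The constant `c_{d,s} = 2^s π^{-d/2} Γ((d+s+1)/2) / Γ((1-s)/2)`, used for `0 < s < 1`. -/
def rieszConst (d : ℕ) (s : ℝ) : ℝ :=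
  2 ^ s * Real.pi ^ (-(d : ℝ) / 2) * Real.Gamma (((d : ℝ) + s + 1) / 2) / Real.Gamma ((1 - s) / 2)

/-- The `s`-divergence of a smooth compactly supported vector field: for `0 < s < 1`
`D^s · Φ (x) = c_{d,s} ∫ (Φ(x) - Φ(y)) / |x-y|^{d+s} · (x-y) / |x-y| dy`,
and for `s = 1` the classical divergence. -/
def rieszDiv {d : ℕ} (s : ℝ) (Φ : E d → E d) (x : E d) : ℝ :=
  if s = 1 then ∑ i : Fin d, (fderiv ℝ Φ x (EuclideanSpace.single i 1)) i
  else rieszConst d s * ∫ y, inner ℝ (Φ x - Φ y) (x - y) / ‖x - y‖ ^ ((d : ℝ) + s + 1)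

/-- `u ∈ L²(ℝ^d)` has distributional Riesz gradient `D^s u = w ∈ L²(ℝ^d)^d`:
`∫ w · Φ = - ∫ u (D^s · Φ)` for all `Φ ∈ C_c^∞(ℝ^d)^d`. For `s = 1` it is the weak gradient. -/
def IsRieszGradient {d : ℕ} (s : ℝ) (u : E d → ℝ) (w : E d → E d) : Prop :=
  MemLp u 2 volume ∧ MemLp w 2 volume ∧
    ∀ Φ : E d → E d, ContDiff ℝ ∞ Φ → HasCompactSupport Φ →
      ∫ x, inner ℝ (w x) (Φ x) = - ∫ x, u x * rieszDiv s Φ x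

/-- `u : ℝ^d → ℝ` belongs to `H^s_0(Ω)`, the closure of `C_c^∞(Ω)` for the norm
`(‖u‖²_{L²(ℝ^d)} + ‖D^s u‖²_{L²(ℝ^d)^d})^{1/2}`. -/
def MemHs0 {d : ℕ} (Ω : Set (E d)) (s : ℝ) (u : E d → ℝ) : Prop :=
  ∃ w : E d → E d, IsRieszGradient s u w ∧
    ∃ (φ : ℕ → E d → ℝ) (ψ : ℕ → E d → E d),
      (∀ n, ContDiff ℝ ∞ (φ n) ∧ HasCompactSupport (φ n) ∧ tsupport (φ n) ⊆ Ω ∧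
        IsRieszGradient s (φ n) (ψ n)) ∧
      Tendsto (fun n => eLpNorm (φ n - u) 2 volume) atTop (𝓝 0) ∧
      Tendsto (fun n => eLpNorm (ψ n - w) 2 volume) atTop (𝓝 0)

/-- `u`, extended by zero outside `Ω`, is in `H^s_0(Ω)` and
`∫_{ℝ^d} A D^s u · D^s v = ∫_Ω h v` for all `v ∈ H^s_0(Ω)`. -/
def IsWeakSolution {d : ℕ} (Ω : Set (E d)) (A : E d → Matrix (Fin d) (Fin d) ℝ) (s : ℝ)
    (h u : L2 Ω) : Prop :=
  MemHs0 Ω s (Ω.indicator u) ∧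
    ∃ w : E d → E d, IsRieszGradient s (Ω.indicator u) w ∧
      ∀ (v : E d → ℝ) (z : E d → E d), MemHs0 Ω s v → IsRieszGradient s v z →
        ∫ x, (A x *ᵥ (w x).ofLp) ⬝ᵥ (z x).ofLp = ∫ x in Ω, h x * v x

/-- `T` is the solution operator `T^s` on `L²(Ω)`: for every `h`, `T h` is the one and only
weak solution with right-hand side `h`. -/
def IsSolutionOperator {d : ℕ} (Ω : Set (E d)) (A : E d → Matrix (Fin d) (Fin d) ℝ) (s : ℝ)
    (T : L2 Ω →L[ℝ] L2 Ω) : Prop :=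
  ∀ h u : L2 Ω, IsWeakSolution Ω A s h u ↔ u = T h

/-- Near each of its boundary points, `Ω` is the strict epigraph, in the direction of a unit vector
`ν`, of a Lipschitz function `γ` on the hyperplane `ν^⊥`. (`γ` is given on `ℝ^d`, but only its
values at the projections `x - ⟨ν, x⟩ ν` onto `ν^⊥` are used.) -/
def HasLipschitzBoundary {d : ℕ} (Ω : Set (E d)) : Prop :=
  ∀ p ∈ frontier Ω, ∃ ν : E d, ‖ν‖ = 1 ∧ ∃ (γ : E d → ℝ) (K : ℝ≥0), LipschitzWith K γ ∧
    ∃ ρ > 0, ∀ x ∈ Metric.ball p ρ, x ∈ Ω ↔ γ (x - inner ℝ ν x • ν) < inner ℝ ν x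

/-- `A` is measurable, symmetric, and `aLow |z|² ≤ A(x) z · z ≤ aUp |z|²` for a.e. `x` and
all `z`. -/
def IsEllipticMatrix {d : ℕ} (A : E d → Matrix (Fin d) (Fin d) ℝ) (aLow aUp : ℝ) : Prop :=
  (∀ i j, AEMeasurable (fun x => A x i j) volume) ∧
  (∀ᵐ x, (A x).IsSymm) ∧
  ∀ᵐ x, ∀ z : E d, aLow * ‖z‖ ^ 2 ≤ (A x *ᵥ z.ofLp) ⬝ᵥ z.ofLp ∧
    (A x *ᵥ z.ofLp) ⬝ᵥ z.ofLp ≤ aUp * ‖z‖ ^ 2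

end RieszDirichlet

end

open MeasureTheory Filter Topology Set
open scoped ContDiff ENNReal NNReal Matrix

noncomputable section

namespace RieszDirichlet

open scoped FourierTransform SchwartzMap ComplexConjugate Convolution Manifold Pointwise

/-! On the Fourier side the components of D^s are the multipliers 2πi ξ_j |2πξ|^(s-1)
(`integral_rieszKernel`, `IsTestFunction.ft_rieszDeriv`), because the power kernel is a
superposition of Gaussians. Hence D^s is skew-adjoint on test functions, ‖D^s φ‖ is the L² norm of
|2πξ|^s φ̂, and for a fixed test function D^s φ is continuous in s in L², by dominated convergence
with majorant a multiple of (1 + |2πξ|)|φ̂|.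

Since Ω is bounded, û is bounded and Lipschitz for u in L²(Ω), with constants proportional to ‖u‖.
Separating low from high frequencies then gives a Poincaré inequality with a constant independent of
s in (0, 1] (`exists_poincare`) and a Rellich theorem uniform for s in [σ, 1]
(`tendsto_of_weak_of_rieszSeminorm_le`). Poincaré makes the form coercive on the closed space of
pairs (u, D^s u), and Lax–Milgram yields T^s.

Convergence is a compactness argument. Choose h_s in the unit ball with ‖T^s - T^r‖ ≤ 2 ‖(T^s - T^r)
h_s‖ and an ultrafilter finer than s → r; along it h_s has a weak limit h₀. Both T^s h_s and T^r h_s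
tend strongly to T^r h₀, by two applications of `exists_tendsto_of_isPairSolution`. There, the
solutions and their gradients are bounded, so they converge weakly, and Rellich makes the functions
converge strongly. The limit of the gradients is D^r of the limit because D^s · Φ → D^r · Φ in L²,
and the equation passes to the limit against each fixed test function as a weak-strong pairing.

The delicate point is that the limit lies in H^r_0(Ω), since s may approach r from below and the
approximants need not lie there. Fatou bounds its norm of order r and it vanishes outside Ω; for a
Lipschitz boundary this suffices (`sobolevApproximable_of_hasLipschitzBoundary`), by localising,
translating into Ω and mollifying. -/

/-- The Fourier transform of a real-valued function. -/
def ft {d : ℕ} (f : E d → ℝ) (ξ : E d) : ℂ := 𝓕 (fun x => (f x : ℂ)) ξ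

/-! ### Fourier transform on L¹ ∩ L² and Plancherel's theorem -/

section FourierTransform

variable {d : ℕ} {f g : E d → ℝ}

theorem ft_apply (f : E d → ℝ) (ξ : E d) :
    ft f ξ = ∫ x, Complex.exp (↑(-2 * Real.pi * inner ℝ x ξ) * Complex.I) * (f x : ℂ) := by
  simp [ft, Real.fourier_eq', smul_eq_mul]

theorem integrable_fourier_integrand (hf : Integrable f) (ξ : E d) :
    Integrable fun x => Complex.exp (↑(-2 * Real.pi * inner ℝ x ξ) * Complex.I) * (f x : ℂ) := by
  refine hf.ofReal.bdd_mul (c := 1) (Continuous.aestronglyMeasurable (by fun_prop)) ?_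
  exact Eventually.of_forall fun x => (Complex.norm_exp_ofReal_mul_I _).le

theorem ft_add (hf : Integrable f) (hg : Integrable g) (ξ : E d) :
    ft (fun x => f x + g x) ξ = ft f ξ + ft g ξ := by
  rw [ft_apply, ft_apply, ft_apply, ← integral_add (integrable_fourier_integrand hf ξ)
    (integrable_fourier_integrand hg ξ)]
  simp [mul_add]

theorem ft_sub (hf : Integrable f) (hg : Integrable g) (ξ : E d) :
    ft (fun x => f x - g x) ξ = ft f ξ - ft g ξ := by
  rw [ft_apply, ft_apply, ft_apply, ← integral_sub (integrable_fourier_integrand hf ξ)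
    (integrable_fourier_integrand hg ξ)]
  simp [mul_sub]

theorem ft_const_mul (c : ℝ) (f : E d → ℝ) (ξ : E d) :
    ft (fun x => c * f x) ξ = c * ft f ξ := by
  rw [ft_apply, ft_apply, ← integral_const_mul]
  congr with x
  push_cast
  ring

theorem ft_congr_ae (h : f =ᵐ[volume] g) : ft f = ft g := by
  ext ξ
  rw [ft_apply, ft_apply]
  refine integral_congr_ae ?_
  filter_upwards [h] with x hx
  rw [hx]

theorem ft_comp_sub (f : E d → ℝ) (z ξ : E d) :
    ft (fun x => f (x - z)) ξ
      = Complex.exp (↑(-2 * Real.pi * inner ℝ z ξ) * Complex.I) * ft f ξ := by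
  rw [ft_apply, ft_apply, ← integral_const_mul, ← integral_add_right_eq_self _ z]
  congr with x
  rw [← mul_assoc, ← Complex.exp_add, add_sub_cancel_right, inner_add_left]
  congr 2
  push_cast
  ring

theorem continuous_ft (hf : Integrable f) : Continuous (ft f) := by
  have := VectorFourier.fourierIntegral_continuous (e := Real.fourierChar)
    (μ := (volume : Measure (E d))) (L := innerₗ (E d)) Real.continuous_fourierChar
    continuous_inner hf.ofReal (𝕜 := ℝ) (f := fun x => (f x : ℂ))
  exact this

theorem norm_ft_le (f : E d → ℝ) (ξ : E d) : ‖ft f ξ‖ ≤ ∫ x, |f x| := by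
  rw [ft_apply]
  refine (norm_integral_le_integral_norm _).trans (le_of_eq ?_)
  congr with x
  rw [norm_mul, Complex.norm_exp_ofReal_mul_I, one_mul, Complex.norm_real, Real.norm_eq_abs]

/-- Plancherel is known for the abstract L² transform, while all computations use the integral. The
two agree as tempered distributions, since both transpose the Fourier transform onto the test
function. -/
theorem fourier_toLp_ae_eq {f : E d → ℂ} (hf : Integrable f) (hf2 : MemLp f 2) :
    (𝓕 (hf2.toLp f) : Lp ℂ 2 (volume : Measure (E d))) =ᵐ[volume] 𝓕 f := by
  refine ae_eq_of_integral_contDiff_smul_eq ((Lp.memLp _).locallyIntegrable (by norm_num)) ?_ ?_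
  · exact (VectorFourier.fourierIntegral_continuous (e := Real.fourierChar)
      (L := innerₗ (E d)) Real.continuous_fourierChar continuous_inner hf).locallyIntegrable
  intro g g_smooth g_cpt
  have hg₁ : HasCompactSupport (Complex.ofRealCLM ∘ g) := g_cpt.comp_left rfl
  have hg₂ : ContDiff ℝ ∞ (Complex.ofRealCLM ∘ g) := by fun_prop
  set G : 𝓢(E d, ℂ) := hg₁.toSchwartzMap hg₂ with hG
  have hGg : ∀ x, G x = (g x : ℂ) := fun x => rfl
  have h1 := DFunLike.congr_fun (MeasureTheory.Lp.fourier_toTemperedDistribution_eq (hf2.toLp f)) G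
  rw [TemperedDistribution.fourier_apply, MeasureTheory.Lp.toTemperedDistribution_apply,
    MeasureTheory.Lp.toTemperedDistribution_apply] at h1
  calc ∫ x, g x • (𝓕 (hf2.toLp f) : Lp ℂ 2 (volume : Measure (E d))) x
      = ∫ x, G x • (𝓕 (hf2.toLp f) : Lp ℂ 2 (volume : Measure (E d))) x := by
        simp [hGg]
    _ = ∫ x, (𝓕 G) x • (hf2.toLp f) x := h1.symm
    _ = ∫ x, (𝓕 (G : E d → ℂ)) x • f x := by
        refine integral_congr_ae ?_
        filter_upwards [hf2.coeFn_toLp] with x hx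
        rw [hx, SchwartzMap.fourier_coe]
    _ = ∫ x, G x • 𝓕 f x := by
        have := VectorFourier.integral_fourierIntegral_smul_eq_flip (L := innerₗ (E d))
          (μ := volume) (ν := volume) Real.continuous_fourierChar continuous_inner G.integrable hf
        simpa using! this
    _ = ∫ x, g x • 𝓕 f x := by simp [hGg]

theorem memLp_ft (hf : Integrable f) (hf2 : MemLp f 2) : MemLp (ft f) 2 :=
  (memLp_congr_ae (fourier_toLp_ae_eq hf.ofReal hf2.ofReal)).1 (Lp.memLp _)

/-- Plancherel's theorem for functions in `L¹ ∩ L²`. -/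
theorem integral_conj_ft_mul_ft (hf : Integrable f) (hf2 : MemLp f 2) (hg : Integrable g)
    (hg2 : MemLp g 2) : ∫ ξ, conj (ft f ξ) * ft g ξ = ((∫ x, f x * g x : ℝ) : ℂ) := by
  have h := MeasureTheory.Lp.inner_fourier_eq (hf2.ofReal (K := ℂ)).toLp (hg2.ofReal (K := ℂ)).toLp
  rw [L2.inner_def, L2.inner_def] at h
  rw [← integral_complex_ofReal]
  calc _ = _ := integral_congr_ae ?_
    _ = _ := h
    _ = _ := integral_congr_ae ?_
  · filter_upwards [fourier_toLp_ae_eq hf.ofReal hf2.ofReal,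
      fourier_toLp_ae_eq hg.ofReal hg2.ofReal] with ξ h1 h2
    rw [h1, h2, RCLike.inner_apply, mul_comm]
    rfl
  · filter_upwards [(hf2.ofReal (K := ℂ)).coeFn_toLp, (hg2.ofReal (K := ℂ)).coeFn_toLp] with x h1 h2
    rw [h1, h2, RCLike.inner_apply]
    simp [mul_comm]

theorem eLpNorm_ft (hf : Integrable f) (hf2 : MemLp f 2) :
    eLpNorm (ft f) 2 volume = eLpNorm f 2 volume := by
  have h := MeasureTheory.Lp.norm_fourier_eq (hf2.ofReal (K := ℂ)).toLp
  have h1 : eLpNorm (ft f) 2 volume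
      = eLpNorm (𝓕 (hf2.ofReal (K := ℂ)).toLp : Lp ℂ 2 (volume : Measure (E d))) 2 volume :=
    (eLpNorm_congr_ae (fourier_toLp_ae_eq hf.ofReal hf2.ofReal)).symm
  have h2 : eLpNorm f 2 volume = eLpNorm (hf2.ofReal (K := ℂ)).toLp 2 volume := by
    rw [eLpNorm_congr_ae (hf2.ofReal (K := ℂ)).coeFn_toLp]
    exact (eLpNorm_congr_norm_ae (Eventually.of_forall fun x => by simp))
  rw [h1, h2, ← Lp.enorm_def, ← Lp.enorm_def, ← ofReal_norm, ← ofReal_norm, h]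

end FourierTransform

/-! ### Fourier multiplier of the Riesz kernel -/

section Multiplier

variable {d : ℕ}

/-- The Fourier multiplier `2πi ξ_j |2πξ|^(s-1)` of the `j`-th partial Riesz derivative. -/
def rieszSymbol (s : ℝ) (j : Fin d) (ξ : E d) : ℂ :=
  2 * Real.pi * Complex.I * (ξ j : ℂ) * (((2 * Real.pi * ‖ξ‖) ^ (s - 1) : ℝ) : ℂ)

theorem ft_fderiv_apply {f : E d → ℝ} (hf : Integrable f) (h'f : Differentiable ℝ f)
    (hf' : Integrable (fderiv ℝ f)) (j : Fin d) (ξ : E d) :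
    ft (fun x => fderiv ℝ f x (EuclideanSpace.single j 1)) ξ
      = 2 * Real.pi * Complex.I * (ξ j : ℂ) * ft f ξ := by
  have hder : fderiv ℝ (fun x => (f x : ℂ)) = fun x => Complex.ofRealCLM ∘L fderiv ℝ f x := by
    ext1 x
    exact (Complex.ofRealCLM.hasFDerivAt.comp x (h'f x).hasFDerivAt).fderiv
  have hint : Integrable (fderiv ℝ (fun x => (f x : ℂ))) := by
    rw [hder]
    exact (ContinuousLinearMap.compL ℝ (E d) ℝ ℂ Complex.ofRealCLM).integrable_comp hf'
  have hdiff : Differentiable ℝ (fun x => (f x : ℂ)) := Complex.ofRealCLM.differentiable.comp h'f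
  have h := congrArg (fun g => g ξ (EuclideanSpace.single j 1))
    (Real.fourier_fderiv hf.ofReal hdiff hint)
  rw [Real.fourier_continuousLinearMap_apply hint] at h
  have : (fun x => ((fderiv ℝ f x (EuclideanSpace.single j 1) : ℝ) : ℂ))
      = fun x => fderiv ℝ (fun x => (f x : ℂ)) x (EuclideanSpace.single j 1) := by
    rw [hder]; rfl
  rw [ft, this, h]
  simp [VectorFourier.fourierSMulRight_apply, innerSL_apply_apply ℝ,
    EuclideanSpace.inner_single_right, ft]
  ring

theorem ft_gaussian {t : ℝ} (ht : 0 < t) (ξ : E d) :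
    ft (fun z : E d => Real.exp (-(Real.pi * ‖z‖ ^ 2 * t))) ξ
      = ((t ^ (-(d : ℝ) / 2) * Real.exp (-(Real.pi * ‖ξ‖ ^ 2 / t)) : ℝ) : ℂ) := by
  have hb : 0 < ((Real.pi * t : ℝ) : ℂ).re := by rw [Complex.ofReal_re]; positivity
  have h := fourier_gaussian_innerProductSpace (V := E d) hb ξ
  have e1 : (fun z : E d => ((Real.exp (-(Real.pi * ‖z‖ ^ 2 * t)) : ℝ) : ℂ))
      = fun v => Complex.exp (-((Real.pi * t : ℝ) : ℂ) * ‖v‖ ^ 2) := by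
    ext v; push_cast; congr 1; ring
  rw [ft, e1, h, finrank_euclideanSpace_fin]
  have hpi : (Real.pi : ℂ) ≠ 0 := by exact_mod_cast Real.pi_ne_zero
  have htc : (t : ℂ) ≠ 0 := by exact_mod_cast ht.ne'
  have e2 : (Real.pi : ℂ) / ((Real.pi * t : ℝ) : ℂ) = ((t⁻¹ : ℝ) : ℂ) := by
    push_cast; field_simp
  rw [e2, show ((d : ℂ) / 2) = (((d : ℝ) / 2 : ℝ) : ℂ) by push_cast; rfl,
    ← Complex.ofReal_cpow (by positivity), Real.inv_rpow ht.le, ← Real.rpow_neg ht.le]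
  push_cast
  congr 3
  · ring
  · field_simp

theorem integrable_gaussian_norm {t : ℝ} (ht : 0 < t) :
    Integrable fun z : E d => Real.exp (-(Real.pi * ‖z‖ ^ 2 * t)) := by
  have hb : 0 < ((Real.pi * t : ℝ) : ℂ).re := by rw [Complex.ofReal_re]; positivity
  have h := (GaussianFourier.integrable_cexp_neg_mul_sq_norm_add (V := E d) hb 0 0).norm
  refine h.congr (Eventually.of_forall fun z => ?_)
  simp only [zero_mul, add_zero]
  rw [show -((Real.pi * t : ℝ) : ℂ) * (‖z‖ : ℂ) ^ 2 = ((-(Real.pi * ‖z‖ ^ 2 * t) : ℝ) : ℂ) by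
    push_cast; ring, Complex.norm_exp_ofReal]

/-- Half of the Gaussian decay absorbs the linear factor, since u ≤ 1 + u² and x + 1 ≤ e^x. -/
theorem norm_mul_gaussian_le {t : ℝ} (ht : 0 < t) (u : ℝ) :
    u * Real.exp (-(Real.pi * u ^ 2 * t))
      ≤ (1 + 2 / (Real.pi * t)) * Real.exp (-(Real.pi * u ^ 2 * (t / 2))) := by
  have hp := Real.pi_pos
  have h1 := Real.add_one_le_exp (Real.pi * u ^ 2 * (t / 2))
  have h2 : u ≤ (1 + 2 / (Real.pi * t)) * Real.exp (Real.pi * u ^ 2 * (t / 2)) := by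
    calc u ≤ 1 + u ^ 2 := by nlinarith [sq_nonneg (u - 1), sq_nonneg (u + 1)]
      _ ≤ (1 + 2 / (Real.pi * t)) * (Real.pi * u ^ 2 * (t / 2) + 1) := by
        have e : (1 + 2 / (Real.pi * t)) * (Real.pi * u ^ 2 * (t / 2) + 1)
            = 1 + u ^ 2 + (2 / (Real.pi * t) + Real.pi * u ^ 2 * (t / 2)) := by
          field_simp; ring
        rw [e]
        have : 0 ≤ 2 / (Real.pi * t) + Real.pi * u ^ 2 * (t / 2) := by positivity
        linarith
      _ ≤ _ := by gcongr
  calc u * Real.exp (-(Real.pi * u ^ 2 * t))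
      ≤ ((1 + 2 / (Real.pi * t)) * Real.exp (Real.pi * u ^ 2 * (t / 2)))
          * Real.exp (-(Real.pi * u ^ 2 * t)) := by gcongr
    _ = _ := by
      rw [mul_assoc, ← Real.exp_add]
      congr 2
      ring

theorem hasFDerivAt_gaussian_norm (t : ℝ) (z : E d) :
    HasFDerivAt (fun z : E d => Real.exp (-(Real.pi * ‖z‖ ^ 2 * t)))
      ((-(2 * Real.pi * t) * Real.exp (-(Real.pi * ‖z‖ ^ 2 * t))) • innerSL ℝ z) z := by
  have h := ((((hasStrictFDerivAt_norm_sq z).hasFDerivAt.const_mul Real.pi).mul_const t).neg).exp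
  refine h.congr_fderiv ?_
  ext v
  simp
  ring

/-- Up to the factor -1/(2πt) the function is a partial derivative of the Gaussian, so its transform
is the coordinate multiplier times a Gaussian transform. -/
theorem ft_coord_mul_gaussian {t : ℝ} (ht : 0 < t) (j : Fin d) (ξ : E d) :
    ft (fun z : E d => z j * Real.exp (-(Real.pi * ‖z‖ ^ 2 * t))) ξ
      = -Complex.I *
        ((ξ j * (t ^ (-(d : ℝ) / 2 - 1) * Real.exp (-(Real.pi * ‖ξ‖ ^ 2 / t))) : ℝ) : ℂ) := by
  have hfd : fderiv ℝ (fun z : E d => Real.exp (-(Real.pi * ‖z‖ ^ 2 * t)))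
      = fun z => (-(2 * Real.pi * t) * Real.exp (-(Real.pi * ‖z‖ ^ 2 * t))) • innerSL ℝ z :=
    funext fun z => (hasFDerivAt_gaussian_norm t z).fderiv
  have hint : Integrable (fderiv ℝ (fun z : E d => Real.exp (-(Real.pi * ‖z‖ ^ 2 * t)))) := by
    rw [hfd]
    refine ((integrable_gaussian_norm (d := d) (half_pos ht)).const_mul
      ((2 * Real.pi * t) * (1 + 2 / (Real.pi * t)))).mono'
      (Continuous.aestronglyMeasurable (by fun_prop)) (Eventually.of_forall fun z => ?_)
    rw [norm_smul, innerSL_apply_norm, norm_mul, norm_neg, Real.norm_of_nonneg (by positivity),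
      Real.norm_of_nonneg (Real.exp_pos _).le, mul_assoc, mul_assoc (2 * Real.pi * t),
      mul_comm (Real.exp _) ‖z‖]
    exact mul_le_mul_of_nonneg_left (norm_mul_gaussian_le ht ‖z‖) (by positivity)
  have h := ft_fderiv_apply (integrable_gaussian_norm ht)
    (fun z => (hasFDerivAt_gaussian_norm t z).differentiableAt) hint j ξ
  have e1 : (fun z : E d => z j * Real.exp (-(Real.pi * ‖z‖ ^ 2 * t)))
      = fun z => (-(2 * Real.pi * t))⁻¹ *
        fderiv ℝ (fun z : E d => Real.exp (-(Real.pi * ‖z‖ ^ 2 * t))) z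
          (EuclideanSpace.single j 1) := by
    ext z
    have := Real.pi_pos
    rw [hfd]
    simp [EuclideanSpace.inner_single_right]
    field_simp
  rw [e1, ft_const_mul, h, ft_gaussian ht, Real.rpow_sub_one ht.ne']
  have hpi : (Real.pi : ℂ) ≠ 0 := by exact_mod_cast Real.pi_ne_zero
  have htc : (t : ℂ) ≠ 0 := by exact_mod_cast ht.ne'
  push_cast
  field_simp

/-- The common majorant of all singular integrals below. In polar coordinates it is r^(-s) near 0,
integrable because s < 1, and r^(-1-s) at infinity, integrable because s > 0. -/
theorem integrable_min_norm_mul_rpow (hd : 0 < d) {s : ℝ} (hs0 : 0 < s) (hs1 : s < 1) :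
    Integrable fun z : E d => min ‖z‖ 1 * ‖z‖ ^ (-((d : ℝ) + s)) := by
  have : Nonempty (Fin d) := ⟨⟨0, hd⟩⟩
  have : Nontrivial (E d) := inferInstance
  rw [integrable_fun_norm_addHaar volume (f := fun y => min y 1 * y ^ (-((d : ℝ) + s))),
    ← Ioc_union_Ioi_eq_Ioi (zero_le_one' ℝ)]
  have hpow : ∀ y : ℝ, 0 < y → y ^ (Module.finrank ℝ (E d) - 1) * y ^ (-((d : ℝ) + s))
      = y ^ (-1 - s) := by
    intro y hy
    rw [finrank_euclideanSpace_fin, ← Real.rpow_natCast, ← Real.rpow_add hy, Nat.cast_sub hd]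
    congr 1
    push_cast
    ring
  refine IntegrableOn.union ?_ ?_
  · have h := (intervalIntegral.intervalIntegrable_rpow' (a := 0) (b := 1)
      (r := -s) (by linarith)).1
    refine h.congr_fun (fun y hy => ?_) measurableSet_Ioc
    simp only [smul_eq_mul]
    rw [min_eq_left hy.2, mul_left_comm, hpow y hy.1, show (-s : ℝ) = 1 + (-1 - s) by ring,
      Real.rpow_add hy.1, Real.rpow_one]
  · refine (integrableOn_Ioi_rpow_of_lt (a := -1 - s) (by linarith) one_pos).congr_fun
      (fun y hy => ?_) measurableSet_Ioi
    have hy : (1 : ℝ) < y := hy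
    simp only [smul_eq_mul]
    rw [min_eq_right hy.le, mul_left_comm, hpow y (by linarith), one_mul]

/-- The substitution t ↦ 1/t in the Gamma integral. -/
theorem integral_rpow_mul_exp_neg_div {c b : ℝ} (hc : 0 < c) (hb : 0 < b) :
    ∫ t in Ioi (0 : ℝ), t ^ (-1 - b) * Real.exp (-(c / t)) = (1 / c) ^ b * Real.Gamma b := by
  rw [← Real.integral_rpow_mul_exp_neg_mul_Ioi hb hc,
    ← integral_comp_rpow_Ioi (fun t => t ^ (b - 1) * Real.exp (-(c * t))) (p := -1) (by norm_num)]
  refine setIntegral_congr_fun measurableSet_Ioi fun t ht => ?_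
  have ht : 0 < t := ht
  simp only [smul_eq_mul, abs_neg, abs_one, one_mul]
  rw [Real.rpow_neg_one, Real.inv_rpow ht.le, ← Real.rpow_neg ht.le, ← mul_assoc,
    ← Real.rpow_add ht]
  congr 2
  ring

theorem norm_one_sub_fourierChar_le (ξ z : E d) :
    ‖1 - Complex.exp (↑(-2 * Real.pi * inner ℝ z ξ) * Complex.I)‖
      ≤ (2 + 2 * Real.pi * ‖ξ‖) * min ‖z‖ 1 := by
  have hp := Real.pi_pos
  rcases le_total ‖z‖ 1 with hz | hz
  · rw [min_eq_left hz, norm_sub_rev, mul_comm _ Complex.I]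
    refine (Real.norm_exp_I_mul_ofReal_sub_one_le).trans ?_
    rw [norm_mul, norm_mul, norm_neg, Real.norm_of_nonneg hp.le, Real.norm_of_nonneg zero_le_two]
    calc 2 * Real.pi * ‖(inner ℝ z ξ : ℝ)‖ ≤ 2 * Real.pi * (‖z‖ * ‖ξ‖) := by
          gcongr; exact norm_inner_le_norm z ξ
      _ ≤ _ := by nlinarith [norm_nonneg z]
  · rw [min_eq_right hz]
    refine (norm_sub_le _ _).trans ?_
    rw [Complex.norm_exp_ofReal_mul_I, norm_one]
    nlinarith [norm_nonneg ξ, mul_nonneg hp.le (norm_nonneg ξ)]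

theorem coord_div_rpow_le (hd : 0 < d) {s : ℝ} (hs0 : 0 < s) (j : Fin d) (z : E d) :
    ‖z j‖ / ‖z‖ ^ ((d : ℝ) + s + 1) ≤ ‖z‖ ^ (-((d : ℝ) + s)) := by
  rcases eq_or_ne z 0 with rfl | hz
  · have : (d : ℝ) + s ≠ 0 := by positivity
    simp only [PiLp.zero_apply, norm_zero, zero_div]
    positivity
  have hz' : 0 < ‖z‖ := norm_pos_iff.2 hz
  rw [div_le_iff₀ (by positivity), ← Real.rpow_add hz',
    show -((d : ℝ) + s) + ((d : ℝ) + s + 1) = 1 by ring, Real.rpow_one]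
  exact PiLp.norm_apply_le z j

theorem integrable_rieszKernel (hd : 0 < d) {s : ℝ} (hs0 : 0 < s) (hs1 : s < 1) (j : Fin d)
    (ξ : E d) :
    Integrable fun z : E d =>
      (1 - Complex.exp (↑(-2 * Real.pi * inner ℝ z ξ) * Complex.I)) *
        ((z j / ‖z‖ ^ ((d : ℝ) + s + 1) : ℝ) : ℂ) := by
  refine ((integrable_min_norm_mul_rpow hd hs0 hs1).const_mul (2 + 2 * Real.pi * ‖ξ‖)).mono' ?_ ?_
  · refine (Continuous.aestronglyMeasurable (by fun_prop)).mul ?_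
    refine (Complex.continuous_ofReal.measurable.comp ?_).aestronglyMeasurable
    exact Measurable.div (by fun_prop) (by fun_prop)
  · refine Eventually.of_forall fun z => ?_
    rw [norm_mul, ← mul_assoc]
    refine mul_le_mul (norm_one_sub_fourierChar_le ξ z) ?_ (norm_nonneg _) (by positivity)
    rw [Complex.norm_real, norm_div, Real.norm_of_nonneg (Real.rpow_nonneg (norm_nonneg z) _)]
    exact coord_div_rpow_le hd hs0 j z

/-- Subordination: a negative power of ‖z‖ is a superposition of Gaussians. -/
theorem integral_rpow_mul_gaussian {a : ℝ} (ha : 0 < a) {z : E d} (hz : z ≠ 0) :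
    ∫ t in Ioi (0 : ℝ), t ^ (a - 1) * Real.exp (-(Real.pi * ‖z‖ ^ 2 * t))
      = Real.pi ^ (-a) * Real.Gamma a / ‖z‖ ^ (2 * a) := by
  have hz' : 0 < ‖z‖ := norm_pos_iff.2 hz
  have hp := Real.pi_pos
  rw [Real.integral_rpow_mul_exp_neg_mul_Ioi ha (by positivity), one_div,
    Real.inv_rpow (by positivity), Real.mul_rpow hp.le (by positivity), mul_inv,
    ← Real.rpow_neg hp.le, ← Real.rpow_natCast ‖z‖ 2, ← Real.rpow_mul hz'.le, div_eq_mul_inv]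
  push_cast
  ring

theorem integrable_subordination (hd : 0 < d) {s : ℝ} (hs0 : 0 < s) (hs1 : s < 1) (j : Fin d)
    (ξ : E d) :
    Integrable (fun p : E d × ℝ =>
      (1 - Complex.exp (↑(-2 * Real.pi * inner ℝ p.1 ξ) * Complex.I)) * ((p.1 j : ℝ) : ℂ) *
        ((p.2 ^ (((d : ℝ) + s + 1) / 2 - 1) *
          Real.exp (-(Real.pi * ‖p.1‖ ^ 2 * p.2)) : ℝ) : ℂ))
      ((volume : Measure (E d)).prod (volume.restrict (Ioi (0 : ℝ)))) := by
  have : Nonempty (Fin d) := ⟨⟨0, hd⟩⟩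
  have : Nontrivial (E d) := inferInstance
  have hp := Real.pi_pos
  have ha : 0 < ((d : ℝ) + s + 1) / 2 := by positivity
  have h0 : ∀ᵐ z : E d, z ≠ 0 := by
    simp [ae_iff, measure_singleton]
  rw [integrable_prod_iff]
  · constructor
    · filter_upwards [h0] with z hz
      refine Integrable.const_mul (Integrable.ofReal (f := fun t : ℝ =>
        t ^ (((d : ℝ) + s + 1) / 2 - 1) * Real.exp (-(Real.pi * ‖z‖ ^ 2 * t))) ?_) _
      -- A non-integrable function would have integral 0 by convention, whereas the value of this
      -- integral is known and positive.
      by_contra hcon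
      have := integral_rpow_mul_gaussian ha hz
      rw [integral_undef hcon] at this
      have hz' : 0 < ‖z‖ := norm_pos_iff.2 hz
      have h2 : 0 < Real.Gamma (((d : ℝ) + s + 1) / 2) := Real.Gamma_pos_of_pos ha
      have : 0 < Real.pi ^ (-(((d : ℝ) + s + 1) / 2)) * Real.Gamma (((d : ℝ) + s + 1) / 2) /
        ‖z‖ ^ (2 * (((d : ℝ) + s + 1) / 2)) := by positivity
      linarith
    · refine ((integrable_rieszKernel hd hs0 hs1 j ξ).norm.const_mul
        (Real.pi ^ (-(((d : ℝ) + s + 1) / 2)) * Real.Gamma (((d : ℝ) + s + 1) / 2))).congr ?_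
      filter_upwards [h0] with z hz
      have e : ∀ t ∈ Ioi (0 : ℝ),
          ‖(1 - Complex.exp (↑(-2 * Real.pi * inner ℝ z ξ) * Complex.I)) * ((z j : ℝ) : ℂ) *
            ((t ^ (((d : ℝ) + s + 1) / 2 - 1) * Real.exp (-(Real.pi * ‖z‖ ^ 2 * t)) : ℝ) : ℂ)‖
          = ‖(1 - Complex.exp (↑(-2 * Real.pi * inner ℝ z ξ) * Complex.I)) * ((z j : ℝ) : ℂ)‖ *
            (t ^ (((d : ℝ) + s + 1) / 2 - 1) * Real.exp (-(Real.pi * ‖z‖ ^ 2 * t))) := by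
        intro t ht
        have ht : 0 < t := ht
        rw [norm_mul _ (((t ^ (((d : ℝ) + s + 1) / 2 - 1) * _ : ℝ) : ℂ)), Complex.norm_real,
          Real.norm_of_nonneg (by positivity)]
      rw [setIntegral_congr_fun measurableSet_Ioi e, integral_const_mul,
        integral_rpow_mul_gaussian ha hz, norm_mul, norm_mul, Complex.norm_real, Complex.norm_real,
        norm_div, Real.norm_of_nonneg (Real.rpow_nonneg (norm_nonneg z) _),
        show 2 * (((d : ℝ) + s + 1) / 2) = (d : ℝ) + s + 1 by ring]
      ring
  · refine Measurable.aestronglyMeasurable ?_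
    refine Measurable.mul (Continuous.measurable (by fun_prop)) ?_
    refine Complex.continuous_ofReal.measurable.comp ?_
    exact Measurable.mul (by fun_prop) (by fun_prop)

theorem integral_one_sub_fourierChar_mul {g : E d → ℝ} (hg : Integrable g) (ξ : E d) :
    ∫ z, (1 - Complex.exp (↑(-2 * Real.pi * inner ℝ z ξ) * Complex.I)) * (g z : ℂ)
      = ft g 0 - ft g ξ := by
  rw [ft_apply, ft_apply, ← integral_sub (integrable_fourier_integrand hg 0)
    (integrable_fourier_integrand hg ξ)]
  simp [sub_mul]

theorem integrable_coord_mul_gaussian {t : ℝ} (ht : 0 < t) (j : Fin d) :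
    Integrable fun z : E d => z j * Real.exp (-(Real.pi * ‖z‖ ^ 2 * t)) := by
  refine ((integrable_gaussian_norm (d := d) (half_pos ht)).const_mul
    (1 + 2 / (Real.pi * t))).mono' (Continuous.aestronglyMeasurable (by fun_prop))
    (Eventually.of_forall fun z => ?_)
  rw [norm_mul, Real.norm_of_nonneg (Real.exp_pos _).le]
  refine le_trans ?_ (norm_mul_gaussian_le ht ‖z‖)
  gcongr
  exact PiLp.norm_apply_le z j

/-- The Fourier multiplier of the singular integral defining the Riesz fractional derivative. -/
theorem integral_rieszKernel (hd : 0 < d) {s : ℝ} (hs0 : 0 < s) (hs1 : s < 1) (j : Fin d)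
    (ξ : E d) :
    rieszConst d s * ∫ z : E d, (1 - Complex.exp (↑(-2 * Real.pi * inner ℝ z ξ) * Complex.I)) *
      ((z j / ‖z‖ ^ ((d : ℝ) + s + 1) : ℝ) : ℂ) = rieszSymbol s j ξ := by
  have : Nonempty (Fin d) := ⟨⟨0, hd⟩⟩
  have : Nontrivial (E d) := inferInstance
  rcases eq_or_ne ξ 0 with rfl | hξ
  · simp [rieszSymbol]
  have hξ' : 0 < ‖ξ‖ := norm_pos_iff.2 hξ
  have hp := Real.pi_pos
  have ha : 0 < ((d : ℝ) + s + 1) / 2 := by positivity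
  have hb : 0 < (1 - s) / 2 := by linarith
  set a := ((d : ℝ) + s + 1) / 2 with ha_def
  have h0 : ∀ᵐ z : E d, z ≠ 0 := by simp [ae_iff, measure_singleton]
  have hG : 0 < Real.Gamma a := Real.Gamma_pos_of_pos ha
  have hG' : 0 < Real.Gamma ((1 - s) / 2) := Real.Gamma_pos_of_pos hb
  -- Subordination with 2a = d + s + 1 replaces the power of ‖z‖ by Gaussians. After Fubini the
  -- z-integral is the transform of z_j times a Gaussian, whose value at frequency 0 vanishes, and
  -- the remaining t-integral is a Gamma integral of parameter (1 - s)/2.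
  have key : ((Real.pi ^ (-a) * Real.Gamma a : ℝ) : ℂ) *
      ∫ z : E d, (1 - Complex.exp (↑(-2 * Real.pi * inner ℝ z ξ) * Complex.I)) *
        ((z j / ‖z‖ ^ ((d : ℝ) + s + 1) : ℝ) : ℂ)
      = Complex.I * ((ξ j * ((1 / (Real.pi * ‖ξ‖ ^ 2)) ^ ((1 - s) / 2) *
        Real.Gamma ((1 - s) / 2)) : ℝ) : ℂ) := by
    calc _ = ∫ z : E d, ∫ t in Ioi (0 : ℝ),
          (1 - Complex.exp (↑(-2 * Real.pi * inner ℝ z ξ) * Complex.I)) * ((z j : ℝ) : ℂ) *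
            ((t ^ (a - 1) * Real.exp (-(Real.pi * ‖z‖ ^ 2 * t)) : ℝ) : ℂ) := by
          rw [← integral_const_mul]
          refine integral_congr_ae ?_
          filter_upwards [h0] with z hz
          rw [integral_const_mul, integral_complex_ofReal, integral_rpow_mul_gaussian ha hz,
            show 2 * a = (d : ℝ) + s + 1 by rw [ha_def]; ring]
          push_cast
          ring
      _ = ∫ t in Ioi (0 : ℝ), ∫ z : E d,
          (1 - Complex.exp (↑(-2 * Real.pi * inner ℝ z ξ) * Complex.I)) * ((z j : ℝ) : ℂ) *
            ((t ^ (a - 1) * Real.exp (-(Real.pi * ‖z‖ ^ 2 * t)) : ℝ) : ℂ) :=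
          integral_integral_swap (integrable_subordination hd hs0 hs1 j ξ)
      _ = ∫ t in Ioi (0 : ℝ), Complex.I * ((ξ j * (t ^ (-1 - (1 - s) / 2) *
            Real.exp (-(Real.pi * ‖ξ‖ ^ 2 / t))) : ℝ) : ℂ) := by
          refine setIntegral_congr_fun measurableSet_Ioi fun t ht => ?_
          have ht : 0 < t := ht
          have e : ∀ z : E d, (1 - Complex.exp (↑(-2 * Real.pi * inner ℝ z ξ) * Complex.I)) *
              ((z j : ℝ) : ℂ) * ((t ^ (a - 1) * Real.exp (-(Real.pi * ‖z‖ ^ 2 * t)) : ℝ) : ℂ)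
              = ((t ^ (a - 1) : ℝ) : ℂ) *
                ((1 - Complex.exp (↑(-2 * Real.pi * inner ℝ z ξ) * Complex.I)) *
                ((z j * Real.exp (-(Real.pi * ‖z‖ ^ 2 * t)) : ℝ) : ℂ)) := by
            intro z; push_cast; ring
          simp only [e]
          rw [integral_const_mul, integral_one_sub_fourierChar_mul
            (integrable_coord_mul_gaussian ht j), ft_coord_mul_gaussian ht,
            ft_coord_mul_gaussian ht, show -1 - (1 - s) / 2 = (a - 1) + (-(d : ℝ) / 2 - 1) by
              rw [ha_def]; ring, Real.rpow_add ht]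
          simp
          ring
      _ = _ := by
          rw [integral_const_mul, integral_complex_ofReal, integral_const_mul,
            integral_rpow_mul_exp_neg_div (by positivity) hb]
  have hne : ((Real.pi ^ (-a) * Real.Gamma a : ℝ) : ℂ) ≠ 0 := by
    exact_mod_cast (by positivity : Real.pi ^ (-a) * Real.Gamma a ≠ 0)
  have hI := eq_div_of_mul_eq hne ((mul_comm _ _).trans key)
  rw [hI, rieszSymbol]
  -- The normalisation c_{d,s} is exactly what cancels both Gamma factors and the powers of π.
  have hreal : rieszConst d s * (ξ j * ((1 / (Real.pi * ‖ξ‖ ^ 2)) ^ ((1 - s) / 2) *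
        Real.Gamma ((1 - s) / 2))) / (Real.pi ^ (-a) * Real.Gamma a)
      = 2 * Real.pi * ξ j * (2 * Real.pi * ‖ξ‖) ^ (s - 1) := by
    have e1 : (1 / (Real.pi * ‖ξ‖ ^ 2)) ^ ((1 - s) / 2)
        = Real.pi ^ (-((1 - s) / 2)) * ‖ξ‖ ^ (s - 1) := by
      rw [one_div, Real.inv_rpow (by positivity), ← Real.rpow_neg (by positivity),
        Real.mul_rpow hp.le (by positivity), ← Real.rpow_natCast ‖ξ‖ 2, ← Real.rpow_mul hξ'.le]
      congr 2
      push_cast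
      ring
    have e2 : (2 * Real.pi * ‖ξ‖) ^ (s - 1)
        = 2 ^ s / 2 * (Real.pi ^ (s - 1) * ‖ξ‖ ^ (s - 1)) := by
      rw [mul_assoc, Real.mul_rpow (by norm_num) (by positivity), Real.mul_rpow hp.le hξ'.le,
        Real.rpow_sub_one (by norm_num)]
    have e3 : Real.pi ^ (-(d : ℝ) / 2) * Real.pi ^ (-((1 - s) / 2))
        = Real.pi ^ (s - 1) * Real.pi * Real.pi ^ (-a) := by
      nth_rewrite 4 [← Real.rpow_one Real.pi]
      rw [← Real.rpow_add hp, ← Real.rpow_add hp, ← Real.rpow_add hp]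
      congr 1
      rw [ha_def]
      ring
    rw [e1, e2, rieszConst, ← ha_def, div_eq_iff (by positivity)]
    calc _ = 2 ^ s * ξ j * ‖ξ‖ ^ (s - 1) * Real.Gamma a *
          (Real.pi ^ (-(d : ℝ) / 2) * Real.pi ^ (-((1 - s) / 2))) *
          (Real.Gamma ((1 - s) / 2) / Real.Gamma ((1 - s) / 2)) := by ring
      _ = _ := by rw [e3, div_self hG'.ne']; ring
  have hc := congrArg (fun r : ℝ => Complex.I * (r : ℂ)) hreal
  simp only at hc
  push_cast at hc ⊢
  rw [show ∀ x y w : ℂ, x * (Complex.I * y / w) = Complex.I * (x * y / w) by intros; ring]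
  rw [hc]
  ring

end Multiplier

/-! ### Riesz derivatives of test functions -/

/-- The `j`-th component of the Riesz fractional gradient of a smooth compactly supported
function. -/
def rieszDeriv {d : ℕ} (s : ℝ) (j : Fin d) (φ : E d → ℝ) (x : E d) : ℝ :=
  if s = 1 then fderiv ℝ φ x (EuclideanSpace.single j 1)
  else rieszConst d s * ∫ z, (φ x - φ (x - z)) * (z j / ‖z‖ ^ ((d : ℝ) + s + 1))

/-- Smooth functions with compact support in `Ω`. -/
structure IsTestFunction {d : ℕ} (Ω : Set (E d)) (φ : E d → ℝ) : Prop where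
  contDiff : ContDiff ℝ ∞ φ
  hasCompactSupport : HasCompactSupport φ
  tsupport_subset : tsupport φ ⊆ Ω

section TestFunctions

variable {d : ℕ} {Ω : Set (E d)} {φ : E d → ℝ}

namespace IsTestFunction

theorem integrable (h : IsTestFunction Ω φ) : Integrable φ :=
  h.contDiff.continuous.integrable_of_hasCompactSupport h.hasCompactSupport

theorem memLp (h : IsTestFunction Ω φ) (p : ℝ≥0∞) : MemLp φ p :=
  h.contDiff.continuous.memLp_of_hasCompactSupport h.hasCompactSupport

theorem fderiv_apply (h : IsTestFunction Ω φ) (v : E d) :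
    IsTestFunction univ fun x => fderiv ℝ φ x v :=
  ⟨(h.contDiff.fderiv_right (m := ∞) (by simp)).clm_apply contDiff_const,
    h.hasCompactSupport.fderiv_apply (𝕜 := ℝ) v, subset_univ _⟩

theorem exists_norm_sub_le (h : IsTestFunction Ω φ) :
    ∃ C, 0 ≤ C ∧ ∀ x z, |φ x - φ (x - z)| ≤ C * min ‖z‖ 1 := by
  obtain ⟨L, hL⟩ := ContDiff.lipschitzWith_of_hasCompactSupport h.hasCompactSupport h.contDiff
    (by simp)
  obtain ⟨M, hM⟩ := h.contDiff.continuous.bounded_above_of_compact_support h.hasCompactSupport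
  have hM0 : 0 ≤ M := (norm_nonneg _).trans (hM 0)
  refine ⟨L + 2 * M, by positivity, fun x z => ?_⟩
  rcases le_total ‖z‖ 1 with hz | hz
  · rw [min_eq_left hz]
    have := hL.dist_le_mul x (x - z)
    rw [Real.dist_eq, dist_eq_norm, sub_sub_cancel] at this
    nlinarith [norm_nonneg z]
  · rw [min_eq_right hz]
    have h1 := hM x
    have h2 := hM (x - z)
    rw [Real.norm_eq_abs] at h1 h2
    have := abs_sub (φ x) (φ (x - z))
    have h3 : (0 : ℝ) ≤ L := L.2
    linarith

theorem integrable_sub_translate (h : IsTestFunction Ω φ) (z : E d) :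
    Integrable fun x => φ x - φ (x - z) :=
  h.integrable.sub (h.integrable.comp_sub_right z)

/-- For ‖z‖ ≤ 1 the difference is supported in one fixed ball, so its pointwise bound integrates;
for larger z the L¹ norms of the two terms suffice. The factor min(‖z‖, 1) is what the kernel needs
to become integrable. -/
theorem exists_integral_norm_sub_le (h : IsTestFunction Ω φ) :
    ∃ C, 0 ≤ C ∧ ∀ z, ∫ x, |φ x - φ (x - z)| ≤ C * min ‖z‖ 1 := by
  obtain ⟨C, hC0, hC⟩ := h.exists_norm_sub_le
  obtain ⟨R, hR⟩ := h.hasCompactSupport.isCompact.isBounded.subset_closedBall (0 : E d)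
  set V := (volume : Measure (E d)).real (Metric.closedBall 0 (R + 1)) with hV
  have hV0 : 0 ≤ V := measureReal_nonneg
  have hN0 : 0 ≤ ∫ x, |φ x| := integral_nonneg fun x => abs_nonneg _
  refine ⟨C * V + 2 * ∫ x, |φ x|, by positivity, fun z => ?_⟩
  rcases le_total ‖z‖ 1 with hz | hz
  · have hind : Integrable ((Metric.closedBall (0 : E d) (R + 1)).indicator
        fun _ => C * min ‖z‖ 1) :=
      (integrable_indicator_iff Metric.isClosed_closedBall.measurableSet).2
        (integrableOn_const (isCompact_closedBall _ _).measure_lt_top.ne)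
    calc ∫ x, |φ x - φ (x - z)|
        ≤ ∫ x, (Metric.closedBall (0 : E d) (R + 1)).indicator (fun _ => C * min ‖z‖ 1) x := by
          refine integral_mono (h.integrable_sub_translate z).norm hind fun x => ?_
          by_cases hx : x ∈ Metric.closedBall (0 : E d) (R + 1)
          · rw [indicator_of_mem hx]; exact hC x z
          · have hx' : R + 1 < ‖x‖ := by simpa using hx
            have h1 : φ x = 0 := image_eq_zero_of_notMem_tsupport fun hm => by
              have := hR hm
              rw [mem_closedBall_zero_iff] at this
              linarith
            have h2 : φ (x - z) = 0 := image_eq_zero_of_notMem_tsupport fun hm => by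
              have := hR hm
              rw [mem_closedBall_zero_iff] at this
              have := norm_sub_norm_le x z
              linarith
            rw [indicator_of_notMem hx]
            simp [h1, h2]
      _ = V * (C * min ‖z‖ 1) := by
          rw [integral_indicator Metric.isClosed_closedBall.measurableSet, setIntegral_const,
            smul_eq_mul]
      _ ≤ _ := by
          have : 0 ≤ min ‖z‖ 1 := by positivity
          nlinarith [mul_nonneg hN0 this]
  · rw [min_eq_right hz, mul_one]
    calc ∫ x, |φ x - φ (x - z)| ≤ ∫ x, (|φ x| + |φ (x - z)|) :=
          integral_mono (h.integrable_sub_translate z).norm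
            (h.integrable.norm.add (h.integrable.comp_sub_right z).norm) fun x => abs_sub _ _
      _ = (∫ x, |φ x|) + ∫ x, |φ (x - z)| :=
          integral_add h.integrable.norm (h.integrable.comp_sub_right z).norm
      _ = 2 * ∫ x, |φ x| := by
          rw [integral_sub_right_eq_self (fun x => |φ x|) z]; ring
      _ ≤ _ := by nlinarith [mul_nonneg hC0 hV0]

theorem measurable_kernel (s : ℝ) (j : Fin d) :
    Measurable fun z : E d => z j / ‖z‖ ^ ((d : ℝ) + s + 1) :=
  Measurable.div (by fun_prop) (by fun_prop)

theorem integrable_kernel (h : IsTestFunction Ω φ) (hd : 0 < d) {s : ℝ} (hs0 : 0 < s)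
    (hs1 : s < 1) (j : Fin d) :
    Integrable (fun p : E d × E d => (φ p.1 - φ (p.1 - p.2)) *
      (p.2 j / ‖p.2‖ ^ ((d : ℝ) + s + 1))) (volume.prod volume) := by
  obtain ⟨C, hC0, hC⟩ := h.exists_integral_norm_sub_le
  have hc := h.contDiff.continuous
  have hmeas : AEStronglyMeasurable (fun p : E d × E d => (φ p.1 - φ (p.1 - p.2)) *
      (p.2 j / ‖p.2‖ ^ ((d : ℝ) + s + 1))) (volume.prod volume) := by
    refine Measurable.aestronglyMeasurable (Measurable.mul (Continuous.measurable (by fun_prop)) ?_)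
    exact (measurable_kernel s j).comp measurable_snd
  rw [integrable_prod_iff' hmeas]
  refine ⟨Eventually.of_forall fun z => (h.integrable_sub_translate z).mul_const
    (z j / ‖z‖ ^ ((d : ℝ) + s + 1)), ?_⟩
  refine ((integrable_min_norm_mul_rpow hd hs0 hs1).const_mul C).mono'
    hmeas.norm.prod_swap.integral_prod_right' (Eventually.of_forall fun z => ?_)
  rw [Real.norm_of_nonneg (integral_nonneg fun x => norm_nonneg _)]
  simp only [norm_mul]
  rw [integral_mul_const, ← mul_assoc]
  refine mul_le_mul (hC z) ?_ (norm_nonneg _) (by positivity)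
  rw [norm_div, Real.norm_of_nonneg (Real.rpow_nonneg (norm_nonneg z) _)]
  exact coord_div_rpow_le hd hs0 j z

theorem integrable_kernel_right (h : IsTestFunction Ω φ) (hd : 0 < d) {s : ℝ} (hs0 : 0 < s)
    (hs1 : s < 1) (j : Fin d) (x : E d) :
    Integrable fun z => (φ x - φ (x - z)) * (z j / ‖z‖ ^ ((d : ℝ) + s + 1)) := by
  obtain ⟨C, hC0, hC⟩ := h.exists_norm_sub_le
  have hc := h.contDiff.continuous
  refine ((integrable_min_norm_mul_rpow hd hs0 hs1).const_mul C).mono'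
    ((Continuous.aestronglyMeasurable (by fun_prop)).mul
      (measurable_kernel s j).aestronglyMeasurable) (Eventually.of_forall fun z => ?_)
  rw [norm_mul, ← mul_assoc]
  refine mul_le_mul (hC x z) ?_ (norm_nonneg _) (by positivity)
  rw [norm_div, Real.norm_of_nonneg (Real.rpow_nonneg (norm_nonneg z) _)]
  exact coord_div_rpow_le hd hs0 j z

theorem integrable_rieszDeriv (h : IsTestFunction Ω φ) (hd : 0 < d) {s : ℝ} (hs0 : 0 < s)
    (hs1 : s ≤ 1) (j : Fin d) : Integrable (rieszDeriv s j φ) := by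
  rcases eq_or_lt_of_le hs1 with rfl | hs1
  · refine (h.fderiv_apply (EuclideanSpace.single j 1)).integrable.congr
      (Eventually.of_forall fun x => ?_)
    simp [rieszDeriv]
  · refine ((h.integrable_kernel hd hs0 hs1 j).integral_prod_left.const_mul
      (rieszConst d s)).congr (Eventually.of_forall fun x => ?_)
    simp [rieszDeriv, hs1.ne]

theorem exists_norm_rieszDeriv_le (h : IsTestFunction Ω φ) (hd : 0 < d) {s : ℝ} (hs0 : 0 < s)
    (hs1 : s ≤ 1) (j : Fin d) : ∃ C, ∀ x, ‖rieszDeriv s j φ x‖ ≤ C := by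
  rcases eq_or_lt_of_le hs1 with rfl | hs1
  · simpa [rieszDeriv] using (h.fderiv_apply _).contDiff.continuous.bounded_above_of_compact_support
      (h.fderiv_apply (EuclideanSpace.single j 1)).hasCompactSupport
  · obtain ⟨C, hC0, hC⟩ := h.exists_norm_sub_le
    refine ⟨‖rieszConst d s‖ * ∫ z : E d, C * (min ‖z‖ 1 * ‖z‖ ^ (-((d : ℝ) + s))), fun x => ?_⟩
    rw [rieszDeriv, if_neg hs1.ne, norm_mul]
    refine mul_le_mul_of_nonneg_left ?_ (norm_nonneg _)
    refine norm_integral_le_of_norm_le ((integrable_min_norm_mul_rpow hd hs0 hs1).const_mul C)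
      (Eventually.of_forall fun z => ?_)
    rw [norm_mul, ← mul_assoc]
    refine mul_le_mul (hC x z) ?_ (norm_nonneg _) (by positivity)
    rw [norm_div, Real.norm_of_nonneg (Real.rpow_nonneg (norm_nonneg z) _)]
    exact coord_div_rpow_le hd hs0 j z

/-- An integrable bounded function is square integrable. -/
theorem memLp_rieszDeriv (h : IsTestFunction Ω φ) (hd : 0 < d) {s : ℝ} (hs0 : 0 < s)
    (hs1 : s ≤ 1) (j : Fin d) : MemLp (rieszDeriv s j φ) 2 := by
  obtain ⟨C, hC⟩ := h.exists_norm_rieszDeriv_le hd hs0 hs1 j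
  have hi := h.integrable_rieszDeriv hd hs0 hs1 j
  rw [memLp_two_iff_integrable_sq hi.1]
  simpa only [sq] using hi.bdd_mul hi.1 (Eventually.of_forall hC)

/-- The partial Riesz derivative of a test function is a Fourier multiplier. -/
theorem ft_rieszDeriv (h : IsTestFunction Ω φ) (hd : 0 < d) {s : ℝ} (hs0 : 0 < s)
    (hs1 : s ≤ 1) (j : Fin d) (ξ : E d) :
    ft (rieszDeriv s j φ) ξ = rieszSymbol s j ξ * ft φ ξ := by
  rcases eq_or_lt_of_le hs1 with rfl | hs1
  · have e : rieszDeriv 1 j φ = fun x => fderiv ℝ φ x (EuclideanSpace.single j 1) := by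
      ext x; simp [rieszDeriv]
    rw [e, ft_fderiv_apply h.integrable (h.contDiff.differentiable (by simp))]
    · simp [rieszSymbol]
    · exact (h.contDiff.continuous_fderiv (by simp)).integrable_of_hasCompactSupport
        (h.hasCompactSupport.fderiv (𝕜 := ℝ))
  have e : rieszDeriv s j φ = fun x => rieszConst d s *
      ∫ z, (φ x - φ (x - z)) * (z j / ‖z‖ ^ ((d : ℝ) + s + 1)) := by
    ext x; simp [rieszDeriv, hs1.ne]
  have hk := h.integrable_kernel hd hs0 hs1 j
  rw [e, ft_const_mul, ← integral_rieszKernel hd hs0 hs1 j ξ, mul_assoc]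
  congr 1
  rw [ft_apply, ← integral_mul_const]
  -- Integrating in x first turns the translation by z into the factor 1 - e^(-2πi z·ξ); what
  -- remains in z is the kernel integral already evaluated.
  calc _ = ∫ x, ∫ z, Complex.exp (↑(-2 * Real.pi * inner ℝ x ξ) * Complex.I) *
        (((φ x - φ (x - z)) * (z j / ‖z‖ ^ ((d : ℝ) + s + 1)) : ℝ) : ℂ) := by
        congr with x
        rw [integral_const_mul, integral_complex_ofReal]
    _ = ∫ z, ∫ x, Complex.exp (↑(-2 * Real.pi * inner ℝ x ξ) * Complex.I) *
        (((φ x - φ (x - z)) * (z j / ‖z‖ ^ ((d : ℝ) + s + 1)) : ℝ) : ℂ) := by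
        refine integral_integral_swap ?_
        refine hk.ofReal.bdd_mul (c := 1) (Continuous.aestronglyMeasurable (by fun_prop)) ?_
        exact Eventually.of_forall fun x => (Complex.norm_exp_ofReal_mul_I _).le
    _ = _ := by
        congr with z
        have e2 : ft (fun x => φ (x - z)) ξ
            = Complex.exp (↑(-2 * Real.pi * inner ℝ z ξ) * Complex.I) * ft φ ξ :=
          ft_comp_sub φ z ξ
        have e3 : ft (fun x => φ x - φ (x - z)) ξ
            = (1 - Complex.exp (↑(-2 * Real.pi * inner ℝ z ξ) * Complex.I)) * ft φ ξ := by
          rw [ft_sub h.integrable (h.integrable.comp_sub_right z), e2]; ring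
        rw [ft_apply] at e3
        have e4 : ∀ x, Complex.exp (↑(-2 * Real.pi * inner ℝ x ξ) * Complex.I) *
            (((φ x - φ (x - z)) * (z j / ‖z‖ ^ ((d : ℝ) + s + 1)) : ℝ) : ℂ)
            = Complex.exp (↑(-2 * Real.pi * inner ℝ x ξ) * Complex.I) * ((φ x - φ (x - z) : ℝ) : ℂ)
              * ((z j / ‖z‖ ^ ((d : ℝ) + s + 1) : ℝ) : ℂ) := by
          intro x; push_cast; ring
        simp only [e4]
        rw [integral_mul_const, e3]
        ring

end IsTestFunction

theorem IsTestFunction.component {Φ : E d → E d} (hΦ : ContDiff ℝ ∞ Φ) (hc : HasCompactSupport Φ)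
    (j : Fin d) : IsTestFunction univ fun x => Φ x j :=
  ⟨(contDiff_euclidean.1 hΦ) j, hc.comp_left (g := fun v : E d => v j) rfl, subset_univ _⟩

/-- The change of variables y = x - z, with integrability of each component allowing the sum to
leave the integral, reduces the vector operator to scalar multipliers. -/
theorem rieszDiv_eq_sum (hd : 0 < d) {s : ℝ} (hs0 : 0 < s) (hs1 : s ≤ 1) {Φ : E d → E d}
    (hΦ : ContDiff ℝ ∞ Φ) (hc : HasCompactSupport Φ) (x : E d) :
    rieszDiv s Φ x = ∑ j, rieszDeriv s j (fun x => Φ x j) x := by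
  rcases eq_or_lt_of_le hs1 with rfl | hs1
  · simp only [rieszDiv, rieszDeriv, if_true]
    refine Finset.sum_congr rfl fun j _ => ?_
    have h := ((EuclideanSpace.proj (𝕜 := ℝ) j).hasFDerivAt.comp x
      (hΦ.differentiable (by simp) x).hasFDerivAt).fderiv
    exact (congrArg (fun L => L (EuclideanSpace.single j 1)) h).symm
  · simp only [rieszDiv, rieszDeriv, if_neg hs1.ne]
    rw [← Finset.mul_sum, ← integral_finsetSum _ fun j _ =>
      (IsTestFunction.component hΦ hc j).integrable_kernel_right hd hs0 hs1 j x,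
      ← integral_sub_left_eq_self _ volume x]
    congr 2
    ext z
    rw [sub_sub_cancel, PiLp.inner_apply, Finset.sum_div]
    refine Finset.sum_congr rfl fun j _ => ?_
    simp
    ring

end TestFunctions

/-! ### Dominated convergence in L² -/

section SquareIntegrable

variable {α F : Type*} [MeasurableSpace α] {μ : Measure α} [NormedAddCommGroup F]

theorem eLpNorm_two_sq (f : α → F) : eLpNorm f 2 μ ^ 2 = ∫⁻ x, ‖f x‖ₑ ^ 2 ∂μ := by
  have h := eLpNorm_nnreal_pow_eq_lintegral (μ := μ) (f := f) (p := 2) two_ne_zero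
  simpa using h

theorem eLpNorm_two_eq (f : α → F) :
    eLpNorm f 2 μ = (∫⁻ x, ‖f x‖ₑ ^ 2 ∂μ) ^ (2⁻¹ : ℝ) := by
  rw [← eLpNorm_two_sq, ← ENNReal.rpow_natCast, ← ENNReal.rpow_mul]
  simp

theorem tendsto_eLpNorm_two_of_dominated {ι : Type*} {l : Filter ι} [l.IsCountablyGenerated]
    {f : ι → α → F} {g : α → ℝ} (hg : MemLp g 2 μ) (hf : ∀ᶠ i in l, AEStronglyMeasurable (f i) μ)
    (hfg : ∀ᶠ i in l, ∀ᵐ x ∂μ, ‖f i x‖ ≤ g x)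
    (hlim : ∀ᵐ x ∂μ, Tendsto (fun i => f i x) l (𝓝 0)) :
    Tendsto (fun i => eLpNorm (f i) 2 μ) l (𝓝 0) := by
  have h : Tendsto (fun i => ∫⁻ x, ‖f i x‖ₑ ^ 2 ∂μ) l (𝓝 (∫⁻ _, 0 ∂μ)) := by
    refine tendsto_lintegral_filter_of_dominated_convergence' (fun x => ‖g x‖ₑ ^ 2) ?_ ?_ ?_ ?_
    · filter_upwards [hf] with i hi using hi.enorm.pow_const 2
    · filter_upwards [hfg] with i hi
      filter_upwards [hi] with x hx
      gcongr
      exact enorm_le_iff_norm_le.2 (hx.trans (Real.le_norm_self _))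
    · rw [← eLpNorm_two_sq]
      exact ENNReal.pow_ne_top hg.2.ne
    · filter_upwards [hlim] with x hx
      have := ENNReal.Tendsto.pow (n := 2) hx.enorm
      simpa using this
  rw [lintegral_zero] at h
  have h2 := ((ENNReal.continuous_rpow_const (y := 2⁻¹)).tendsto 0).comp h
  simpa [Function.comp_def, eLpNorm_two_eq] using h2

theorem tendsto_eLpNorm_sum_zero {ι κ : Type*} {l : Filter ι} {p : ℝ≥0∞} (hp : 1 ≤ p)
    (s : Finset κ) {f : κ → ι → α → F} (hf : ∀ k ∈ s, ∀ᶠ i in l, AEStronglyMeasurable (f k i) μ)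
    (h : ∀ k ∈ s, Tendsto (fun i => eLpNorm (f k i) p μ) l (𝓝 0)) :
    Tendsto (fun i => eLpNorm (fun x => ∑ k ∈ s, f k i x) p μ) l (𝓝 0) := by
  have h1 : Tendsto (fun i => ∑ k ∈ s, eLpNorm (f k i) p μ) l (𝓝 0) := by
    simpa using tendsto_finsetSum s h
  refine tendsto_of_tendsto_of_tendsto_of_le_of_le' tendsto_const_nhds h1
    (Eventually.of_forall fun _ => zero_le) ?_
  filter_upwards [(Finset.eventually_all s).2 hf] with i hi
  have := eLpNorm_sum_le (s := s) (f := fun k => f k i) hi hp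
  rwa [show (∑ k ∈ s, f k i) = fun x => ∑ k ∈ s, f k i x from
    funext fun x => Finset.sum_apply x s _] at this

end SquareIntegrable

/-! ### Riesz gradients of test functions and continuity in the order -/

/-- The Riesz fractional gradient of a smooth compactly supported function. -/
def rieszGrad {d : ℕ} (s : ℝ) (φ : E d → ℝ) (x : E d) : E d :=
  WithLp.toLp 2 fun j => rieszDeriv s j φ x

section Gradient

variable {d : ℕ} {Ω : Set (E d)} {φ χ : E d → ℝ}

theorem conj_rieszSymbol (s : ℝ) (j : Fin d) (ξ : E d) :
    conj (rieszSymbol s j ξ) = -rieszSymbol s j ξ := by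
  simp [rieszSymbol, Complex.conj_ofNat]

theorem norm_rieszSymbol (s : ℝ) (j : Fin d) (ξ : E d) :
    ‖rieszSymbol s j ξ‖ = 2 * Real.pi * |ξ j| * (2 * Real.pi * ‖ξ‖) ^ (s - 1) := by
  have hp := Real.pi_pos
  rw [rieszSymbol, norm_mul, norm_mul, norm_mul, norm_mul, Complex.norm_real, Complex.norm_real,
    Complex.norm_real, Complex.norm_I, Real.norm_of_nonneg hp.le,
    Real.norm_of_nonneg (by positivity : 0 ≤ (2 * Real.pi * ‖ξ‖) ^ (s - 1)), Real.norm_eq_abs]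
  simp

/-- Away from 0, factor out |2πξ|^(s-1). At ξ = 0 the left side is 0, and s > 0 makes the right side
vanish too. -/
theorem sum_norm_rieszSymbol_sq {s : ℝ} (hs : 0 < s) (ξ : E d) :
    ∑ j, ‖rieszSymbol s j ξ‖ ^ 2 = ((2 * Real.pi * ‖ξ‖) ^ s) ^ 2 := by
  have hp := Real.pi_pos
  rcases eq_or_ne ξ 0 with rfl | hξ
  · simp [norm_rieszSymbol, Real.zero_rpow hs.ne']
  have hξ' : 0 < ‖ξ‖ := norm_pos_iff.2 hξ
  have e : ∑ j, ‖rieszSymbol s j ξ‖ ^ 2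
      = (2 * Real.pi * (2 * Real.pi * ‖ξ‖) ^ (s - 1)) ^ 2 * ∑ j, ξ j ^ 2 := by
    rw [Finset.mul_sum]
    refine Finset.sum_congr rfl fun j _ => ?_
    rw [norm_rieszSymbol, ← sq_abs (ξ j)]
    ring
  rw [e, ← EuclideanSpace.real_norm_sq_eq, Real.rpow_sub_one (by positivity)]
  field_simp

theorem norm_rieszSymbol_le {s : ℝ} (hs : 0 < s) (j : Fin d) (ξ : E d) :
    ‖rieszSymbol s j ξ‖ ≤ (2 * Real.pi * ‖ξ‖) ^ s := by
  have hp := Real.pi_pos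
  refine (pow_le_pow_iff_left₀ (norm_nonneg _) (by positivity) two_ne_zero).1 ?_
  rw [← sum_norm_rieszSymbol_sq hs]
  exact Finset.single_le_sum (f := fun j => ‖rieszSymbol s j ξ‖ ^ 2)
    (fun i _ => by positivity) (Finset.mem_univ j)

theorem rpow_le_one_add {s x : ℝ} (hs0 : 0 < s) (hs1 : s ≤ 1) (hx : 0 ≤ x) : x ^ s ≤ 1 + x := by
  rcases le_total x 1 with h | h
  · linarith [Real.rpow_le_one hx h hs0.le]
  · have := Real.rpow_le_rpow_of_exponent_le h hs1
    rw [Real.rpow_one] at this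
    linarith

theorem measurable_rieszSymbol (s : ℝ) (j : Fin d) : Measurable (rieszSymbol s j) := by
  unfold rieszSymbol
  refine Measurable.mul (Continuous.measurable (by fun_prop)) ?_
  exact Complex.continuous_ofReal.measurable.comp (by fun_prop)

theorem tendsto_rieszSymbol (j : Fin d) (ξ : E d) (r : ℝ) :
    Tendsto (fun s => rieszSymbol s j ξ) (𝓝 r) (𝓝 (rieszSymbol r j ξ)) := by
  rcases eq_or_ne ξ 0 with rfl | hξ
  · simp [rieszSymbol]
  have hξ' : 0 < ‖ξ‖ := norm_pos_iff.2 hξ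
  have hp := Real.pi_pos
  unfold rieszSymbol
  refine Tendsto.const_mul _ ((Complex.continuous_ofReal.tendsto _).comp ?_)
  exact ((Real.continuous_const_rpow (by positivity)).comp
    (continuous_id.sub continuous_const)).tendsto r

namespace IsTestFunction

theorem memLp_ft (h : IsTestFunction Ω φ) : MemLp (ft φ) 2 :=
  RieszDirichlet.memLp_ft h.integrable (h.memLp 2)

/-- Symbols of order at most one act on the Fourier transforms of test functions. -/
theorem memLp_one_add_norm_mul_ft (h : IsTestFunction Ω φ) :
    MemLp (fun ξ => (1 + 2 * Real.pi * ‖ξ‖) * ‖ft φ ξ‖) 2 := by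
  have hp := Real.pi_pos
  have h1 : MemLp (fun ξ => ‖ft φ ξ‖ + ∑ j : Fin d, ‖ft (fun x => fderiv ℝ φ x
      (EuclideanSpace.single j 1)) ξ‖) 2 :=
    h.memLp_ft.norm.add (memLp_finsetSum _ fun j _ => (h.fderiv_apply _).memLp_ft.norm)
  refine h1.mono' ?_ (Eventually.of_forall fun ξ => ?_)
  · have := continuous_ft h.integrable
    exact Continuous.aestronglyMeasurable (by fun_prop)
  rw [Real.norm_of_nonneg (by positivity)]
  have e : ∀ j : Fin d, ‖ft (fun x => fderiv ℝ φ x (EuclideanSpace.single j 1)) ξ‖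
      = 2 * Real.pi * |ξ j| * ‖ft φ ξ‖ := by
    intro j
    rw [ft_fderiv_apply h.integrable (h.contDiff.differentiable (by simp))
      ((h.contDiff.continuous_fderiv (by simp)).integrable_of_hasCompactSupport
        (h.hasCompactSupport.fderiv (𝕜 := ℝ)))]
    simp [abs_of_pos hp]
  simp only [e]
  rw [← Finset.sum_mul, ← Finset.mul_sum]
  have hn : ‖ξ‖ ≤ ∑ j, |ξ j| := by
    rw [EuclideanSpace.norm_eq]
    refine (Real.sqrt_le_left (by positivity)).2 ?_
    simpa using Finset.sum_sq_le_sq_sum_of_nonneg (s := Finset.univ) (f := fun j => |ξ j|)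
      (fun j _ => abs_nonneg (ξ j))
  have : 2 * Real.pi * ‖ξ‖ * ‖ft φ ξ‖ ≤ 2 * Real.pi * (∑ j, |ξ j|) * ‖ft φ ξ‖ := by gcongr
  linarith

/-- By Plancherel, integration by parts is the statement that the symbol is purely imaginary. -/
theorem integral_rieszDeriv_mul (h : IsTestFunction Ω φ) (hχ : IsTestFunction univ χ)
    (hd : 0 < d) {s : ℝ} (hs0 : 0 < s) (hs1 : s ≤ 1) (j : Fin d) :
    ∫ x, rieszDeriv s j φ x * χ x = -∫ x, φ x * rieszDeriv s j χ x := by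
  have h1 := integral_conj_ft_mul_ft (h.integrable_rieszDeriv hd hs0 hs1 j)
    (h.memLp_rieszDeriv hd hs0 hs1 j) hχ.integrable (hχ.memLp 2)
  have h2 := integral_conj_ft_mul_ft h.integrable (h.memLp 2)
    (hχ.integrable_rieszDeriv hd hs0 hs1 j) (hχ.memLp_rieszDeriv hd hs0 hs1 j)
  rw [← Complex.ofReal_inj, Complex.ofReal_neg, ← h1, ← h2, ← integral_neg]
  congr with ξ
  rw [h.ft_rieszDeriv hd hs0 hs1, hχ.ft_rieszDeriv hd hs0 hs1, map_mul, conj_rieszSymbol]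
  ring

theorem memLp_rieszGrad (h : IsTestFunction Ω φ) (hd : 0 < d) {s : ℝ} (hs0 : 0 < s)
    (hs1 : s ≤ 1) : MemLp (rieszGrad s φ) 2 :=
  memLp_piLp_iff.2 fun j => h.memLp_rieszDeriv hd hs0 hs1 j

end IsTestFunction

theorem memLp_rieszDiv (hd : 0 < d) {s : ℝ} (hs0 : 0 < s) (hs1 : s ≤ 1) {Φ : E d → E d}
    (hΦ : ContDiff ℝ ∞ Φ) (hc : HasCompactSupport Φ) : MemLp (rieszDiv s Φ) 2 := by
  rw [funext (rieszDiv_eq_sum hd hs0 hs1 hΦ hc)]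
  exact memLp_finsetSum _ fun j _ =>
    (IsTestFunction.component hΦ hc j).memLp_rieszDeriv hd hs0 hs1 j

namespace IsTestFunction

theorem isRieszGradient (h : IsTestFunction Ω φ) (hd : 0 < d) {s : ℝ} (hs0 : 0 < s)
    (hs1 : s ≤ 1) : IsRieszGradient s φ (rieszGrad s φ) := by
  refine ⟨h.memLp 2, h.memLp_rieszGrad hd hs0 hs1, fun Φ hΦ hc => ?_⟩
  have hcomp := IsTestFunction.component hΦ hc
  have e1 : ∀ x, inner ℝ (rieszGrad s φ x) (Φ x) = ∑ j, rieszDeriv s j φ x * Φ x j := by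
    intro x
    rw [PiLp.inner_apply]
    refine Finset.sum_congr rfl fun j _ => ?_
    simp [rieszGrad, mul_comm]
  simp only [e1, rieszDiv_eq_sum hd hs0 hs1 hΦ hc, Finset.mul_sum]
  rw [integral_finsetSum, integral_finsetSum, ← Finset.sum_neg_distrib]
  · exact Finset.sum_congr rfl fun j _ => h.integral_rieszDeriv_mul (hcomp j) hd hs0 hs1 j
  · exact fun j _ => (h.memLp 2).integrable_mul ((hcomp j).memLp_rieszDeriv hd hs0 hs1 j)
  · exact fun j _ => (h.memLp_rieszDeriv hd hs0 hs1 j).integrable_mul ((hcomp j).memLp 2)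

/-- Plancherel in each component, the squared moduli of the symbols summing to |2πξ|^(2s). This is
the link between gradients and the frequency estimates. -/
theorem eLpNorm_rieszGrad (h : IsTestFunction Ω φ) (hd : 0 < d) {s : ℝ} (hs0 : 0 < s)
    (hs1 : s ≤ 1) : eLpNorm (rieszGrad s φ) 2 volume
      = eLpNorm (fun ξ => (2 * Real.pi * ‖ξ‖) ^ s * ‖ft φ ξ‖) 2 volume := by
  have hp := Real.pi_pos
  have e1 : ∀ x, ‖rieszGrad s φ x‖ₑ ^ 2 = ∑ j, ‖rieszDeriv s j φ x‖ₑ ^ 2 := by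
    intro x
    rw [← ofReal_norm, ← ENNReal.ofReal_pow (norm_nonneg _), EuclideanSpace.norm_sq_eq,
      ENNReal.ofReal_sum_of_nonneg fun j _ => by positivity]
    refine Finset.sum_congr rfl fun j _ => ?_
    rw [ENNReal.ofReal_pow (norm_nonneg _), ofReal_norm]
    rfl
  have e2 : ∀ ξ, ‖(2 * Real.pi * ‖ξ‖) ^ s * ‖ft φ ξ‖‖ₑ ^ 2
      = ∑ j, ‖ft (rieszDeriv s j φ) ξ‖ₑ ^ 2 := by
    intro ξ
    rw [← ofReal_norm, ← ENNReal.ofReal_pow (norm_nonneg _), norm_mul, norm_norm,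
      Real.norm_of_nonneg (by positivity), mul_pow, ← sum_norm_rieszSymbol_sq hs0, Finset.sum_mul,
      ENNReal.ofReal_sum_of_nonneg fun j _ => by positivity]
    refine Finset.sum_congr rfl fun j _ => ?_
    rw [← mul_pow, ← norm_mul, ENNReal.ofReal_pow (norm_nonneg _), ofReal_norm,
      h.ft_rieszDeriv hd hs0 hs1]
  have hm := fun j => h.memLp_rieszDeriv hd hs0 hs1 j
  have hi := fun j => h.integrable_rieszDeriv hd hs0 hs1 j
  rw [eLpNorm_two_eq, eLpNorm_two_eq]
  congr 1
  simp only [e1, e2]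
  rw [lintegral_finsetSum' _ fun j _ => (hm j).1.enorm.pow_const 2,
    lintegral_finsetSum' _ fun j _ => (continuous_ft (hi j)).aestronglyMeasurable.enorm.pow_const 2]
  refine Finset.sum_congr rfl fun j _ => ?_
  rw [← eLpNorm_two_sq, ← eLpNorm_two_sq, eLpNorm_ft (hi j) (hm j)]

/-- After Plancherel, the symbols converge pointwise and for every order in (0, 1] are at most 1 +
|2πξ|, so 2(1 + |2πξ|)|φ̂| is a square integrable majorant independent of s. -/
theorem tendsto_eLpNorm_rieszDeriv_sub (h : IsTestFunction Ω φ) (hd : 0 < d) {r : ℝ} (hr0 : 0 < r)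
    (hr1 : r ≤ 1) (j : Fin d) :
    Tendsto (fun s => eLpNorm (fun x => rieszDeriv s j φ x - rieszDeriv r j φ x) 2 volume)
      (𝓝[Ioc 0 1] r) (𝓝 0) := by
  have hp := Real.pi_pos
  have e : ∀ s ∈ Ioc (0 : ℝ) 1, eLpNorm (fun x => rieszDeriv s j φ x - rieszDeriv r j φ x) 2 volume
      = eLpNorm (fun ξ => (rieszSymbol s j ξ - rieszSymbol r j ξ) * ft φ ξ) 2 volume := by
    intro s hs
    refine (eLpNorm_ft ((h.integrable_rieszDeriv hd hs.1 hs.2 j).sub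
      (h.integrable_rieszDeriv hd hr0 hr1 j)) ((h.memLp_rieszDeriv hd hs.1 hs.2 j).sub
      (h.memLp_rieszDeriv hd hr0 hr1 j))).symm.trans ?_
    congr 1
    ext ξ
    refine (ft_sub (h.integrable_rieszDeriv hd hs.1 hs.2 j)
      (h.integrable_rieszDeriv hd hr0 hr1 j) ξ).trans ?_
    rw [h.ft_rieszDeriv hd hs.1 hs.2, h.ft_rieszDeriv hd hr0 hr1, sub_mul]
  have hlim : Tendsto (fun s => eLpNorm (fun ξ => (rieszSymbol s j ξ - rieszSymbol r j ξ) * ft φ ξ)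
      2 volume) (𝓝[Ioc 0 1] r) (𝓝 0) := by
    refine tendsto_eLpNorm_two_of_dominated (h.memLp_one_add_norm_mul_ft.const_mul 2)
      (Eventually.of_forall fun s => ?_) ?_ (Eventually.of_forall fun ξ => ?_)
    · exact ((measurable_rieszSymbol s j).sub (measurable_rieszSymbol r j)).aestronglyMeasurable.mul
        (continuous_ft h.integrable).aestronglyMeasurable
    · filter_upwards [self_mem_nhdsWithin] with s hs
      refine Eventually.of_forall fun ξ => ?_
      rw [norm_mul, ← mul_assoc]
      gcongr
      have h1 := norm_rieszSymbol_le hs.1 j ξ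
      have h2 := norm_rieszSymbol_le hr0 j ξ
      have h3 := rpow_le_one_add hs.1 hs.2 (by positivity : 0 ≤ 2 * Real.pi * ‖ξ‖)
      have h4 := rpow_le_one_add hr0 hr1 (by positivity : 0 ≤ 2 * Real.pi * ‖ξ‖)
      have := norm_sub_le (rieszSymbol s j ξ) (rieszSymbol r j ξ)
      linarith
    · have := ((tendsto_rieszSymbol j ξ r).sub_const (rieszSymbol r j ξ)).mul_const (ft φ ξ)
      rw [sub_self, zero_mul] at this
      exact this.mono_left nhdsWithin_le_nhds
  refine hlim.congr' ?_
  filter_upwards [self_mem_nhdsWithin] with s hs using (e s hs).symm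

theorem tendsto_eLpNorm_rieszGrad_sub (h : IsTestFunction Ω φ) (hd : 0 < d) {r : ℝ} (hr0 : 0 < r)
    (hr1 : r ≤ 1) :
    Tendsto (fun s => eLpNorm (fun x => rieszGrad s φ x - rieszGrad r φ x) 2 volume)
      (𝓝[Ioc 0 1] r) (𝓝 0) := by
  have e : ∀ s x, rieszGrad s φ x - rieszGrad r φ x
      = ∑ j, (rieszDeriv s j φ x - rieszDeriv r j φ x) • EuclideanSpace.single j (1 : ℝ) := by
    intro s x
    ext i
    simp [rieszGrad, Finset.sum_apply, Pi.single_apply]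
  simp only [e]
  refine tendsto_eLpNorm_sum_zero one_le_two _ (fun j _ => ?_) fun j _ => ?_
  · filter_upwards [self_mem_nhdsWithin] with s hs
    exact ((h.memLp_rieszDeriv hd hs.1 hs.2 j).sub
      (h.memLp_rieszDeriv hd hr0 hr1 j)).1.smul_const _
  · refine (h.tendsto_eLpNorm_rieszDeriv_sub hd hr0 hr1 j).congr fun s => ?_
    refine eLpNorm_congr_norm_ae (Eventually.of_forall fun x => ?_)
    rw [norm_smul]
    simp

end IsTestFunction

theorem tendsto_eLpNorm_rieszDiv_sub (hd : 0 < d) {r : ℝ} (hr0 : 0 < r)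
    (hr1 : r ≤ 1) {Φ : E d → E d} (hΦ : ContDiff ℝ ∞ Φ) (hc : HasCompactSupport Φ) :
    Tendsto (fun s => eLpNorm (fun x => rieszDiv s Φ x - rieszDiv r Φ x) 2 volume)
      (𝓝[Ioc 0 1] r) (𝓝 0) := by
  have hcomp := IsTestFunction.component hΦ hc
  have h : Tendsto (fun s => eLpNorm (fun x => ∑ j, (rieszDeriv s j (fun x => Φ x j) x -
      rieszDeriv r j (fun x => Φ x j) x)) 2 volume) (𝓝[Ioc 0 1] r) (𝓝 0) := by
    refine tendsto_eLpNorm_sum_zero one_le_two _ (fun j _ => ?_) fun j _ =>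
      (hcomp j).tendsto_eLpNorm_rieszDeriv_sub hd hr0 hr1 j
    filter_upwards [self_mem_nhdsWithin] with s hs
    exact (((hcomp j).memLp_rieszDeriv hd hs.1 hs.2 j).sub
      ((hcomp j).memLp_rieszDeriv hd hr0 hr1 j)).1
  refine h.congr' ?_
  filter_upwards [self_mem_nhdsWithin] with s hs
  congr 1
  ext x
  rw [rieszDiv_eq_sum hd hs.1 hs.2 hΦ hc, rieszDiv_eq_sum hd hr0 hr1 hΦ hc,
    Finset.sum_sub_distrib]

end Gradient

/-! ### Bessel potential norms: multiplication and translation -/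

/-- The weight `1 + |2πξ|^s`. -/
def sobolevWeight {d : ℕ} (s : ℝ) (ξ : E d) : ℝ := 1 + (2 * Real.pi * ‖ξ‖) ^ s

/-- The Bessel potential norm `‖(1 + |2πξ|^s) û‖_{L²}` of an integrable function. -/
def sobolevNorm {d : ℕ} (s : ℝ) (u : E d → ℝ) : ℝ≥0∞ :=
  eLpNorm (fun ξ => sobolevWeight s ξ * ‖ft u ξ‖) 2 volume

section Sobolev

variable {d : ℕ} {Ω : Set (E d)} {s : ℝ} {u v : E d → ℝ}

theorem one_le_sobolevWeight (s : ℝ) (ξ : E d) : 1 ≤ sobolevWeight s ξ := by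
  have hp := Real.pi_pos
  have : 0 ≤ (2 * Real.pi * ‖ξ‖) ^ s := by positivity
  rw [sobolevWeight]
  linarith

theorem sobolevWeight_nonneg (s : ℝ) (ξ : E d) : 0 ≤ sobolevWeight s ξ :=
  zero_le_one.trans (one_le_sobolevWeight s ξ)

theorem continuous_sobolevWeight (hs0 : 0 < s) : Continuous (sobolevWeight (d := d) s) := by
  unfold sobolevWeight
  exact continuous_const.add ((Real.continuous_rpow_const hs0.le).comp (by fun_prop))

/-- Peetre's inequality. -/
theorem sobolevWeight_le_mul (hs0 : 0 < s) (hs1 : s ≤ 1) (ξ ζ : E d) :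
    sobolevWeight s ξ ≤ sobolevWeight s ζ * sobolevWeight s (ξ - ζ) := by
  have hp := Real.pi_pos
  -- For s ≤ 1 the map t ↦ t^s is subadditive, so no constant is lost; the nonnegative cross term of
  -- the product is simply discarded.
  have h1 : (2 * Real.pi * ‖ξ‖) ^ s
      ≤ (2 * Real.pi * ‖ζ‖) ^ s + (2 * Real.pi * ‖ξ - ζ‖) ^ s := by
    refine le_trans ?_ (Real.rpow_add_le_add_rpow (by positivity) (by positivity) hs0.le hs1)
    refine Real.rpow_le_rpow (by positivity) ?_ hs0.le
    have : ‖ξ‖ ≤ ‖ζ‖ + ‖ξ - ζ‖ := by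
      simpa using norm_add_le ζ (ξ - ζ)
    nlinarith
  have h2 : 0 ≤ (2 * Real.pi * ‖ζ‖) ^ s * (2 * Real.pi * ‖ξ - ζ‖) ^ s := by positivity
  simp only [sobolevWeight]
  linarith

theorem continuous_sobolevWeight_mul_ft (hs0 : 0 < s) (hu : Integrable u) :
    Continuous fun ξ => sobolevWeight s ξ * ‖ft u ξ‖ :=
  (continuous_sobolevWeight hs0).mul (continuous_ft hu).norm

theorem sobolevNorm_add_le (hs0 : 0 < s) (hu : Integrable u) (hv : Integrable v) :
    sobolevNorm s (fun x => u x + v x) ≤ sobolevNorm s u + sobolevNorm s v := by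
  refine le_trans ?_ (eLpNorm_add_le
    (continuous_sobolevWeight_mul_ft hs0 hu).aestronglyMeasurable
    (continuous_sobolevWeight_mul_ft hs0 hv).aestronglyMeasurable one_le_two)
  refine eLpNorm_mono_real fun ξ => ?_
  have hw := sobolevWeight_nonneg s ξ
  rw [Real.norm_of_nonneg (by positivity), ft_add hu hv, Pi.add_apply, ← mul_add]
  gcongr
  exact norm_add_le _ _

theorem eLpNorm_le_sobolevNorm (hu : Integrable u) (hu2 : MemLp u 2) (s : ℝ) :
    eLpNorm u 2 volume ≤ sobolevNorm s u := by
  rw [← eLpNorm_ft hu hu2, sobolevNorm]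
  refine eLpNorm_mono_real fun ξ => ?_
  have := one_le_sobolevWeight s ξ
  nlinarith [norm_nonneg (ft u ξ)]

theorem eLpNorm_rpow_mul_ft_le_sobolevNorm (s : ℝ) (u : E d → ℝ) :
    eLpNorm (fun ξ => (2 * Real.pi * ‖ξ‖) ^ s * ‖ft u ξ‖) 2 volume ≤ sobolevNorm s u := by
  have hp := Real.pi_pos
  refine eLpNorm_mono_real fun ξ => ?_
  rw [Real.norm_of_nonneg (by positivity)]
  gcongr
  rw [sobolevWeight]
  linarith

/-- Cauchy–Schwarz after writing g f = g^(1/2) · g^(1/2) f. -/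
theorem lintegral_mul_sq_le {α : Type*} [MeasurableSpace α] {μ : Measure α} {g f : α → ℝ≥0∞}
    (hg : AEMeasurable g μ) (hf : AEMeasurable f μ) :
    (∫⁻ x, g x * f x ∂μ) ^ 2 ≤ (∫⁻ x, g x ∂μ) * ∫⁻ x, g x * f x ^ 2 ∂μ := by
  have h := ENNReal.lintegral_mul_le_Lp_mul_Lq μ Real.HolderConjugate.two_two
    (hg.pow_const (2⁻¹ : ℝ)) ((hg.pow_const (2⁻¹ : ℝ)).mul hf)
  have e1 : ∀ x, (g x ^ (2⁻¹ : ℝ)) ^ (2 : ℝ) = g x := fun x => by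
    rw [← ENNReal.rpow_mul]; norm_num
  have e2 : ∀ x, (g x ^ (2⁻¹ : ℝ)) * (g x ^ (2⁻¹ : ℝ)) = g x := fun x => by
    rw [← ENNReal.rpow_add_of_nonneg _ _ (by norm_num) (by norm_num)]; norm_num
  have e3 : ∀ x, (g x ^ (2⁻¹ : ℝ) * f x) ^ (2 : ℝ) = g x * f x ^ 2 := fun x => by
    rw [ENNReal.mul_rpow_of_nonneg _ _ (by norm_num), e1]; norm_num
  simp only [Pi.mul_apply, e1, ← mul_assoc, e2, e3] at h
  calc _ ≤ ((∫⁻ x, g x ∂μ) ^ (1 / 2 : ℝ) * (∫⁻ x, g x * f x ^ 2 ∂μ) ^ (1 / 2 : ℝ)) ^ 2 := by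
        gcongr
    _ = _ := by
        rw [mul_pow, ← ENNReal.rpow_natCast, ← ENNReal.rpow_natCast, ← ENNReal.rpow_mul,
          ← ENNReal.rpow_mul]
        norm_num

/-- Young's inequality `‖g * f‖_{L²} ≤ ‖g‖_{L¹} ‖f‖_{L²}`. -/
theorem lintegral_convolution_sq_le {g f : E d → ℝ≥0∞} (hg : Measurable g) (hf : Measurable f) :
    ∫⁻ x, (∫⁻ y, g y * f (x - y)) ^ 2 ≤ (∫⁻ y, g y) ^ 2 * ∫⁻ x, f x ^ 2 := by
  calc ∫⁻ x, (∫⁻ y, g y * f (x - y)) ^ 2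
      ≤ ∫⁻ x, (∫⁻ y, g y) * ∫⁻ y, g y * f (x - y) ^ 2 :=
        lintegral_mono fun x => lintegral_mul_sq_le hg.aemeasurable
          (hf.comp (measurable_const.sub measurable_id)).aemeasurable
    _ = (∫⁻ y, g y) * ∫⁻ x, ∫⁻ y, g y * f (x - y) ^ 2 := by
        refine lintegral_const_mul _ (Measurable.lintegral_prod_right' (f := fun p : E d × E d =>
          g p.2 * f (p.1 - p.2) ^ 2) ?_)
        exact (hg.comp measurable_snd).mul
          ((hf.comp (measurable_fst.sub measurable_snd)).pow_const 2)
    _ = (∫⁻ y, g y) * ∫⁻ y, ∫⁻ x, g y * f (x - y) ^ 2 := by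
        rw [lintegral_lintegral_swap]
        exact ((hg.comp measurable_snd).mul
          ((hf.comp (measurable_fst.sub measurable_snd)).pow_const 2)).aemeasurable
    _ = (∫⁻ y, g y) * ∫⁻ y, g y * ∫⁻ x, f x ^ 2 := by
        congr 2
        ext y
        rw [lintegral_const_mul _ (f := fun x => f (x - y) ^ 2) (by fun_prop)]
        congr 1
        exact lintegral_sub_right_eq_self (fun x => f x ^ 2) y
    _ = _ := by
        rw [lintegral_mul_const _ hg, sq, mul_assoc]

/-- The transform of a test function is Schwartz, and the weight grows at most linearly. -/
theorem IsTestFunction.integrable_weight_mul_ft {η : E d → ℝ} (hη : IsTestFunction Ω η)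
    (hs0 : 0 < s) (hs1 : s ≤ 1) : Integrable fun ξ => sobolevWeight s ξ * ‖ft η ξ‖ := by
  have hp := Real.pi_pos
  have hg₁ : HasCompactSupport (Complex.ofRealCLM ∘ η) := hη.hasCompactSupport.comp_left rfl
  have hg₂ : ContDiff ℝ ∞ (Complex.ofRealCLM ∘ η) := Complex.ofRealCLM.contDiff.comp hη.contDiff
  set G : 𝓢(E d, ℂ) := 𝓕 (hg₁.toSchwartzMap hg₂) with hG
  have hGη : ∀ ξ, G ξ = ft η ξ := fun ξ => rfl
  refine (((G.integrable_pow_mul volume 0).const_mul 2).add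
    ((G.integrable_pow_mul volume 1).const_mul (2 * Real.pi))).mono'
    (continuous_sobolevWeight_mul_ft hs0 hη.integrable).aestronglyMeasurable
    (Eventually.of_forall fun ξ => ?_)
  rw [Real.norm_of_nonneg (mul_nonneg (sobolevWeight_nonneg s ξ) (norm_nonneg _))]
  have := rpow_le_one_add hs0 hs1 (by positivity : 0 ≤ 2 * Real.pi * ‖ξ‖)
  simp only [Pi.add_apply, pow_zero, one_mul, pow_one, hGη]
  rw [← mul_assoc, ← add_mul]
  gcongr
  rw [sobolevWeight]
  linarith

theorem IsTestFunction.integrable_ft {η : E d → ℝ} (hη : IsTestFunction Ω η) :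
    Integrable (ft η) := by
  refine (hη.integrable_weight_mul_ft one_pos le_rfl).mono'
    (continuous_ft hη.integrable).aestronglyMeasurable (Eventually.of_forall fun ξ => ?_)
  nlinarith [one_le_sobolevWeight 1 ξ, norm_nonneg (ft η ξ)]

/-- Fourier inversion for η followed by Fubini; only η̂ and u need to be integrable. -/
theorem IsTestFunction.ft_mul {η : E d → ℝ} (hη : IsTestFunction Ω η) (hu : Integrable u)
    (ξ : E d) : ft (fun x => η x * u x) ξ = ∫ ζ, ft η ζ * ft u (ξ - ζ) := by
  have hinv : ∀ x, ((η x : ℝ) : ℂ)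
      = ∫ ζ, Complex.exp (↑(2 * Real.pi * inner ℝ ζ x) * Complex.I) * ft η ζ := by
    intro x
    have hc : Continuous fun x => (η x : ℂ) :=
      Complex.continuous_ofReal.comp hη.contDiff.continuous
    have h := congrFun (Continuous.fourierInv_fourier_eq hc hη.integrable.ofReal
      hη.integrable_ft) x
    rw [← h, Real.fourierInv_eq']
    simp only [smul_eq_mul]
    rfl
  calc ft (fun x => η x * u x) ξ
      = ∫ x, ∫ ζ, ft η ζ * (Complex.exp (↑(-2 * Real.pi * inner ℝ x (ξ - ζ)) * Complex.I)
          * (u x : ℂ)) := by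
        rw [ft_apply]
        congr with x
        rw [Complex.ofReal_mul (η x) (u x), hinv, mul_comm (∫ ζ, _) (u x : ℂ), ← mul_assoc,
          ← integral_const_mul]
        congr with ζ
        rw [inner_sub_right, show (((-2 * Real.pi * (inner ℝ x ξ - inner ℝ x ζ) : ℝ) : ℂ)) *
          Complex.I = ↑(-2 * Real.pi * inner ℝ x ξ) * Complex.I +
            ↑(2 * Real.pi * inner ℝ ζ x) * Complex.I by
          rw [real_inner_comm ζ x]; push_cast; ring, Complex.exp_add]
        ring
    _ = ∫ ζ, ∫ x, ft η ζ * (Complex.exp (↑(-2 * Real.pi * inner ℝ x (ξ - ζ)) * Complex.I)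
          * (u x : ℂ)) := by
        refine integral_integral_swap ?_
        have hi : Integrable (fun p : E d × E d => (u p.1 : ℂ) * ft η p.2)
            (volume.prod volume) := hu.ofReal.mul_prod hη.integrable_ft
        refine (hi.bdd_mul (c := 1) (f := fun p : E d × E d =>
          Complex.exp (↑(-2 * Real.pi * inner ℝ p.1 (ξ - p.2)) * Complex.I))
          (Continuous.aestronglyMeasurable (by fun_prop))
          (Eventually.of_forall fun x => (Complex.norm_exp_ofReal_mul_I _).le)).congr
          (Eventually.of_forall fun p => ?_)
        simp only [Function.uncurry]
        ring
    _ = _ := by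
        congr with ζ
        rw [integral_const_mul, ft_apply u]

/-- Multiplication by a test function is bounded for the Bessel potential norm. -/
theorem IsTestFunction.sobolevNorm_mul_lt_top {η : E d → ℝ} (hη : IsTestFunction Ω η)
    (hs0 : 0 < s) (hs1 : s ≤ 1) (hu : Integrable u) (h : sobolevNorm s u < ⊤) :
    sobolevNorm s (fun x => η x * u x) < ⊤ := by
  have hcη := continuous_sobolevWeight_mul_ft hs0 hη.integrable
  have hcu := continuous_sobolevWeight_mul_ft hs0 hu
  -- Peetre's inequality distributes the weight over the convolution of η̂ and û, leaving a
  -- convolution of an L¹ function with an L² function, to which Young's inequality applies.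
  have hpt : ∀ ξ, ‖sobolevWeight s ξ * ‖ft (fun x => η x * u x) ξ‖‖ₑ
      ≤ ∫⁻ ζ, ‖sobolevWeight s ζ * ‖ft η ζ‖‖ₑ *
        ‖sobolevWeight s (ξ - ζ) * ‖ft u (ξ - ζ)‖‖ₑ := by
    intro ξ
    rw [hη.ft_mul hu, enorm_mul, enorm_norm]
    refine (mul_le_mul_right (enorm_integral_le_lintegral_enorm _) _).trans ?_
    rw [← lintegral_const_mul' _ _ enorm_ne_top]
    refine lintegral_mono fun ζ => ?_
    rw [← enorm_norm (ft η ζ * _), ← enorm_mul, ← enorm_mul, enorm_le_iff_norm_le]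
    simp only [norm_mul, norm_norm]
    rw [Real.norm_of_nonneg (sobolevWeight_nonneg s ξ),
      Real.norm_of_nonneg (sobolevWeight_nonneg s ζ),
      Real.norm_of_nonneg (sobolevWeight_nonneg s (ξ - ζ))]
    calc sobolevWeight s ξ * (‖ft η ζ‖ * ‖ft u (ξ - ζ)‖)
        ≤ (sobolevWeight s ζ * sobolevWeight s (ξ - ζ)) * (‖ft η ζ‖ * ‖ft u (ξ - ζ)‖) := by
          gcongr
          exact sobolevWeight_le_mul hs0 hs1 ξ ζ
      _ = _ := by ring
  have hsq : sobolevNorm s (fun x => η x * u x) ^ 2 < ⊤ := by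
    rw [sobolevNorm, eLpNorm_two_sq]
    calc _ ≤ ∫⁻ ξ, (∫⁻ ζ, ‖sobolevWeight s ζ * ‖ft η ζ‖‖ₑ *
          ‖sobolevWeight s (ξ - ζ) * ‖ft u (ξ - ζ)‖‖ₑ) ^ 2 :=
          lintegral_mono fun ξ => pow_le_pow_left' (hpt ξ) 2
      _ ≤ _ := lintegral_convolution_sq_le hcη.measurable.enorm hcu.measurable.enorm
      _ < ⊤ := by
          rw [← eLpNorm_two_sq]
          exact ENNReal.mul_lt_top
            (ENNReal.pow_lt_top (hη.integrable_weight_mul_ft hs0 hs1).hasFiniteIntegral)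
            (ENNReal.pow_lt_top h)
  by_contra hcon
  rw [not_lt, top_le_iff] at hcon
  simp [hcon] at hsq

/-- On the transform side translation is multiplication by a character, so the difference carries a
factor of modulus at most 2 that tends to 0 at each frequency. -/
theorem tendsto_sobolevNorm_translate (hs0 : 0 < s) (hu : Integrable u)
    (h : sobolevNorm s u < ⊤) (z : E d) :
    Tendsto (fun t : ℝ => sobolevNorm s fun x => u (x - t • z) - u x) (𝓝 0) (𝓝 0) := by
  have hcu := continuous_sobolevWeight_mul_ft hs0 hu
  have hmem : MemLp (fun ξ => sobolevWeight s ξ * ‖ft u ξ‖) 2 :=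
    ⟨hcu.aestronglyMeasurable, h⟩
  have e : ∀ (t : ℝ) ξ, ft (fun x => u (x - t • z) - u x) ξ
      = (Complex.exp (↑(-2 * Real.pi * inner ℝ (t • z) ξ) * Complex.I) - 1) * ft u ξ := by
    intro t ξ
    rw [ft_sub (hu.comp_sub_right _) hu, ft_comp_sub, sub_mul, one_mul]
  simp only [sobolevNorm, e]
  refine tendsto_eLpNorm_two_of_dominated (hmem.const_mul 2) (Eventually.of_forall fun t => ?_)
    (Eventually.of_forall fun t => Eventually.of_forall fun ξ => ?_)
    (Eventually.of_forall fun ξ => ?_)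
  · have h1 := continuous_sobolevWeight (d := d) hs0
    have h2 := continuous_ft hu
    exact Continuous.aestronglyMeasurable (by fun_prop)
  · have hw := sobolevWeight_nonneg s ξ
    rw [Real.norm_of_nonneg (by positivity), norm_mul, mul_left_comm]
    have : ‖Complex.exp (↑(-2 * Real.pi * inner ℝ (t • z) ξ) * Complex.I) - 1‖ ≤ 2 := by
      refine (norm_sub_le _ _).trans ?_
      rw [Complex.norm_exp_ofReal_mul_I, norm_one]
      norm_num
    gcongr
  · have hc : Continuous fun t : ℝ => sobolevWeight s ξ *
        ‖(Complex.exp (↑(-2 * Real.pi * inner ℝ (t • z) ξ) * Complex.I) - 1) * ft u ξ‖ := by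
      fun_prop
    simpa using hc.tendsto 0

end Sobolev

/-! ### Density of test functions on Lipschitz domains -/

/-- `u` is a limit of test functions in `Ω` for the Bessel potential norm of order `s`. -/
def SobolevApproximable {d : ℕ} (s : ℝ) (Ω : Set (E d)) (u : E d → ℝ) : Prop :=
  ∀ ε : ℝ≥0∞, 0 < ε → ∃ φ, IsTestFunction Ω φ ∧ sobolevNorm s (fun x => φ x - u x) < ε

section Density

variable {d : ℕ} {Ω : Set (E d)} {s : ℝ} {u v : E d → ℝ}

theorem ft_convolution {ρ : E d → ℝ} (hρ : Integrable ρ) (hu : Integrable u) (ξ : E d) :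
    ft (ρ ⋆[ContinuousLinearMap.lsmul ℝ ℝ, volume] u) ξ = ft ρ ξ * ft u ξ := by
  have e : (fun x => (((ρ ⋆[ContinuousLinearMap.lsmul ℝ ℝ, volume] u) x : ℝ) : ℂ))
      = (fun x => (ρ x : ℂ)) ⋆[ContinuousLinearMap.mul ℂ ℂ, volume] (fun x => (u x : ℂ)) := by
    ext x
    simp only [convolution, ContinuousLinearMap.lsmul_apply, ContinuousLinearMap.mul_apply',
      smul_eq_mul]
    rw [← integral_complex_ofReal]
    simp
  rw [ft, e]
  exact Real.fourier_mul_convolution_eq (hρ.ofReal (𝕜 := ℂ)) (hu.ofReal (𝕜 := ℂ)) ξ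

theorem norm_ft_sub_one_le {ρ : E d → ℝ} (hρ : Integrable ρ) (h0 : ∀ x, 0 ≤ ρ x)
    (h1 : ∫ x, ρ x = 1) {r : ℝ} (hr : Function.support ρ ⊆ Metric.ball 0 r) (ξ : E d) :
    ‖ft ρ ξ - 1‖ ≤ (2 + 2 * Real.pi * ‖ξ‖) * r := by
  have hp := Real.pi_pos
  have e0 : ft ρ 0 = 1 := by
    rw [ft_apply]
    simp only [inner_zero_right, mul_zero, Complex.ofReal_zero, zero_mul, Complex.exp_zero, one_mul]
    rw [integral_complex_ofReal, h1, Complex.ofReal_one]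
  rw [norm_sub_rev, ← e0, ← integral_one_sub_fourierChar_mul hρ]
  calc _ ≤ ∫ x, (2 + 2 * Real.pi * ‖ξ‖) * r * ρ x := by
        refine norm_integral_le_of_norm_le (hρ.const_mul _) (Eventually.of_forall fun x => ?_)
        rw [norm_mul, Complex.norm_real, Real.norm_of_nonneg (h0 x)]
        by_cases hx : ρ x = 0
        · simp [hx]
        have hxr : ‖x‖ < r := by simpa using hr (Function.mem_support.2 hx)
        refine mul_le_mul_of_nonneg_right ((norm_one_sub_fourierChar_le ξ x).trans ?_) (h0 x)
        gcongr
        exact (min_le_left _ _).trans hxr.le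
    _ = _ := by rw [integral_const_mul, h1, mul_one]

/-- Mollification: the mollifier's transform is bounded by 1 and tends to 1 at each frequency, so
the error tends to 0 by dominated convergence. Mollifying at scale at most δ keeps the support in
the closed δ-thickening of K, inside Ω. -/
theorem sobolevApproximable_of_compact (hΩ : IsOpen Ω) (hs0 : 0 < s) {K : Set (E d)}
    (hK : IsCompact K) (hKΩ : K ⊆ Ω) (huK : Function.support u ⊆ K) (hu : Integrable u)
    (h : sobolevNorm s u < ⊤) : SobolevApproximable s Ω u := by
  obtain ⟨δ, hδ, hδΩ⟩ := hK.exists_cthickening_subset_open hΩ hKΩ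
  set r : ℕ → ℝ := fun n => δ / (n + 1) with hr
  have hr0 : ∀ n, 0 < r n := fun n => by positivity
  have hrδ : ∀ n, r n ≤ δ := fun n => by
    rw [hr]
    exact div_le_self hδ.le (by linarith [(Nat.cast_nonneg n : (0 : ℝ) ≤ n)])
  have hrlim : Tendsto r atTop (𝓝 0) := by
    have := (tendsto_one_div_add_atTop_nhds_zero_nat (𝕜 := ℝ)).const_mul δ
    simpa [hr, div_eq_mul_inv] using this
  set b : ∀ n, ContDiffBump (0 : E d) := fun n => ⟨r n / 2, r n, by linarith [hr0 n],
    by linarith [hr0 n]⟩ with hb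
  set ρ : ℕ → E d → ℝ := fun n => (b n).normed volume with hρ
  have hρi : ∀ n, Integrable (ρ n) := fun n => (b n).integrable_normed
  have hρ0 : ∀ n x, 0 ≤ ρ n x := fun n x => (b n).nonneg_normed x
  have hρ1 : ∀ n, ∫ x, ρ n x = 1 := fun n => (b n).integral_normed
  have hρs : ∀ n, Function.support (ρ n) ⊆ Metric.ball 0 (r n) := fun n =>
    ((b n).support_normed_eq (μ := volume)).subset
  set φ : ℕ → E d → ℝ := fun n => (ρ n) ⋆[ContinuousLinearMap.lsmul ℝ ℝ, volume] u with hφ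
  have hφsupp : ∀ n, tsupport (φ n) ⊆ Metric.cthickening δ K := by
    intro n
    refine closure_minimal ?_ Metric.isClosed_cthickening
    refine (support_convolution_subset _).trans ?_
    rintro _ ⟨x, hx, y, hy, rfl⟩
    refine Metric.mem_cthickening_of_dist_le _ y δ K (huK hy) ?_
    have : ‖x‖ < r n := by simpa using hρs n hx
    rw [dist_eq_norm, add_sub_cancel_right]
    exact this.le.trans (hrδ n)
  have hφtest : ∀ n, IsTestFunction Ω (φ n) := fun n =>
    { contDiff := ((b n).hasCompactSupport_normed).contDiff_convolution_left _
        ((b n).contDiff_normed (n := ⊤)) hu.locallyIntegrable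
      hasCompactSupport := hK.cthickening.of_isClosed_subset (isClosed_tsupport _) (hφsupp n)
      tsupport_subset := (hφsupp n).trans hδΩ }
  have hlim : Tendsto (fun n => sobolevNorm s fun x => φ n x - u x) atTop (𝓝 0) := by
    have hcu := continuous_sobolevWeight_mul_ft hs0 hu
    have hmem : MemLp (fun ξ => sobolevWeight s ξ * ‖ft u ξ‖) 2 :=
      ⟨hcu.aestronglyMeasurable, h⟩
    have e : ∀ n ξ, ft (fun x => φ n x - u x) ξ = (ft (ρ n) ξ - 1) * ft u ξ := by
      intro n ξ
      rw [ft_sub (hφtest n).integrable hu, ft_convolution (hρi n) hu, sub_mul, one_mul]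
    simp only [sobolevNorm, e]
    refine tendsto_eLpNorm_two_of_dominated (hmem.const_mul 2) (Eventually.of_forall fun n => ?_)
      (Eventually.of_forall fun n => Eventually.of_forall fun ξ => ?_)
      (Eventually.of_forall fun ξ => ?_)
    · have h1 := continuous_sobolevWeight (d := d) hs0
      have h2 := continuous_ft hu
      have h3 := continuous_ft (hρi n)
      exact Continuous.aestronglyMeasurable (by fun_prop)
    · have hw := sobolevWeight_nonneg s ξ
      rw [Real.norm_of_nonneg (by positivity), norm_mul, mul_left_comm]
      have : ‖ft (ρ n) ξ - 1‖ ≤ 2 := by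
        refine (norm_sub_le _ _).trans ?_
        have := norm_ft_le (ρ n) ξ
        simp only [abs_of_nonneg (hρ0 n _), hρ1 n] at this
        rw [norm_one]
        linarith
      gcongr
    · have h1 : Tendsto (fun n => ft (ρ n) ξ - 1) atTop (𝓝 0) := by
        refine squeeze_zero_norm
          (fun n => norm_ft_sub_one_le (hρi n) (hρ0 n) (hρ1 n) (hρs n) ξ) ?_
        simpa using hrlim.const_mul (2 + 2 * Real.pi * ‖ξ‖)
      simpa using ((h1.mul_const (ft u ξ)).norm).const_mul (sobolevWeight s ξ)
  intro ε hε
  obtain ⟨n, hn⟩ := (hlim.eventually_lt_const hε).exists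
  exact ⟨φ n, hφtest n, hn⟩

theorem IsTestFunction.zero : IsTestFunction Ω (fun _ => (0 : ℝ)) :=
  ⟨contDiff_const, HasCompactSupport.zero, by simp [tsupport, Function.support]⟩

theorem IsTestFunction.add {φ χ : E d → ℝ} (hφ : IsTestFunction Ω φ) (hχ : IsTestFunction Ω χ) :
    IsTestFunction Ω fun x => φ x + χ x :=
  ⟨hφ.contDiff.add hχ.contDiff, hφ.hasCompactSupport.add hχ.hasCompactSupport,
    (tsupport_add φ χ).trans (union_subset hφ.tsupport_subset hχ.tsupport_subset)⟩

theorem IsTestFunction.const_mul {φ : E d → ℝ} (hφ : IsTestFunction Ω φ) (c : ℝ) :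
    IsTestFunction Ω fun x => c * φ x :=
  ⟨contDiff_const.mul hφ.contDiff, hφ.hasCompactSupport.mul_left,
    (tsupport_mul_subset_right).trans hφ.tsupport_subset⟩

theorem SobolevApproximable.of_near (hs0 : 0 < s) (hu : Integrable u)
    (h : ∀ ε : ℝ≥0∞, 0 < ε → ∃ v, Integrable v ∧ SobolevApproximable s Ω v ∧
      sobolevNorm s (fun x => v x - u x) < ε) : SobolevApproximable s Ω u := by
  intro ε hε
  obtain ⟨v, hvi, hv, hvu⟩ := h (ε / 2) (ENNReal.half_pos hε.ne')
  obtain ⟨φ, hφ, hφv⟩ := hv (ε / 2) (ENNReal.half_pos hε.ne')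
  refine ⟨φ, hφ, ?_⟩
  have e : (fun x => φ x - u x) = fun x => (φ x - v x) + (v x - u x) := by ext x; ring
  rw [e]
  refine (sobolevNorm_add_le hs0 (hφ.integrable.sub hvi) (hvi.sub hu)).trans_lt ?_
  exact (ENNReal.add_lt_add hφv hvu).trans_eq (ENNReal.add_halves ε)

theorem SobolevApproximable.add (hs0 : 0 < s) (hui : Integrable u) (hvi : Integrable v)
    (hu : SobolevApproximable s Ω u) (hv : SobolevApproximable s Ω v) :
    SobolevApproximable s Ω fun x => u x + v x := by
  intro ε hε
  obtain ⟨φ, hφ, hφu⟩ := hu (ε / 2) (ENNReal.half_pos hε.ne')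
  obtain ⟨χ, hχ, hχv⟩ := hv (ε / 2) (ENNReal.half_pos hε.ne')
  refine ⟨_, hφ.add hχ, ?_⟩
  have e : (fun x => φ x + χ x - (u x + v x)) = fun x => (φ x - u x) + (χ x - v x) := by
    ext x; ring
  rw [e]
  refine (sobolevNorm_add_le hs0 (hφ.integrable.sub hui) (hχ.integrable.sub hvi)).trans_lt ?_
  exact (ENNReal.add_lt_add hφu hχv).trans_eq (ENNReal.add_halves ε)

theorem SobolevApproximable.sum (hs0 : 0 < s) {ι : Type*} (t : Finset ι) {f : ι → E d → ℝ}
    (hf : ∀ i ∈ t, Integrable (f i)) (h : ∀ i ∈ t, SobolevApproximable s Ω (f i)) :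
    SobolevApproximable s Ω fun x => ∑ i ∈ t, f i x := by
  classical
  induction t using Finset.induction_on with
  | empty =>
    intro ε hε
    refine ⟨_, IsTestFunction.zero, ?_⟩
    have : ft (fun _ : E d => (0 : ℝ)) = 0 := by ext ξ; simp [ft_apply]
    simpa [sobolevNorm, this] using hε
  | insert a t ha ih =>
    simp only [Finset.sum_insert ha]
    refine SobolevApproximable.add hs0 (hf a (by simp)) (integrable_finsetSum _ fun i hi =>
      hf i (by simp [hi])) (h a (by simp)) (ih (fun i hi => hf i (by simp [hi])) fun i hi =>
      h i (by simp [hi]))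

theorem IsTestFunction.integrable_mul {U : Set (E d)} {η : E d → ℝ} (hη : IsTestFunction U η)
    (hu : Integrable u) : Integrable fun x => η x * u x := by
  obtain ⟨C, hC⟩ := hη.contDiff.continuous.bounded_above_of_compact_support hη.hasCompactSupport
  exact hu.bdd_mul hη.contDiff.continuous.aestronglyMeasurable (Eventually.of_forall hC)

/-- Near a boundary point a function vanishing outside `Ω` is approximated by its translates into
`Ω`. -/
theorem sobolevApproximable_mul_of_epigraph (hΩ : IsOpen Ω) (hs0 : 0 < s) (hs1 : s ≤ 1)
    (hu : Integrable u) (h : sobolevNorm s u < ⊤) (hu0 : ∀ x ∉ Ω, u x = 0) {p ν : E d}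
    (hν : ‖ν‖ = 1) {γ : E d → ℝ} (hγ : Continuous γ) {ρ : ℝ} (hρ : 0 < ρ)
    (hΩγ : ∀ x ∈ Metric.ball p ρ, x ∈ Ω ↔ γ (x - inner ℝ ν x • ν) < inner ℝ ν x)
    {η : E d → ℝ} (hη : IsTestFunction (Metric.ball p (ρ / 2)) η) :
    SobolevApproximable s Ω fun x => η x * u x := by
  have hvi := hη.integrable_mul hu
  have hvn := hη.sobolevNorm_mul_lt_top hs0 hs1 hu h
  refine SobolevApproximable.of_near hs0 hvi fun ε hε => ?_
  have hev := (tendsto_sobolevNorm_translate hs0 hvi hvn ν).eventually_lt_const hε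
  have hpos : ∀ᶠ t : ℝ in 𝓝[>] 0, t ∈ Ioo 0 (ρ / 2) := Ioo_mem_nhdsGT (by positivity)
  obtain ⟨t, ht, ht0, htρ⟩ := ((hev.filter_mono nhdsWithin_le_nhds).and hpos).exists
  refine ⟨fun x => η (x - t • ν) * u (x - t • ν), hvi.comp_sub_right (t • ν), ?_, ht⟩
  -- Points of closure Ω in the chart satisfy only γ ≤ ⟨ν, x⟩. A shift by tν leaves the projection
  -- onto ν^⊥ unchanged and raises ⟨ν, x⟩ by t, which makes the inequality strict; t < ρ/2 keeps the
  -- shifted point in the chart ball.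
  have hK : IsCompact ((fun x => x + t • ν) '' (tsupport η ∩ closure Ω)) :=
    (hη.hasCompactSupport.isCompact.inter_right isClosed_closure).image (by fun_prop)
  refine sobolevApproximable_of_compact hΩ hs0 hK ?_ ?_ (hvi.comp_sub_right (t • ν)) ?_
  · rintro _ ⟨x, ⟨hx1, hx2⟩, rfl⟩
    have hxb : x ∈ Metric.ball p (ρ / 2) := hη.tsupport_subset hx1
    have hxb' : x ∈ Metric.ball p ρ := Metric.ball_subset_ball (by linarith) hxb
    have hxγ : γ (x - inner ℝ ν x • ν) ≤ inner ℝ ν x := by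
      have hcl : IsClosed {y : E d | γ (y - inner ℝ ν y • ν) ≤ inner ℝ ν y} :=
        isClosed_le (hγ.comp (by fun_prop)) (by fun_prop)
      have hsub : Metric.ball p ρ ∩ Ω ⊆ {y : E d | γ (y - inner ℝ ν y • ν) ≤ inner ℝ ν y} :=
        fun y hy => ((hΩγ y hy.1).1 hy.2).le
      exact closure_minimal hsub hcl (Metric.isOpen_ball.inter_closure ⟨hxb', hx2⟩)
    have hyb : x + t • ν ∈ Metric.ball p ρ := by
      rw [Metric.mem_ball, dist_eq_norm] at hxb ⊢
      calc ‖x + t • ν - p‖ = ‖(x - p) + t • ν‖ := by congr 1; abel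
        _ ≤ ‖x - p‖ + ‖t • ν‖ := norm_add_le _ _
        _ < ρ := by
          rw [norm_smul, hν, Real.norm_of_nonneg ht0.le]
          linarith
    have hinner : inner ℝ ν (x + t • ν) = inner ℝ ν x + t := by
      rw [inner_add_right, inner_smul_right, real_inner_self_eq_norm_sq, hν]
      ring
    refine (hΩγ _ hyb).2 ?_
    rw [hinner, add_smul, add_sub_add_right_eq_sub]
    linarith
  · intro x hx
    have hx' : η (x - t • ν) ≠ 0 ∧ u (x - t • ν) ≠ 0 := by
      simpa using mul_ne_zero_iff.1 hx
    refine ⟨x - t • ν, ⟨subset_tsupport η hx'.1, subset_closure ?_⟩, by simp⟩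
    by_contra hcon
    exact hx'.2 (hu0 _ hcon)
  · have e : sobolevNorm s (fun x => η (x - t • ν) * u (x - t • ν))
        = sobolevNorm s fun x => η x * u x := by
      rw [sobolevNorm, sobolevNorm]
      congr 1
      ext ξ
      rw [ft_comp_sub (fun x => η x * u x), norm_mul, Complex.norm_exp_ofReal_mul_I, one_mul]
    rw [e]
    exact hvn

/-- On a bounded Lipschitz domain every function of finite Bessel potential norm that vanishes
outside the domain is a limit of test functions. -/
theorem sobolevApproximable_of_hasLipschitzBoundary (hΩ : IsOpen Ω)
    (hΩb : Bornology.IsBounded Ω) (hΩL : HasLipschitzBoundary Ω) (hs0 : 0 < s) (hs1 : s ≤ 1)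
    (hu : Integrable u) (h : sobolevNorm s u < ⊤) (hu0 : ∀ x ∉ Ω, u x = 0) :
    SobolevApproximable s Ω u := by
  -- Near interior points the localised function already has compact support in Ω; near boundary
  -- points half of the chart ball leaves room for the translation.
  have hloc : ∀ x ∈ closure Ω, ∃ U : Set (E d), IsOpen U ∧ x ∈ U ∧ Bornology.IsBounded U ∧
      ∀ η, IsTestFunction U η → SobolevApproximable s Ω fun x => η x * u x := by
    intro x hx
    by_cases hxΩ : x ∈ Ω
    · refine ⟨Ω, hΩ, hxΩ, hΩb, fun η hη => ?_⟩
      refine sobolevApproximable_of_compact hΩ hs0 hη.hasCompactSupport.isCompact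
        hη.tsupport_subset ?_ (hη.integrable_mul hu) (hη.sobolevNorm_mul_lt_top hs0 hs1 hu h)
      intro y hy
      exact subset_tsupport η (mul_ne_zero_iff.1 hy).1
    · have hxf : x ∈ frontier Ω := ⟨hx, fun hi => hxΩ (interior_subset hi)⟩
      obtain ⟨ν, hν, γ, K, hγ, ρ, hρ, hΩγ⟩ := hΩL x hxf
      exact ⟨Metric.ball x (ρ / 2), Metric.isOpen_ball, Metric.mem_ball_self (by positivity),
        Metric.isBounded_ball, fun η hη => sobolevApproximable_mul_of_epigraph hΩ hs0 hs1 hu h hu0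
          hν hγ.continuous hρ hΩγ hη⟩
  choose! U hUo hUx hUb hU using hloc
  have hcpt : IsCompact (closure Ω) := hΩb.isCompact_closure
  obtain ⟨t, htΩ, ht⟩ := hcpt.elim_nhds_subcover U fun x hx => (hUo x hx).mem_nhds (hUx x hx)
  obtain ⟨f, hf⟩ := SmoothPartitionOfUnity.exists_isSubordinate 𝓘(ℝ, E d) isClosed_closure
    (fun i : t => U i) (fun i => hUo i (htΩ i i.2)) (by
      intro x hx
      obtain ⟨i, hi, hxi⟩ := mem_iUnion₂.1 (ht hx)
      exact mem_iUnion.2 ⟨⟨i, hi⟩, hxi⟩)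
  have htest : ∀ i : t, IsTestFunction (U i) (f i) := fun i =>
    { contDiff := (f i).contMDiff.contDiff
      hasCompactSupport := Metric.isCompact_of_isClosed_isBounded (isClosed_tsupport _)
        ((hUb i (htΩ i i.2)).subset (hf i))
      tsupport_subset := hf i }
  have e : u = fun x => ∑ i : t, f i x * u x := by
    ext x
    by_cases hx : x ∈ Ω
    · have := f.sum_eq_one (subset_closure hx)
      rw [finsum_eq_sum_of_fintype] at this
      rw [← Finset.sum_mul, this, one_mul]
    · simp [hu0 x hx]
  rw [e]
  exact SobolevApproximable.sum hs0 _ (fun i _ => (htest i).integrable_mul hu)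
    fun i _ => hU i (htΩ i i.2) _ (htest i)

end Density

/-! ### Weak compactness along ultrafilters -/

section WeakLimit

variable {H : Type*} [NormedAddCommGroup H] [InnerProductSpace ℝ H] [CompleteSpace H]

/-- Bounded families in a Hilbert space converge weakly along ultrafilters. -/
theorem exists_weak_limit {ι : Type*} (𝒰 : Ultrafilter ι) {x : ι → H} {M : ℝ}
    (hM : ∀ i, ‖x i‖ ≤ M) :
    ∃ y : H, ∀ ℓ : H →L[ℝ] ℝ, Tendsto (fun i => ℓ (x i)) 𝒰 (𝓝 (ℓ y)) := by
  -- Each scalar family stays in a compact interval, so it converges along the ultrafilter without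
  -- extraction of subsequences. The limits form a bounded linear functional, which Riesz
  -- representation turns into a vector.
  have hlim : ∀ z : H, ∃ a ∈ Icc (-(M * ‖z‖)) (M * ‖z‖),
      Tendsto (fun i => inner ℝ (x i) z) 𝒰 (𝓝 a) := by
    intro z
    refine isCompact_Icc.ultrafilter_le_nhds' (𝒰.map fun i => inner ℝ (x i) z) ?_
    refine Ultrafilter.mem_map.2 (univ_mem' fun i => ?_)
    have := abs_le.1 ((abs_real_inner_le_norm (x i) z).trans
      (mul_le_mul_of_nonneg_right (hM i) (norm_nonneg z)))
    exact ⟨this.1, this.2⟩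
  choose a ha hlim using hlim
  let L : H →ₗ[ℝ] ℝ :=
    { toFun := a
      map_add' := fun z w => tendsto_nhds_unique (hlim (z + w))
        (((hlim z).add (hlim w)).congr fun i => (inner_add_right _ _ _).symm)
      map_smul' := fun c z => tendsto_nhds_unique (hlim (c • z))
        (((hlim z).const_mul c).congr fun i => (real_inner_smul_right _ _ _).symm) }
  let L' : H →L[ℝ] ℝ := L.mkContinuous M fun z => abs_le.2 ⟨(ha z).1, (ha z).2⟩
  refine ⟨(InnerProductSpace.toDual ℝ H).symm L', fun ℓ => ?_⟩
  have h := hlim ((InnerProductSpace.toDual ℝ H).symm ℓ)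
  have e1 : ∀ w : H, ℓ w = inner ℝ w ((InnerProductSpace.toDual ℝ H).symm ℓ) := fun w => by
    rw [real_inner_comm, InnerProductSpace.toDual_symm_apply]
  simp only [e1 (x _)]
  convert h using 2
  rw [e1, InnerProductSpace.toDual_symm_apply]
  rfl

end WeakLimit

/-! ### Zero extension from Ω and regularity of its Fourier transform -/

section ZeroExtension

variable {d : ℕ} {Ω : Set (E d)}

theorem memLp_indicator (hΩ : IsOpen Ω) (u : L2 Ω) : MemLp (Ω.indicator u) 2 volume :=
  (memLp_indicator_iff_restrict hΩ.measurableSet).2 (Lp.memLp u)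

theorem integrable_indicator_L2 (hΩ : IsOpen Ω) (hΩb : Bornology.IsBounded Ω) (u : L2 Ω) :
    Integrable (Ω.indicator u) := by
  have : IsFiniteMeasure (volume.restrict Ω) := ⟨by simpa using hΩb.measure_lt_top⟩
  exact (integrable_indicator_iff hΩ.measurableSet).2 ((Lp.memLp u).integrable one_le_two)

theorem eLpNorm_indicator (hΩ : IsOpen Ω) (u : L2 Ω) :
    eLpNorm (Ω.indicator u) 2 volume = ‖u‖ₑ := by
  rw [eLpNorm_indicator_eq_eLpNorm_restrict hΩ.measurableSet, Lp.enorm_def]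

theorem eLpNorm_ft_indicator (hΩ : IsOpen Ω) (hΩb : Bornology.IsBounded Ω) (u : L2 Ω) :
    eLpNorm (ft (Ω.indicator u)) 2 volume = ‖u‖ₑ := by
  rw [eLpNorm_ft (integrable_indicator_L2 hΩ hΩb u) (memLp_indicator hΩ u), eLpNorm_indicator hΩ]

theorem indicator_add_ae (hΩ : IsOpen Ω) (u v : L2 Ω) :
    Ω.indicator (u + v : L2 Ω) =ᵐ[volume] fun x => Ω.indicator u x + Ω.indicator v x := by
  have h := (ae_restrict_iff' hΩ.measurableSet).1 (Lp.coeFn_add u v)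
  filter_upwards [h] with x hx
  by_cases hxΩ : x ∈ Ω
  · simpa [indicator_of_mem hxΩ] using hx hxΩ
  · simp [indicator_of_notMem hxΩ]

theorem indicator_smul_ae (hΩ : IsOpen Ω) (c : ℝ) (u : L2 Ω) :
    Ω.indicator (c • u : L2 Ω) =ᵐ[volume] fun x => c * Ω.indicator u x := by
  have h := (ae_restrict_iff' hΩ.measurableSet).1 (Lp.coeFn_smul c u)
  filter_upwards [h] with x hx
  by_cases hxΩ : x ∈ Ω
  · simpa [indicator_of_mem hxΩ] using hx hxΩ
  · simp [indicator_of_notMem hxΩ]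

theorem integral_abs_indicator_le (hΩ : IsOpen Ω) (hΩb : Bornology.IsBounded Ω) (u : L2 Ω) :
    ∫ x, |Ω.indicator u x| ≤ √(volume.real Ω) * ‖u‖ := by
  have hfin : IsFiniteMeasure (volume.restrict Ω) := ⟨by simpa using hΩb.measure_lt_top⟩
  have h1 : ∫ x, |Ω.indicator u x| = ∫ x in Ω, |u x| := by
    rw [← integral_indicator hΩ.measurableSet]
    congr with x
    by_cases hx : x ∈ Ω <;> simp [hx]
  have h2 : ∫ x in Ω, |u x| = (eLpNorm u 1 (volume.restrict Ω)).toReal := by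
    have := (integral_norm_eq_lintegral_enorm (Lp.aestronglyMeasurable u))
    simp only [Real.norm_eq_abs] at this
    rw [this, eLpNorm_one_eq_lintegral_enorm]
  have h3 := eLpNorm_le_eLpNorm_mul_rpow_measure_univ (p := 1) (q := 2) one_le_two
    (Lp.aestronglyMeasurable u)
  rw [h1, h2]
  have hV : (volume : Measure (E d)) Ω ≠ ⊤ := hΩb.measure_lt_top.ne
  have hne : eLpNorm u 2 (volume.restrict Ω) ≠ ⊤ := (Lp.memLp u).2.ne
  refine (ENNReal.toReal_mono (ENNReal.mul_ne_top hne (ENNReal.rpow_ne_top_of_nonneg (by norm_num)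
    (by simpa using hV))) h3).trans (le_of_eq ?_)
  rw [ENNReal.toReal_mul, Lp.norm_def, mul_comm, ← ENNReal.toReal_rpow, Measure.restrict_apply_univ,
    Real.sqrt_eq_rpow]
  norm_num [Measure.real]

/-- The Fourier transform of a function on `Ω` at `ξ`, as a functional on `L²(Ω)`. -/
def ftEval (hΩ : IsOpen Ω) (hΩb : Bornology.IsBounded Ω) (ξ : E d) : L2 Ω →L[ℝ] ℂ :=
  LinearMap.mkContinuous
    { toFun := fun u => ft (Ω.indicator u) ξ
      map_add' := fun u v => by
        rw [ft_congr_ae (indicator_add_ae hΩ u v), ft_add (integrable_indicator_L2 hΩ hΩb u)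
          (integrable_indicator_L2 hΩ hΩb v)]
      map_smul' := fun c u => by
        rw [ft_congr_ae (indicator_smul_ae hΩ c u), ft_const_mul]
        simp }
    (√(volume.real Ω)) fun u => (norm_ft_le _ ξ).trans (integral_abs_indicator_le hΩ hΩb u)

theorem ftEval_apply (hΩ : IsOpen Ω) (hΩb : Bornology.IsBounded Ω) (ξ : E d) (u : L2 Ω) :
    ftEval hΩ hΩb ξ u = ft (Ω.indicator u) ξ := rfl

theorem ft_indicator_sub (hΩ : IsOpen Ω) (hΩb : Bornology.IsBounded Ω) (u v : L2 Ω) (ξ : E d) :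
    ft (Ω.indicator (u - v : L2 Ω)) ξ = ft (Ω.indicator u) ξ - ft (Ω.indicator v) ξ :=
  map_sub (ftEval hΩ hΩb ξ) u v

theorem norm_ft_indicator_le (hΩ : IsOpen Ω) (hΩb : Bornology.IsBounded Ω) (u : L2 Ω) (ξ : E d) :
    ‖ft (Ω.indicator u) ξ‖ ≤ √(volume.real Ω) * ‖u‖ :=
  (norm_ft_le _ ξ).trans (integral_abs_indicator_le hΩ hΩb u)

/-- On Ω ⊆ B(0, R) the characters are 2πR-Lipschitz in frequency. The constant depends on u only
through ‖u‖, which gives equicontinuity on bounded sets of L²(Ω). -/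
theorem norm_ft_indicator_sub_le (hΩ : IsOpen Ω) (hΩb : Bornology.IsBounded Ω) {R : ℝ}
    (hR0 : 0 ≤ R) (hR : Ω ⊆ Metric.closedBall 0 R) (u : L2 Ω) (ξ ζ : E d) :
    ‖ft (Ω.indicator u) ξ - ft (Ω.indicator u) ζ‖
      ≤ 2 * Real.pi * R * ‖ξ - ζ‖ * (√(volume.real Ω) * ‖u‖) := by
  have hp := Real.pi_pos
  have hi := integrable_indicator_L2 hΩ hΩb u
  rw [ft_apply, ft_apply, ← integral_sub (integrable_fourier_integrand hi ξ)
    (integrable_fourier_integrand hi ζ)]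
  calc _ ≤ ∫ x, 2 * Real.pi * R * ‖ξ - ζ‖ * |Ω.indicator u x| := by
        refine norm_integral_le_of_norm_le (hi.norm.const_mul _)
          (Eventually.of_forall fun x => ?_)
        rw [← sub_mul, norm_mul, Complex.norm_real, Real.norm_eq_abs]
        by_cases hx : x ∈ Ω
        · refine mul_le_mul_of_nonneg_right ?_ (abs_nonneg _)
          have e : Complex.exp (↑(-2 * Real.pi * inner ℝ x ξ) * Complex.I) -
              Complex.exp (↑(-2 * Real.pi * inner ℝ x ζ) * Complex.I)
              = Complex.exp (↑(-2 * Real.pi * inner ℝ x ζ) * Complex.I) *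
                (Complex.exp (Complex.I * ↑(-2 * Real.pi * inner ℝ x (ξ - ζ))) - 1) := by
            rw [mul_sub, ← Complex.exp_add, inner_sub_right, mul_one]
            congr 2
            push_cast
            ring
          rw [e, norm_mul, Complex.norm_exp_ofReal_mul_I, one_mul]
          refine Real.norm_exp_I_mul_ofReal_sub_one_le.trans ?_
          rw [norm_mul, norm_mul, norm_neg, Real.norm_of_nonneg hp.le,
            Real.norm_of_nonneg zero_le_two, mul_assoc (2 * Real.pi)]
          gcongr
          refine (norm_inner_le_norm x (ξ - ζ)).trans ?_
          gcongr
          simpa using hR hx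
        · simp [indicator_of_notMem hx]
    _ ≤ _ := by
        rw [integral_const_mul]
        gcongr
        exact integral_abs_indicator_le hΩ hΩb u

end ZeroExtension

/-! ### Uniform Poincaré inequality and Rellich compactness -/

/-- The seminorm `‖|2πξ|^s û‖_{L²}` of an integrable function. -/
def rieszSeminorm {d : ℕ} (s : ℝ) (u : E d → ℝ) : ℝ≥0∞ :=
  eLpNorm (fun ξ => (2 * Real.pi * ‖ξ‖) ^ s * ‖ft u ξ‖) 2 volume

section Compactness

variable {d : ℕ} {Ω : Set (E d)}

/-- The frequencies `ξ` with `|2πξ| ≥ ρ`. -/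
def highFrequencies (d : ℕ) (ρ : ℝ) : Set (E d) := {ξ | ρ ≤ 2 * Real.pi * ‖ξ‖}

theorem measurableSet_highFrequencies (ρ : ℝ) : MeasurableSet (highFrequencies d ρ) :=
  (isClosed_le continuous_const (by fun_prop)).measurableSet

theorem compl_highFrequencies (ρ : ℝ) :
    (highFrequencies d ρ)ᶜ = Metric.ball 0 (ρ / (2 * Real.pi)) := by
  have hp := Real.pi_pos
  ext ξ
  simp only [highFrequencies, mem_compl_iff, mem_ofPred_eq, not_le, mem_ball_zero_iff]
  rw [lt_div_iff₀ (by positivity), mul_comm]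

theorem eLpNorm_indicator_highFrequencies_le {s ρ : ℝ} (hs : 0 < s) (hρ : 0 < ρ) (u : E d → ℝ) :
    eLpNorm ((highFrequencies d ρ).indicator (ft u)) 2 volume
      ≤ ENNReal.ofReal (ρ ^ (-s)) * rieszSeminorm s u := by
  have hp := Real.pi_pos
  refine eLpNorm_le_mul_eLpNorm_of_ae_le_mul (Eventually.of_forall fun ξ => ?_) 2
  rw [Real.norm_of_nonneg (by positivity)]
  by_cases hξ : ξ ∈ highFrequencies d ρ
  · rw [indicator_of_mem hξ, ← mul_assoc]
    have h1 : ρ ^ s ≤ (2 * Real.pi * ‖ξ‖) ^ s := Real.rpow_le_rpow hρ.le hξ hs.le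
    have h2 : 1 ≤ ρ ^ (-s) * (2 * Real.pi * ‖ξ‖) ^ s := by
      rw [Real.rpow_neg hρ.le, ← div_eq_inv_mul, one_le_div (by positivity)]
      exact h1
    nlinarith [norm_nonneg (ft u ξ)]
  · rw [indicator_of_notMem hξ, norm_zero]
    positivity

theorem eLpNorm_indicator_le_of_bound {α F : Type*} [MeasurableSpace α] {μ : Measure α}
    [NormedAddCommGroup F] {S : Set α} (hS : MeasurableSet S) {f : α → F} {c : ℝ} (hc : 0 ≤ c)
    (h : ∀ x ∈ S, ‖f x‖ ≤ c) :
    eLpNorm (S.indicator f) 2 μ ≤ ENNReal.ofReal c * μ S ^ (2⁻¹ : ℝ) := by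
  calc eLpNorm (S.indicator f) 2 μ ≤ eLpNorm (S.indicator fun _ => c) 2 μ := by
        refine eLpNorm_mono fun x => ?_
        by_cases hx : x ∈ S
        · rw [indicator_of_mem hx, indicator_of_mem hx, Real.norm_of_nonneg hc]
          exact h x hx
        · simp [hx]
    _ = _ := by
        rw [eLpNorm_indicator_const hS two_ne_zero ENNReal.ofNat_ne_top, Real.enorm_of_nonneg hc]
        norm_num

theorem enorm_le_low_add_high (hΩ : IsOpen Ω) (hΩb : Bornology.IsBounded Ω) (u : L2 Ω) (ρ : ℝ) :
    ‖u‖ₑ ≤ eLpNorm ((Metric.ball 0 (ρ / (2 * Real.pi))).indicator (ft (Ω.indicator u))) 2 volume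
      + eLpNorm ((highFrequencies d ρ).indicator (ft (Ω.indicator u))) 2 volume := by
  have hc := continuous_ft (integrable_indicator_L2 hΩ hΩb u)
  have hm := measurableSet_highFrequencies (d := d) ρ
  rw [← eLpNorm_ft_indicator hΩ hΩb, ← compl_highFrequencies, add_comm]
  conv_lhs => rw [← indicator_self_add_compl (highFrequencies d ρ) (ft (Ω.indicator u))]
  exact eLpNorm_add_le (hc.aestronglyMeasurable.indicator hm)
    (hc.aestronglyMeasurable.indicator hm.compl) one_le_two

/-- The volume of the ball tends to 0 with ρ because d > 0. The bound 1/2 is chosen so that the low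
frequencies can be absorbed in the Poincaré inequality. -/
theorem exists_radius_volume_ball_le (hd : 0 < d) (κ : ℝ) :
    ∃ ρ : ℝ, 0 < ρ ∧ ρ ≤ 1 ∧
      κ * (volume (Metric.ball (0 : E d) (ρ / (2 * Real.pi)))).toReal ^ (2⁻¹ : ℝ) ≤ 2⁻¹ := by
  have hp := Real.pi_pos
  set b := (volume (Metric.ball (0 : E d) 1)).toReal with hb
  have hcont : Continuous fun ρ : ℝ => κ * ((ρ / (2 * Real.pi)) ^ d * b) ^ (2⁻¹ : ℝ) :=
    continuous_const.mul ((Real.continuous_rpow_const (by norm_num)).comp (by fun_prop))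
  have hlim := hcont.tendsto 0
  have e0 : κ * (((0 : ℝ) / (2 * Real.pi)) ^ d * b) ^ (2⁻¹ : ℝ) = 0 := by
    rw [zero_div, zero_pow hd.ne', zero_mul, Real.zero_rpow (by norm_num), mul_zero]
  rw [e0] at hlim
  have h1 := (hlim.eventually_le_const (u := 2⁻¹) (by norm_num)).filter_mono
    (nhdsWithin_le_nhds (s := Ioi 0))
  obtain ⟨ρ, h1, h2⟩ := (h1.and (Ioo_mem_nhdsGT one_pos)).exists
  refine ⟨ρ, h2.1, h2.2.le, ?_⟩
  have hr : 0 < ρ / (2 * Real.pi) := div_pos h2.1 (by positivity)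
  rw [Measure.addHaar_ball_of_pos _ _ hr, ENNReal.toReal_mul, finrank_euclideanSpace_fin,
    ENNReal.toReal_ofReal (by positivity)]
  exact h1

/-- The Poincaré inequality, uniformly in the order `s ∈ (0, 1]`. -/
theorem exists_poincare (hd : 0 < d) (hΩ : IsOpen Ω) (hΩb : Bornology.IsBounded Ω) :
    ∃ C : ℝ, 0 < C ∧ ∀ s ∈ Ioc (0 : ℝ) 1, ∀ (u : L2 Ω) (M : ℝ), 0 ≤ M →
      rieszSeminorm s (Ω.indicator u) ≤ ENNReal.ofReal M → ‖u‖ ≤ C * M := by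
  obtain ⟨ρ, hρ0, hρ1, hρ⟩ := exists_radius_volume_ball_le hd √(volume.real Ω)
  -- Low frequencies contribute at most ‖u‖/2 and high frequencies at most ρ^(-s) M ≤ ρ⁻¹ M, as ρ ≤
  -- 1 and s ≤ 1. Absorbing the first term doubles the second.
  refine ⟨2 * ρ⁻¹, by positivity, fun s hs u M hM hu => ?_⟩
  have hlow := eLpNorm_indicator_le_of_bound (μ := volume) (S := Metric.ball (0 : E d)
    (ρ / (2 * Real.pi))) Metric.isOpen_ball.measurableSet (f := ft (Ω.indicator u))
    (c := √(volume.real Ω) * ‖u‖) (by positivity) fun ξ _ => norm_ft_indicator_le hΩ hΩb u ξ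
  have hhigh := (eLpNorm_indicator_highFrequencies_le hs.1 hρ0 (Ω.indicator u)).trans
    (mul_le_mul_right hu _)
  have h := (enorm_le_low_add_high hΩ hΩb u ρ).trans (add_le_add hlow hhigh)
  set B := volume (Metric.ball (0 : E d) (ρ / (2 * Real.pi))) with hB
  have hBtop : B ≠ ⊤ := measure_ball_lt_top.ne
  have e : ENNReal.ofReal (√(volume.real Ω) * ‖u‖) * B ^ (2⁻¹ : ℝ) +
      ENNReal.ofReal (ρ ^ (-s)) * ENNReal.ofReal M
      = ENNReal.ofReal (√(volume.real Ω) * ‖u‖ * B.toReal ^ (2⁻¹ : ℝ) + ρ ^ (-s) * M) := by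
    have hB2 : B ^ (2⁻¹ : ℝ) = ENNReal.ofReal (B.toReal ^ (2⁻¹ : ℝ)) := by
      rw [← ENNReal.ofReal_rpow_of_nonneg ENNReal.toReal_nonneg (by norm_num),
        ENNReal.ofReal_toReal hBtop]
    rw [hB2, ENNReal.ofReal_add (by positivity) (by positivity), ← ENNReal.ofReal_mul
      (by positivity), ← ENNReal.ofReal_mul (by positivity)]
  rw [e, ← ofReal_norm, ENNReal.ofReal_le_ofReal_iff (by positivity)] at h
  have h1 : √(volume.real Ω) * ‖u‖ * B.toReal ^ (2⁻¹ : ℝ) ≤ 2⁻¹ * ‖u‖ := by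
    calc _ = (√(volume.real Ω) * B.toReal ^ (2⁻¹ : ℝ)) * ‖u‖ := by ring
      _ ≤ _ := by gcongr
  have h2 : ρ ^ (-s) ≤ ρ⁻¹ := by
    rw [← Real.rpow_neg_one]
    exact Real.rpow_le_rpow_of_exponent_ge hρ0 hρ1 (by linarith [hs.2])
  have h3 : ρ ^ (-s) * M ≤ ρ⁻¹ * M := by gcongr
  linarith

/-- Pointwise convergence becomes uniform on balls by the Arzelà–Ascoli argument: the transforms are
equi-Lipschitz, so a finite net of frequencies controls them all. -/
theorem eventually_norm_ft_le (hΩ : IsOpen Ω) (hΩb : Bornology.IsBounded Ω) {ι : Type*}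
    {l : Filter ι} {w : ι → L2 Ω} {M : ℝ} (hM : ∀ i, ‖w i‖ ≤ M)
    (hlim : ∀ ξ, Tendsto (fun i => ft (Ω.indicator (w i)) ξ) l (𝓝 0)) {c : ℝ} (hc : 0 < c)
    (R : ℝ) : ∀ᶠ i in l, ∀ ξ ∈ Metric.ball (0 : E d) R, ‖ft (Ω.indicator (w i)) ξ‖ ≤ c := by
  rcases l.eq_or_neBot with rfl | hne
  · simp
  obtain ⟨i₀⟩ := l.nonempty_of_neBot
  have hM0 : 0 ≤ M := (norm_nonneg _).trans (hM i₀)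
  have hp := Real.pi_pos
  obtain ⟨r, hr0, hr⟩ : ∃ r : ℝ, 0 ≤ r ∧ Ω ⊆ Metric.closedBall 0 r := by
    obtain ⟨r, hr⟩ := hΩb.subset_closedBall (0 : E d)
    exact ⟨max r 0, le_max_right _ _, hr.trans (Metric.closedBall_subset_closedBall
      (le_max_left _ _))⟩
  set L := 2 * Real.pi * r * (√(volume.real Ω) * M) with hL
  have hL0 : 0 ≤ L := by positivity
  obtain ⟨t, -, htf, ht⟩ := (isCompact_closedBall (0 : E d) R).finite_cover_balls
    (e := c / (2 * (L + 1))) (by positivity)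
  have hev : ∀ᶠ i in l, ∀ ζ ∈ t, ‖ft (Ω.indicator (w i)) ζ‖ < c / 2 := by
    rw [Filter.eventually_all_finite htf]
    intro ζ _
    have := (hlim ζ).norm
    rw [norm_zero] at this
    exact this.eventually_lt_const (by positivity)
  filter_upwards [hev] with i hi ξ hξ
  obtain ⟨ζ, hζ, hξζ⟩ := mem_iUnion₂.1 (ht (Metric.ball_subset_closedBall hξ))
  have h1 := norm_ft_indicator_sub_le hΩ hΩb hr0 hr (w i) ξ ζ
  have h2 := hi ζ hζ
  rw [Metric.mem_ball, dist_eq_norm, lt_div_iff₀ (by positivity)] at hξζ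
  have h3 : 2 * Real.pi * r * ‖ξ - ζ‖ * (√(volume.real Ω) * ‖w i‖) ≤ ‖ξ - ζ‖ * L := by
    calc _ ≤ 2 * Real.pi * r * ‖ξ - ζ‖ * (√(volume.real Ω) * M) := by gcongr; exact hM i
      _ = _ := by rw [hL]; ring
  have h4 := norm_le_norm_sub_add (ft (Ω.indicator (w i)) ξ) (ft (Ω.indicator (w i)) ζ)
  nlinarith [norm_nonneg (ξ - ζ)]

theorem tendsto_eLpNorm_indicator_highFrequencies {f : E d → ℂ} (hf : MemLp f 2) :
    Tendsto (fun ρ : ℝ => eLpNorm ((highFrequencies d ρ).indicator f) 2 volume) atTop (𝓝 0) := by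
  refine tendsto_eLpNorm_two_of_dominated hf.norm
    (Eventually.of_forall fun ρ => hf.1.indicator (measurableSet_highFrequencies ρ))
    (Eventually.of_forall fun ρ => Eventually.of_forall fun ξ => norm_indicator_le_norm_self _ _)
    (Eventually.of_forall fun ξ => ?_)
  refine tendsto_const_nhds.congr' ?_
  filter_upwards [eventually_gt_atTop (2 * Real.pi * ‖ξ‖)] with ρ hρ
  rw [indicator_of_notMem]
  simpa [highFrequencies] using hρ

/-- Rellich's theorem, uniformly in the order `s ∈ [σ, 1]`. -/
theorem tendsto_of_weak_of_rieszSeminorm_le (hd : 0 < d) (hΩ : IsOpen Ω)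
    (hΩb : Bornology.IsBounded Ω) {σ : ℝ} (hσ : 0 < σ) {ι : Type*} {l : Filter ι} {s : ι → ℝ}
    (hs : ∀ i, s i ∈ Icc σ 1) {u : ι → L2 Ω} {M : ℝ} (hM0 : 0 ≤ M)
    (hM : ∀ i, rieszSeminorm (s i) (Ω.indicator (u i)) ≤ ENNReal.ofReal M) {v : L2 Ω}
    (hw : ∀ ℓ : L2 Ω →L[ℝ] ℝ, Tendsto (fun i => ℓ (u i)) l (𝓝 (ℓ v))) :
    Tendsto u l (𝓝 v) := by
  obtain ⟨C, hC0, hC⟩ := exists_poincare hd hΩ hΩb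
  have hs0 : ∀ i, 0 < s i := fun i => hσ.trans_le (hs i).1
  have hub : ∀ i, ‖u i - v‖ ≤ C * M + ‖v‖ := fun i =>
    (norm_sub_le _ _).trans (by linarith [hC (s i) ⟨hs0 i, (hs i).2⟩ (u i) M hM0 (hM i)])
  have hpt : ∀ ξ, Tendsto (fun i => ft (Ω.indicator (u i - v : L2 Ω)) ξ) l (𝓝 0) := by
    -- The transform at a single frequency is a bounded functional on L²(Ω), so weak convergence of
    -- u gives pointwise convergence of û.
    intro ξ
    have h1 := hw (Complex.reCLM ∘L ftEval hΩ hΩb ξ)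
    have h2 := hw (Complex.imCLM ∘L ftEval hΩ hΩb ξ)
    have h3 : Tendsto (fun i => ft (Ω.indicator (u i)) ξ) l (𝓝 (ft (Ω.indicator v) ξ)) := by
      have := ((Complex.continuous_ofReal.tendsto _).comp h1).add
        (((Complex.continuous_ofReal.tendsto _).comp h2).mul_const Complex.I)
      simpa [Function.comp_def, ftEval_apply, Complex.re_add_im] using this
    have h4 := h3.sub_const (ft (Ω.indicator v) ξ)
    rw [sub_self] at h4
    refine h4.congr fun i => ?_
    rw [ft_indicator_sub hΩ hΩb]
  rw [tendsto_iff_norm_sub_tendsto_zero, Metric.tendsto_nhds]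
  intro ε hε
  have hε4 : 0 < ε / 4 := by positivity
  have hv2 := memLp_ft (integrable_indicator_L2 hΩ hΩb v) (memLp_indicator hΩ v)
  have ht1 := (tendsto_eLpNorm_indicator_highFrequencies hv2).eventually_lt_const
    (ENNReal.ofReal_pos.2 hε4)
  -- The high-frequency tail of u i carries the factor ρ^(-s i), at most ρ^(-σ) once ρ ≥ 1; this is
  -- where the lower bound σ gives uniformity. The low part and the tails of u i and v each receive
  -- ε/4.
  have ht2 : ∀ᶠ ρ : ℝ in atTop, ρ ^ (-σ) * M < ε / 4 := by
    have := (tendsto_rpow_neg_atTop hσ).mul_const M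
    rw [zero_mul] at this
    exact this.eventually_lt_const hε4
  obtain ⟨ρ, ⟨h1, h2⟩, h3⟩ := ((ht1.and ht2).and (eventually_ge_atTop 1)).exists
  have hρ0 : 0 < ρ := by linarith
  set B := volume (Metric.ball (0 : E d) (ρ / (2 * Real.pi))) with hB
  have hBtop : B ≠ ⊤ := measure_ball_lt_top.ne
  set b := B.toReal ^ (2⁻¹ : ℝ) with hb
  have hb0 : 0 ≤ b := by positivity
  have hc : 0 < ε / 4 / (b + 1) := by positivity
  filter_upwards [eventually_norm_ft_le hΩ hΩb hub hpt hc (ρ / (2 * Real.pi))] with i hi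
  rw [Real.dist_eq, sub_zero, abs_of_nonneg (norm_nonneg _)]
  have hlow : eLpNorm ((Metric.ball 0 (ρ / (2 * Real.pi))).indicator
      (ft (Ω.indicator (u i - v : L2 Ω)))) 2 volume ≤ ENNReal.ofReal (ε / 4) := by
    refine (eLpNorm_indicator_le_of_bound Metric.isOpen_ball.measurableSet hc.le hi).trans ?_
    rw [← hB, ← ENNReal.ofReal_toReal hBtop, ENNReal.ofReal_rpow_of_nonneg (by positivity)
      (by norm_num), ← hb, ← ENNReal.ofReal_mul hc.le]
    refine ENNReal.ofReal_le_ofReal ?_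
    rw [div_mul_eq_mul_div, div_le_iff₀ (by positivity)]
    nlinarith
  have hhigh : eLpNorm ((highFrequencies d ρ).indicator
      (ft (Ω.indicator (u i - v : L2 Ω)))) 2 volume
      ≤ ENNReal.ofReal (ε / 4) + ENNReal.ofReal (ε / 4) := by
    have e : (highFrequencies d ρ).indicator (ft (Ω.indicator (u i - v : L2 Ω)))
        = (highFrequencies d ρ).indicator (ft (Ω.indicator (u i)))
          - (highFrequencies d ρ).indicator (ft (Ω.indicator v)) := by
      rw [← indicator_sub']
      congr 1
      ext ξ
      exact ft_indicator_sub hΩ hΩb _ _ _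
    have hm := measurableSet_highFrequencies (d := d) ρ
    rw [e]
    refine (eLpNorm_sub_le ((continuous_ft (integrable_indicator_L2 hΩ hΩb
      (u i))).aestronglyMeasurable.indicator hm) (hv2.1.indicator hm) one_le_two).trans
      (add_le_add ?_ h1.le)
    refine (eLpNorm_indicator_highFrequencies_le (hs0 i) hρ0 _).trans
      ((mul_le_mul_right (hM i) _).trans ?_)
    rw [← ENNReal.ofReal_mul (by positivity)]
    refine ENNReal.ofReal_le_ofReal (le_trans ?_ h2.le)
    gcongr
    exact (hs i).1
  have h := (enorm_le_low_add_high hΩ hΩb (u i - v) ρ).trans (add_le_add hlow hhigh)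
  rw [← ENNReal.ofReal_add hε4.le hε4.le, ← ENNReal.ofReal_add hε4.le (by positivity),
    ← ofReal_norm, ENNReal.ofReal_le_ofReal_iff (by positivity)] at h
  linarith

end Compactness

/-! ### The space H^s_0(Ω) as a closed space of pairs (u, D^s u) -/

/-- Pairs of a function on `Ω` and a vector field on `ℝ^d`. -/
abbrev PairSpace {d : ℕ} (Ω : Set (E d)) :=
  WithLp 2 (L2 Ω × Lp (E d) 2 (volume : Measure (E d)))

/-- The pair `p` consists of the test function `φ` and its Riesz gradient. -/
structure IsTestPair {d : ℕ} {Ω : Set (E d)} (s : ℝ) (p : PairSpace Ω) (φ : E d → ℝ) : Prop where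
  isTestFunction : IsTestFunction Ω φ
  fst_ae : p.fst =ᵐ[volume.restrict Ω] φ
  snd_ae : p.snd =ᵐ[volume] rieszGrad s φ

section Pairs

variable {d : ℕ} {Ω : Set (E d)} {s : ℝ} {φ χ : E d → ℝ}

theorem rieszDeriv_add (hd : 0 < d) (hs : s ∈ Ioc (0 : ℝ) 1) (hφ : IsTestFunction Ω φ)
    (hχ : IsTestFunction Ω χ) (j : Fin d) (x : E d) :
    rieszDeriv s j (fun x => φ x + χ x) x = rieszDeriv s j φ x + rieszDeriv s j χ x := by
  rcases eq_or_lt_of_le hs.2 with rfl | hs1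
  · simp only [rieszDeriv, if_true]
    rw [fderiv_fun_add (hφ.contDiff.differentiable (by simp) x)
      (hχ.contDiff.differentiable (by simp) x)]
    rfl
  · simp only [rieszDeriv, if_neg hs1.ne]
    rw [← mul_add, ← integral_add (hφ.integrable_kernel_right hd hs.1 hs1 j x)
      (hχ.integrable_kernel_right hd hs.1 hs1 j x)]
    congr 2
    ext z
    ring

theorem rieszDeriv_const_mul (hφ : IsTestFunction Ω φ) (c : ℝ) (j : Fin d) (x : E d) :
    rieszDeriv s j (fun x => c * φ x) x = c * rieszDeriv s j φ x := by
  by_cases hs1 : s = 1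
  · simp only [rieszDeriv, if_pos hs1]
    rw [fderiv_const_mul (hφ.contDiff.differentiable (by simp) x)]
    rfl
  · simp only [rieszDeriv, if_neg hs1]
    rw [mul_left_comm c, ← integral_const_mul c]
    refine congrArg _ (integral_congr_ae (Eventually.of_forall fun z => ?_))
    simp only
    ring

theorem rieszGrad_add (hd : 0 < d) (hs : s ∈ Ioc (0 : ℝ) 1) (hφ : IsTestFunction Ω φ)
    (hχ : IsTestFunction Ω χ) (x : E d) :
    rieszGrad s (fun x => φ x + χ x) x = rieszGrad s φ x + rieszGrad s χ x := by
  ext j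
  exact rieszDeriv_add hd hs hφ hχ j x

theorem rieszGrad_const_mul (hφ : IsTestFunction Ω φ) (c : ℝ) (x : E d) :
    rieszGrad s (fun x => c * φ x) x = c • rieszGrad s φ x := by
  ext j
  exact rieszDeriv_const_mul hφ c j x

theorem IsTestPair.add (hd : 0 < d) (hs : s ∈ Ioc (0 : ℝ) 1) {p q : PairSpace Ω}
    (hp : IsTestPair s p φ) (hq : IsTestPair s q χ) :
    IsTestPair s (p + q) fun x => φ x + χ x where
  isTestFunction := hp.isTestFunction.add hq.isTestFunction
  fst_ae := by
    rw [WithLp.add_fst]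
    filter_upwards [Lp.coeFn_add p.fst q.fst, hp.fst_ae, hq.fst_ae] with x h1 h2 h3
    rw [h1, Pi.add_apply, h2, h3]
  snd_ae := by
    rw [WithLp.add_snd]
    filter_upwards [Lp.coeFn_add p.snd q.snd, hp.snd_ae, hq.snd_ae] with x h1 h2 h3
    rw [h1, Pi.add_apply, h2, h3, rieszGrad_add hd hs hp.isTestFunction hq.isTestFunction]

theorem IsTestPair.smul {p : PairSpace Ω} (hp : IsTestPair s p φ) (c : ℝ) :
    IsTestPair s (c • p) fun x => c * φ x where
  isTestFunction := hp.isTestFunction.const_mul c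
  fst_ae := by
    rw [WithLp.smul_fst]
    filter_upwards [Lp.coeFn_smul c p.fst, hp.fst_ae] with x h1 h2
    rw [h1, Pi.smul_apply, h2, smul_eq_mul]
  snd_ae := by
    rw [WithLp.smul_snd]
    filter_upwards [Lp.coeFn_smul c p.snd, hp.snd_ae] with x h1 h2
    rw [h1, Pi.smul_apply, h2, rieszGrad_const_mul hp.isTestFunction]

theorem exists_isTestPair (hd : 0 < d) (hs : s ∈ Ioc (0 : ℝ) 1) (hφ : IsTestFunction Ω φ) :
    ∃ p : PairSpace Ω, IsTestPair s p φ :=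
  ⟨WithLp.toLp 2 (((hφ.memLp 2).restrict Ω).toLp, (hφ.memLp_rieszGrad hd hs.1 hs.2).toLp), hφ,
    ((hφ.memLp 2).restrict Ω).coeFn_toLp, (hφ.memLp_rieszGrad hd hs.1 hs.2).coeFn_toLp⟩

/-- Test functions in `Ω` together with their Riesz gradients. -/
def testPairs (hd : 0 < d) (hs : s ∈ Ioc (0 : ℝ) 1) (Ω : Set (E d)) :
    Submodule ℝ (PairSpace Ω) where
  carrier := {p | ∃ φ, IsTestPair s p φ}
  add_mem' := by
    rintro p q ⟨φ, hp⟩ ⟨χ, hq⟩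
    exact ⟨_, hp.add hd hs hq⟩
  zero_mem' := by
    obtain ⟨p, hp⟩ := exists_isTestPair (Ω := Ω) hd hs IsTestFunction.zero
    exact ⟨_, by simpa using hp.smul 0⟩
  smul_mem' := by
    rintro c p ⟨φ, hp⟩
    exact ⟨_, hp.smul c⟩

/-- The space `H^s_0(Ω)`, as the space of pairs of a function and its Riesz gradient. -/
def sobolevPairs (hd : 0 < d) (hs : s ∈ Ioc (0 : ℝ) 1) (Ω : Set (E d)) :
    Submodule ℝ (PairSpace Ω) := (testPairs hd hs Ω).topologicalClosure

theorem mem_sobolevPairs_iff (hd : 0 < d) (hs : s ∈ Ioc (0 : ℝ) 1) {p : PairSpace Ω} :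
    p ∈ sobolevPairs hd hs Ω ↔ ∃ (q : ℕ → PairSpace Ω) (φ : ℕ → E d → ℝ),
      (∀ n, IsTestPair s (q n) (φ n)) ∧ Tendsto q atTop (𝓝 p) := by
  rw [sobolevPairs, ← SetLike.mem_coe, Submodule.topologicalClosure_coe,
    mem_closure_iff_seq_limit]
  constructor
  · rintro ⟨q, hq, hlim⟩
    choose φ hφ using hq
    exact ⟨q, φ, hφ, hlim⟩
  · rintro ⟨q, φ, hφ, hlim⟩
    exact ⟨q, fun n => ⟨φ n, hφ n⟩, hlim⟩

theorem IsTestPair.mem_sobolevPairs (hd : 0 < d) (hs : s ∈ Ioc (0 : ℝ) 1) {p : PairSpace Ω}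
    (hp : IsTestPair s p φ) : p ∈ sobolevPairs hd hs Ω :=
  Submodule.le_topologicalClosure _ ⟨φ, hp⟩

theorem IsTestPair.indicator_ae (hΩ : IsOpen Ω) {p : PairSpace Ω} (hp : IsTestPair s p φ) :
    Ω.indicator p.fst =ᵐ[volume] φ := by
  filter_upwards [(ae_restrict_iff' hΩ.measurableSet).1 hp.fst_ae] with x hx
  by_cases hxΩ : x ∈ Ω
  · rw [indicator_of_mem hxΩ, hx hxΩ]
  · rw [indicator_of_notMem hxΩ, image_eq_zero_of_notMem_tsupport fun h =>
      hxΩ (hp.isTestFunction.tsupport_subset h)]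

theorem isRieszGradient_congr {u u' : E d → ℝ} {w w' : E d → E d} (hu : u =ᵐ[volume] u')
    (hw : w =ᵐ[volume] w') (h : IsRieszGradient s u w) : IsRieszGradient s u' w' := by
  refine ⟨(memLp_congr_ae hu).1 h.1, (memLp_congr_ae hw).1 h.2.1, fun Φ hΦ hc => ?_⟩
  have e1 : ∫ x, inner ℝ (w' x) (Φ x) = ∫ x, inner ℝ (w x) (Φ x) :=
    integral_congr_ae (by filter_upwards [hw] with x hx; rw [hx])
  have e2 : ∫ x, u' x * rieszDiv s Φ x = ∫ x, u x * rieszDiv s Φ x :=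
    integral_congr_ae (by filter_upwards [hu] with x hx; rw [hx])
  rw [e1, e2]
  exact h.2.2 Φ hΦ hc

/-- Testing with Φ = g e_j isolates the j-th component. Uniqueness allows the gradient to be treated
as a function of u throughout. -/
theorem ae_eq_of_isRieszGradient {u : E d → ℝ} {w w' : E d → E d} (h : IsRieszGradient s u w)
    (h' : IsRieszGradient s u w') : w =ᵐ[volume] w' := by
  have hcomp : ∀ j : Fin d, ∀ᵐ x, w x j = w' x j := by
    intro j
    refine ae_eq_of_integral_contDiff_smul_eq
      ((memLp_piLp_iff.1 h.2.1 j).locallyIntegrable one_le_two)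
      ((memLp_piLp_iff.1 h'.2.1 j).locallyIntegrable one_le_two) fun g hg hgc => ?_
    have hΦ : ContDiff ℝ ∞ fun x => g x • EuclideanSpace.single j (1 : ℝ) :=
      hg.smul contDiff_const
    have hc : HasCompactSupport fun x => g x • EuclideanSpace.single j (1 : ℝ) :=
      hgc.smul_right
    have e : ∀ v : E d → E d, (fun x => inner ℝ (v x) (g x • EuclideanSpace.single j (1 : ℝ)))
        = fun x => g x • v x j := by
      intro v
      ext x
      rw [real_inner_smul_right, EuclideanSpace.inner_single_right]
      simp
    have h1 := h.2.2 _ hΦ hc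
    have h2 := h'.2.2 _ hΦ hc
    rw [e] at h1 h2
    rw [h1, h2]
  filter_upwards [eventually_countable_forall.2 hcomp] with x hx
  ext j
  exact hx j

theorem integral_indicator_mul (hΩ : IsOpen Ω) (u : L2 Ω) (g : E d → ℝ) :
    ∫ x, Ω.indicator u x * g x = ∫ x in Ω, u x * g x := by
  rw [← integral_indicator hΩ.measurableSet]
  congr with x
  by_cases hx : x ∈ Ω <;> simp [hx]

theorem inner_toLp_eq (hΩ : IsOpen Ω) (u : L2 Ω) {g : E d → ℝ} (hg : MemLp g 2) :
    inner ℝ u ((hg.restrict Ω).toLp g) = ∫ x, Ω.indicator u x * g x := by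
  rw [integral_indicator_mul hΩ, L2.inner_def]
  refine integral_congr_ae ?_
  filter_upwards [(hg.restrict Ω).coeFn_toLp] with x hx
  rw [hx]
  simp [mul_comm]

theorem inner_toLp_vector_eq (w : Lp (E d) 2 (volume : Measure (E d))) {Φ : E d → E d}
    (hΦ : MemLp Φ 2) : inner ℝ w (hΦ.toLp Φ) = ∫ x, inner ℝ (w x) (Φ x) := by
  rw [L2.inner_def]
  refine integral_congr_ae ?_
  filter_upwards [hΦ.coeFn_toLp] with x hx
  rw [hx]

/-- For a fixed Φ the defining identity is a closed condition on the pair, since D^s · Φ is in L²,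
and it holds for test pairs. -/
theorem isRieszGradient_of_mem (hd : 0 < d) (hs : s ∈ Ioc (0 : ℝ) 1) (hΩ : IsOpen Ω)
    {p : PairSpace Ω} (hp : p ∈ sobolevPairs hd hs Ω) :
    IsRieszGradient s (Ω.indicator p.fst) p.snd := by
  refine ⟨memLp_indicator hΩ _, Lp.memLp _, fun Φ hΦ hc => ?_⟩
  have hΦ2 : MemLp Φ 2 := hΦ.continuous.memLp_of_hasCompactSupport hc
  have hD := memLp_rieszDiv hd hs.1 hs.2 hΦ hc
  rw [← inner_toLp_vector_eq _ hΦ2, ← inner_toLp_eq hΩ _ hD]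
  have hcl : IsClosed {p : PairSpace Ω | inner ℝ p.snd (hΦ2.toLp Φ)
      = -inner ℝ p.fst ((hD.restrict Ω).toLp _)} := by
    refine isClosed_eq ?_ ?_
    · exact (WithLp.continuous_snd ..).inner continuous_const
    · exact ((WithLp.continuous_fst ..).inner continuous_const).neg
  refine closure_minimal ?_ hcl hp
  rintro q ⟨φ, hq⟩
  have h := (isRieszGradient_congr (hq.indicator_ae hΩ).symm hq.snd_ae.symm
    (hq.isTestFunction.isRieszGradient hd hs.1 hs.2)).2.2 Φ hΦ hc
  rw [← inner_toLp_vector_eq _ hΦ2, ← inner_toLp_eq hΩ _ hD] at h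
  exact h

theorem memHs0_of_mem (hd : 0 < d) (hs : s ∈ Ioc (0 : ℝ) 1) (hΩ : IsOpen Ω)
    {p : PairSpace Ω} (hp : p ∈ sobolevPairs hd hs Ω) : MemHs0 Ω s (Ω.indicator p.fst) := by
  obtain ⟨q, φ, hq, hlim⟩ := (mem_sobolevPairs_iff hd hs).1 hp
  refine ⟨p.snd, isRieszGradient_of_mem hd hs hΩ hp, φ, fun n => rieszGrad s (φ n), fun n =>
    ⟨(hq n).isTestFunction.contDiff, (hq n).isTestFunction.hasCompactSupport,
      (hq n).isTestFunction.tsupport_subset,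
      (hq n).isTestFunction.isRieszGradient hd hs.1 hs.2⟩, ?_, ?_⟩
  · have h1 : Tendsto (fun n => (q n).fst - p.fst) atTop (𝓝 0) := by
      simpa using (((WithLp.continuous_fst ..).tendsto p).comp hlim).sub_const p.fst
    have h2 := h1.enorm
    rw [enorm_zero] at h2
    refine h2.congr fun n => ?_
    rw [← eLpNorm_indicator hΩ]
    refine eLpNorm_congr_ae ?_
    have h3 := (ae_restrict_iff' hΩ.measurableSet).1 (Lp.coeFn_sub (q n).fst p.fst)
    filter_upwards [h3, (hq n).indicator_ae hΩ] with x hx1 hx2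
    rw [Pi.sub_apply, ← hx2]
    by_cases hx : x ∈ Ω
    · simpa [hx] using hx1 hx
    · simp [hx]
  · have h1 : Tendsto (fun n => (q n).snd - p.snd) atTop (𝓝 0) := by
      simpa using (((WithLp.continuous_snd ..).tendsto p).comp hlim).sub_const p.snd
    have h2 := h1.enorm
    rw [enorm_zero] at h2
    refine h2.congr fun n => ?_
    rw [Lp.enorm_def]
    refine eLpNorm_congr_ae ?_
    filter_upwards [Lp.coeFn_sub (q n).snd p.snd, (hq n).snd_ae] with x hx1 hx2
    rw [hx1, Pi.sub_apply, Pi.sub_apply, hx2]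

/-- The prescribed gradient z need not be the one witnessing membership, nor the approximating
gradients the singular integrals; uniqueness identifies them almost everywhere. -/
theorem exists_mem_of_memHs0 (hd : 0 < d) (hs : s ∈ Ioc (0 : ℝ) 1)
    {v : E d → ℝ} {z : E d → E d} (hv : MemHs0 Ω s v) (hz : IsRieszGradient s v z) :
    ∃ p ∈ sobolevPairs hd hs Ω, p.fst =ᵐ[volume.restrict Ω] v ∧ p.snd =ᵐ[volume] z := by
  obtain ⟨w, hw, φ, ψ, hφ, hφv, hψw⟩ := hv
  have htest : ∀ n, IsTestFunction Ω (φ n) := fun n => ⟨(hφ n).1, (hφ n).2.1, (hφ n).2.2.1⟩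
  choose q hq using fun n => exists_isTestPair hd hs (htest n)
  let p : PairSpace Ω := WithLp.toLp 2 ((hz.1.restrict Ω).toLp, hz.2.1.toLp)
  have hp1 : p.fst =ᵐ[volume.restrict Ω] v := (hz.1.restrict Ω).coeFn_toLp
  have hp2 : p.snd =ᵐ[volume] z := hz.2.1.coeFn_toLp
  refine ⟨p, (mem_sobolevPairs_iff hd hs).2 ⟨q, φ, hq, ?_⟩, hp1, hp2⟩
  have h1 : Tendsto (fun n => (q n).fst) atTop (𝓝 p.fst) := by
    rw [tendsto_iff_edist_tendsto_0]
    refine tendsto_of_tendsto_of_tendsto_of_le_of_le tendsto_const_nhds hφv (fun _ => zero_le)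
      fun n => ?_
    simp only [Lp.edist_def]
    refine (eLpNorm_congr_ae ?_).trans_le
      (eLpNorm_mono_measure (φ n - v) (Measure.restrict_le_self (s := Ω)))
    filter_upwards [(hq n).fst_ae, hp1] with x hx1 hx2
    rw [Pi.sub_apply, Pi.sub_apply, hx1, hx2]
  have h2 : Tendsto (fun n => (q n).snd) atTop (𝓝 p.snd) := by
    rw [tendsto_iff_edist_tendsto_0]
    refine hψw.congr fun n => ?_
    simp only [Lp.edist_def]
    refine eLpNorm_congr_ae ?_
    filter_upwards [(hq n).snd_ae, hp2, ae_eq_of_isRieszGradient hw hz, ae_eq_of_isRieszGradient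
      (hφ n).2.2.2 ((htest n).isRieszGradient hd hs.1 hs.2)] with x hx1 hx2 hx3 hx4
    rw [Pi.sub_apply, Pi.sub_apply, hx1, hx2, hx3, hx4]
  exact ((WithLp.prod_continuous_toLp ..).tendsto _).comp (h1.prodMk_nhds h2)

/-- For test pairs this is an equality, by Plancherel. L² convergence on Ω makes the transforms
converge at every frequency, and Fatou carries the inequality to the closure. -/
theorem rieszSeminorm_le_of_mem (hd : 0 < d) (hs : s ∈ Ioc (0 : ℝ) 1) (hΩ : IsOpen Ω)
    (hΩb : Bornology.IsBounded Ω) {p : PairSpace Ω} (hp : p ∈ sobolevPairs hd hs Ω) :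
    rieszSeminorm s (Ω.indicator p.fst) ≤ ENNReal.ofReal ‖p.snd‖ := by
  obtain ⟨q, φ, hq, hlim⟩ := (mem_sobolevPairs_iff hd hs).1 hp
  have h2 := (((WithLp.continuous_snd ..).tendsto p).comp hlim).enorm
  have hfst := ((WithLp.continuous_fst ..).tendsto p).comp hlim
  have hcont : ∀ f : E d → ℝ, Integrable f →
      Continuous fun ξ : E d => (2 * Real.pi * ‖ξ‖) ^ s * ‖ft f ξ‖ := fun f hf =>
    ((Real.continuous_rpow_const hs.1.le).comp (by fun_prop)).mul (continuous_ft hf).norm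
  have h3 := Lp.eLpNorm_lim_le_liminf_eLpNorm (p := 2) (μ := (volume : Measure (E d)))
    (f := fun n ξ => (2 * Real.pi * ‖ξ‖) ^ s * ‖ft (Ω.indicator (q n).fst) ξ‖)
    (fun n => (hcont _ (integrable_indicator_L2 hΩ hΩb _)).aestronglyMeasurable)
    (fun ξ => (2 * Real.pi * ‖ξ‖) ^ s * ‖ft (Ω.indicator p.fst) ξ‖)
    (Eventually.of_forall fun ξ =>
      ((((ftEval hΩ hΩb ξ).continuous.tendsto _).comp hfst).norm).const_mul _)
  refine h3.trans (le_of_eq ?_)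
  rw [ofReal_norm, ← h2.liminf_eq]
  congr 1
  ext n
  rw [ft_congr_ae ((hq n).indicator_ae hΩ), ← (hq n).isTestFunction.eLpNorm_rieszGrad hd hs.1 hs.2,
    Function.comp, Lp.enorm_def]
  exact (eLpNorm_congr_ae (hq n).snd_ae).symm

theorem IsTestPair.enorm_le (hd : 0 < d) (hs : s ∈ Ioc (0 : ℝ) 1) (hΩ : IsOpen Ω)
    {p : PairSpace Ω} (hp : IsTestPair s p φ) : ‖p‖ₑ ≤ 2 * sobolevNorm s φ := by
  have h1 : ‖p.fst‖ₑ ≤ sobolevNorm s φ := by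
    rw [← eLpNorm_indicator hΩ, eLpNorm_congr_ae (hp.indicator_ae hΩ)]
    exact eLpNorm_le_sobolevNorm hp.isTestFunction.integrable (hp.isTestFunction.memLp 2) s
  have h2 : ‖p.snd‖ₑ ≤ sobolevNorm s φ := by
    rw [Lp.enorm_def, eLpNorm_congr_ae hp.snd_ae, hp.isTestFunction.eLpNorm_rieszGrad hd hs.1 hs.2]
    exact eLpNorm_rpow_mul_ft_le_sobolevNorm s φ
  have h3 : ‖p‖ ≤ ‖p.fst‖ + ‖p.snd‖ := by
    refine (pow_le_pow_iff_left₀ (norm_nonneg _) (by positivity) two_ne_zero).1 ?_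
    rw [WithLp.prod_norm_sq_eq_of_L2]
    nlinarith [norm_nonneg p.fst, norm_nonneg p.snd]
  calc ‖p‖ₑ ≤ ‖p.fst‖ₑ + ‖p.snd‖ₑ := by
        rw [← ofReal_norm, ← ofReal_norm, ← ofReal_norm,
          ← ENNReal.ofReal_add (norm_nonneg _) (norm_nonneg _)]
        exact ENNReal.ofReal_le_ofReal h3
    _ ≤ _ := by rw [two_mul]; exact add_le_add h1 h2

/-- On a bounded Lipschitz domain, membership in `H^s_0(Ω)` is a condition on the Fourier
transform. -/
theorem exists_mem_of_sobolevNorm_lt_top (hd : 0 < d) (hs : s ∈ Ioc (0 : ℝ) 1) (hΩ : IsOpen Ω)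
    (hΩb : Bornology.IsBounded Ω) (hΩL : HasLipschitzBoundary Ω) {u : L2 Ω}
    (hu : sobolevNorm s (Ω.indicator u) < ⊤) : ∃ p ∈ sobolevPairs hd hs Ω, p.fst = u := by
  have hui := integrable_indicator_L2 hΩ hΩb u
  have happ := sobolevApproximable_of_hasLipschitzBoundary hΩ hΩb hΩL hs.1 hs.2
    hui hu fun x hx => indicator_of_notMem hx _
  choose φ hφ hφu using fun n : ℕ => happ (ENNReal.ofReal (1 / ((n : ℝ) + 1)))
    (ENNReal.ofReal_pos.2 (by positivity))
  choose q hq using fun n => exists_isTestPair hd hs (hφ n)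
  have hsub : ∀ n m, IsTestPair s (q n - q m) fun x => φ n x + -1 * φ m x := fun n m => by
    have := (hq n).add hd hs ((hq m).smul (-1))
    rwa [neg_one_smul, ← sub_eq_add_neg] at this
  have hneg : ∀ m, sobolevNorm s (fun x => Ω.indicator u x + -1 * φ m x)
      ≤ ENNReal.ofReal (1 / ((m : ℝ) + 1)) := by
    intro m
    refine le_trans (le_of_eq ?_) (hφu m).le
    have e : (fun x => Ω.indicator u x + -1 * φ m x)
        = fun x => -1 * (φ m x - Ω.indicator u x) := by ext x; ring
    rw [sobolevNorm, sobolevNorm, e]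
    congr 1
    ext ξ
    rw [ft_const_mul]
    simp
  -- Each approximant is within 1/(N+1) of u, and the pair norm is at most twice the Bessel
  -- potential norm, whence 4. Completeness then supplies the gradient of u.
  have hdist : ∀ n m N : ℕ, N ≤ n → N ≤ m → dist (q n) (q m) ≤ 4 * (1 / ((N : ℝ) + 1)) := by
    intro n m N hn hm
    have hN : ∀ k : ℕ, N ≤ k → ENNReal.ofReal (1 / ((k : ℝ) + 1))
        ≤ ENNReal.ofReal (1 / ((N : ℝ) + 1)) := fun k hk =>
      ENNReal.ofReal_le_ofReal (by gcongr)
    have h1 : ‖q n - q m‖ₑ ≤ 2 * (ENNReal.ofReal (1 / ((N : ℝ) + 1)) +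
        ENNReal.ofReal (1 / ((N : ℝ) + 1))) := by
      refine ((hsub n m).enorm_le hd hs hΩ).trans (mul_le_mul_right ?_ _)
      have e : (fun x => φ n x + -1 * φ m x)
          = fun x => (φ n x - Ω.indicator u x) + (Ω.indicator u x + -1 * φ m x) := by
        ext x; ring
      rw [e]
      refine (sobolevNorm_add_le hs.1 ((hφ n).integrable.sub hui)
        (hui.add ((hφ m).integrable.const_mul (-1)))).trans (add_le_add ?_ ?_)
      · exact (hφu n).le.trans (hN n hn)
      · exact (hneg m).trans (hN m hm)
    rw [← ENNReal.ofReal_add (by positivity) (by positivity), two_mul,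
      ← ENNReal.ofReal_add (by positivity) (by positivity),
      ← ofReal_norm, ENNReal.ofReal_le_ofReal_iff (by positivity)] at h1
    rw [dist_eq_norm]
    linarith
  have hcauchy : CauchySeq q := by
    refine cauchySeq_of_le_tendsto_0 (fun N : ℕ => 4 * (1 / ((N : ℝ) + 1))) hdist ?_
    simpa using (tendsto_one_div_add_atTop_nhds_zero_nat (𝕜 := ℝ)).const_mul 4
  obtain ⟨p, hp⟩ := cauchySeq_tendsto_of_complete hcauchy
  refine ⟨p, (mem_sobolevPairs_iff hd hs).2 ⟨q, φ, hq, hp⟩, ?_⟩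
  refine tendsto_nhds_unique (((WithLp.continuous_fst ..).tendsto p).comp hp) ?_
  rw [tendsto_iff_edist_tendsto_0]
  have hlim : Tendsto (fun n : ℕ => ENNReal.ofReal (1 / ((n : ℝ) + 1))) atTop (𝓝 0) := by
    simpa using ENNReal.tendsto_ofReal (tendsto_one_div_add_atTop_nhds_zero_nat (𝕜 := ℝ))
  refine tendsto_of_tendsto_of_tendsto_of_le_of_le tendsto_const_nhds hlim (fun _ => zero_le)
    fun n => ?_
  have hm : MemLp (fun x => φ n x - Ω.indicator u x) 2 :=
    ((hφ n).memLp 2).sub (memLp_indicator hΩ u)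
  refine le_trans ?_ (((eLpNorm_le_sobolevNorm ((hφ n).integrable.sub hui) hm s)).trans (hφu n).le)
  simp only [Function.comp, Lp.edist_def]
  refine (eLpNorm_congr_ae ?_).trans_le (eLpNorm_mono_measure _ (Measure.restrict_le_self (s := Ω)))
  filter_upwards [(hq n).fst_ae, ae_restrict_mem hΩ.measurableSet] with x hx1 hx2
  rw [Pi.sub_apply, hx1, Pi.sub_apply, indicator_of_mem hx2]

end Pairs

/-! ### The coefficient matrix as a bounded coercive operator -/

section Coefficients

variable {d : ℕ}

theorem inner_toLp_mulVec (A : Matrix (Fin d) (Fin d) ℝ) (w z : E d) :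
    inner ℝ (WithLp.toLp 2 (A *ᵥ w.ofLp)) z = (A *ᵥ w.ofLp) ⬝ᵥ z.ofLp := by
  rw [EuclideanSpace.inner_eq_star_dotProduct, dotProduct_comm]
  rfl

theorem mulVec_dotProduct_comm {A : Matrix (Fin d) (Fin d) ℝ} (hA : A.IsSymm) (w z : Fin d → ℝ) :
    (A *ᵥ w) ⬝ᵥ z = (A *ᵥ z) ⬝ᵥ w := by
  rw [dotProduct_comm, Matrix.dotProduct_mulVec, ← Matrix.mulVec_transpose, hA.eq]

/-- Polarisation: 4 ‖w‖ ‖z‖ (Aw · z) is the difference of the quadratic form at ‖z‖w + ‖w‖z and at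
‖z‖w - ‖w‖z. The second value is nonnegative and the first vector has norm at most 2 ‖w‖ ‖z‖. -/
theorem mulVec_dotProduct_le {A : Matrix (Fin d) (Fin d) ℝ} {b : ℝ} (hA : A.IsSymm)
    (hA0 : ∀ z : E d, 0 ≤ (A *ᵥ z.ofLp) ⬝ᵥ z.ofLp)
    (hAb : ∀ z : E d, (A *ᵥ z.ofLp) ⬝ᵥ z.ofLp ≤ b * ‖z‖ ^ 2) (w z : E d) :
    (A *ᵥ w.ofLp) ⬝ᵥ z.ofLp ≤ b * (‖w‖ * ‖z‖) := by
  rcases eq_or_ne w 0 with rfl | hw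
  · simp
  rcases eq_or_ne z 0 with rfl | hz
  · simp
  have hw' := norm_pos_iff.2 hw
  have hz' := norm_pos_iff.2 hz
  have h1 := hAb (‖z‖ • w + ‖w‖ • z)
  have h2 := hA0 (‖z‖ • w - ‖w‖ • z)
  have hnorm : ‖‖z‖ • w + ‖w‖ • z‖ ^ 2 ≤ (2 * (‖w‖ * ‖z‖)) ^ 2 := by
    refine pow_le_pow_left₀ (norm_nonneg _) ((norm_add_le _ _).trans (le_of_eq ?_)) 2
    rw [norm_smul, norm_smul, norm_norm, norm_norm]
    ring
  have hb : 0 ≤ b := by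
    have := (hA0 w).trans (hAb w)
    exact nonneg_of_mul_nonneg_left this (by positivity)
  have h3 := h1.trans (mul_le_mul_of_nonneg_left hnorm hb)
  simp only [WithLp.ofLp_add, WithLp.ofLp_sub, WithLp.ofLp_smul, Matrix.mulVec_add,
    Matrix.mulVec_sub, Matrix.mulVec_smul, add_dotProduct, sub_dotProduct, smul_dotProduct,
    dotProduct_add, dotProduct_sub, dotProduct_smul, smul_eq_mul,
    mulVec_dotProduct_comm hA z.ofLp w.ofLp] at h2 h3
  have h4 : (‖w‖ * ‖z‖) * ((A *ᵥ w.ofLp) ⬝ᵥ z.ofLp) ≤ (‖w‖ * ‖z‖) * (b * (‖w‖ * ‖z‖)) := by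
    nlinarith
  exact le_of_mul_le_mul_left h4 (by positivity)

theorem norm_toLp_mulVec_le {A : Matrix (Fin d) (Fin d) ℝ} {b : ℝ} (hA : A.IsSymm)
    (hA0 : ∀ z : E d, 0 ≤ (A *ᵥ z.ofLp) ⬝ᵥ z.ofLp)
    (hAb : ∀ z : E d, (A *ᵥ z.ofLp) ⬝ᵥ z.ofLp ≤ b * ‖z‖ ^ 2) (w : E d) :
    ‖(WithLp.toLp 2 (A *ᵥ w.ofLp) : E d)‖ ≤ |b| * ‖w‖ := by
  have h := mulVec_dotProduct_le hA hA0 hAb w (WithLp.toLp 2 (A *ᵥ w.ofLp))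
  rw [← inner_toLp_mulVec, real_inner_self_eq_norm_sq] at h
  rcases (norm_nonneg (WithLp.toLp 2 (A *ᵥ w.ofLp) : E d)).eq_or_lt with h0 | h0
  · rw [← h0]; positivity
  · refine le_trans ?_ (mul_le_mul_of_nonneg_right (le_abs_self b) (norm_nonneg w))
    refine le_of_mul_le_mul_right ?_ h0
    nlinarith

/-- Multiplication by the coefficient matrix, as an operator on square integrable fields. -/
theorem exists_coefficientOperator {A : E d → Matrix (Fin d) (Fin d) ℝ} {a b : ℝ} (ha : 0 < a)
    (hA : IsEllipticMatrix A a b) :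
    ∃ S : Lp (E d) 2 (volume : Measure (E d)) →L[ℝ] Lp (E d) 2 (volume : Measure (E d)),
      (∀ w z, inner ℝ (S w) z = ∫ x, (A x *ᵥ (w x).ofLp) ⬝ᵥ (z x).ofLp) ∧
      ∀ w, a * ‖w‖ ^ 2 ≤ inner ℝ (S w) w := by
  obtain ⟨hmeas, hsymm, hell⟩ := hA
  have hbound : ∀ᵐ x, ∀ w : E d, ‖(WithLp.toLp 2 (A x *ᵥ w.ofLp) : E d)‖ ≤ |b| * ‖w‖ := by
    filter_upwards [hsymm, hell] with x h1 h2 w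
    exact norm_toLp_mulVec_le h1 (fun z => le_trans (by positivity) (h2 z).1)
      (fun z => (h2 z).2) w
  have hmem : ∀ w : Lp (E d) 2 (volume : Measure (E d)),
      MemLp (fun x => (WithLp.toLp 2 (A x *ᵥ (w x).ofLp) : E d)) 2 := by
    intro w
    refine (Lp.memLp w).of_le_mul (c := |b|) ?_ (hbound.mono fun x hx => hx _)
    refine AEMeasurable.aestronglyMeasurable ?_
    refine (WithLp.measurable_toLp 2 _).comp_aemeasurable (aemeasurable_pi_lambda _ fun i => ?_)
    simp only [Matrix.mulVec, dotProduct]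
    refine Finset.aemeasurable_fun_sum _ fun j _ => (hmeas i j).mul ?_
    exact (EuclideanSpace.proj j : E d →L[ℝ] ℝ).measurable.comp_aemeasurable
      (Lp.aestronglyMeasurable w).aemeasurable
  let S₀ : Lp (E d) 2 (volume : Measure (E d)) →ₗ[ℝ] Lp (E d) 2 (volume : Measure (E d)) :=
    { toFun := fun w => (hmem w).toLp
      map_add' := fun w z => by
        refine Lp.ext ?_
        filter_upwards [(hmem (w + z)).coeFn_toLp, (hmem w).coeFn_toLp, (hmem z).coeFn_toLp,
          Lp.coeFn_add w z, Lp.coeFn_add ((hmem w).toLp) ((hmem z).toLp)] with x h1 h2 h3 h4 h5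
        rw [h1, h5, Pi.add_apply, h2, h3, h4]
        simp [Matrix.mulVec_add]
      map_smul' := fun c w => by
        refine Lp.ext ?_
        filter_upwards [(hmem (c • w)).coeFn_toLp, (hmem w).coeFn_toLp,
          Lp.coeFn_smul c w, Lp.coeFn_smul c ((hmem w).toLp)] with x h1 h2 h4 h5
        rw [h1, RingHom.id_apply, h5, Pi.smul_apply, h2, h4]
        simp [Matrix.mulVec_smul] }
  let S := S₀.mkContinuous |b| fun w => Lp.norm_le_mul_norm_of_ae_le_mul (by
    filter_upwards [(hmem w).coeFn_toLp, hbound] with x h1 h2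
    exact (congrArg norm h1).trans_le (h2 _))
  have hS : ∀ w z, inner ℝ (S w) z = ∫ x, (A x *ᵥ (w x).ofLp) ⬝ᵥ (z x).ofLp := by
    intro w z
    rw [L2.inner_def]
    refine integral_congr_ae ?_
    filter_upwards [(hmem w).coeFn_toLp] with x h1
    rw [← inner_toLp_mulVec]
    exact congrArg (fun y => inner ℝ y (z x)) h1
  refine ⟨S, hS, fun w => ?_⟩
  rw [← real_inner_self_eq_norm_sq, L2.inner_def, L2.inner_def, ← integral_const_mul]
  refine integral_mono_ae ((L2.integrable_inner w w).const_mul a) (L2.integrable_inner _ _) ?_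
  filter_upwards [(hmem w).coeFn_toLp, hell] with x h1 h2
  have e : (S w : E d → E d) x = WithLp.toLp 2 (A x *ᵥ (w x).ofLp) := h1
  rw [e, inner_toLp_mulVec, real_inner_self_eq_norm_sq]
  exact (h2 _).1

end Coefficients

/-! ### Lax–Milgram -/

section LaxMilgram

variable {V H K : Type*} [NormedAddCommGroup V] [InnerProductSpace ℝ V] [CompleteSpace V]
  [NormedAddCommGroup H] [InnerProductSpace ℝ H] [CompleteSpace H]
  [NormedAddCommGroup K] [InnerProductSpace ℝ K]

/-- The form ⟨S G p, G q⟩ is coercive with constant a/c, and R is the inverse of its operator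
composed with the adjoint of F; this yields linearity and boundedness of the solution map at once.
-/
theorem exists_laxMilgram_operator (F : V →L[ℝ] H) (G : V →L[ℝ] K) (S : K →L[ℝ] K) {a c : ℝ}
    (ha : 0 < a) (hc : 0 < c) (hS : ∀ w, a * ‖w‖ ^ 2 ≤ inner ℝ (S w) w)
    (hG : ∀ p, ‖p‖ ^ 2 ≤ c * ‖G p‖ ^ 2) :
    ∃ R : H →L[ℝ] V, ∀ h q, inner ℝ (S (G (R h))) (G q) = inner ℝ h (F q) := by
  obtain ⟨B, hB⟩ : ∃ B : V →L[ℝ] V →L[ℝ] ℝ, ∀ p q, B p q = inner ℝ (S (G p)) (G q) :=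
    ⟨(isBoundedBilinearMap_inner (𝕜 := ℝ) (E := K)).toContinuousLinearMap.bilinearComp
      (S.comp G) G, fun p q => rfl⟩
  have hcoer : IsCoercive B := by
    refine ⟨a / c, by positivity, fun p => ?_⟩
    rw [hB]
    refine le_trans ?_ (hS _)
    rw [mul_assoc, ← sq, div_mul_eq_mul_div, div_le_iff₀ hc, mul_assoc, mul_comm _ c]
    exact mul_le_mul_of_nonneg_left (hG p) ha.le
  refine ⟨(hcoer.continuousLinearEquivOfBilin.symm : V →L[ℝ] V).comp
    (ContinuousLinearMap.adjoint F), fun h q => ?_⟩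
  rw [← hB, ← hcoer.continuousLinearEquivOfBilin_apply, ContinuousLinearMap.comp_apply,
    ContinuousLinearEquiv.coe_coe, ContinuousLinearEquiv.apply_symm_apply,
    ContinuousLinearMap.adjoint_inner_left]

end LaxMilgram

/-! ### Existence, uniqueness and bounds for weak solutions -/

section Solutions

variable {d : ℕ} {Ω : Set (E d)}
  {S : Lp (E d) 2 (volume : Measure (E d)) →L[ℝ] Lp (E d) 2 (volume : Measure (E d))}
  {V : Submodule ℝ (PairSpace Ω)} {a C : ℝ} {h : L2 Ω} {p : PairSpace Ω}

/-- `p ∈ V` satisfies `⟨S p₂, q₂⟩ = ⟨h, q₁⟩` for all `q ∈ V`. -/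
def IsPairSolution
    (S : Lp (E d) 2 (volume : Measure (E d)) →L[ℝ] Lp (E d) 2 (volume : Measure (E d)))
    (V : Submodule ℝ (PairSpace Ω)) (h : L2 Ω) (p : PairSpace Ω) : Prop :=
  p ∈ V ∧ ∀ q ∈ V, inner ℝ (S p.snd) q.snd = inner ℝ h q.fst

theorem IsPairSolution.norm_snd_le (hS : ∀ w, a * ‖w‖ ^ 2 ≤ inner ℝ (S w) w) (ha : 0 < a)
    (hC : 0 ≤ C) (hV : ∀ p ∈ V, ‖p.fst‖ ≤ C * ‖p.snd‖) (hp : IsPairSolution S V h p) :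
    ‖p.snd‖ ≤ C / a * ‖h‖ := by
  have h1 : a * ‖p.snd‖ ^ 2 ≤ ‖h‖ * (C * ‖p.snd‖) := by
    refine (hS _).trans ?_
    rw [hp.2 p hp.1]
    exact (real_inner_le_norm _ _).trans (mul_le_mul_of_nonneg_left (hV p hp.1) (norm_nonneg _))
  rcases (norm_nonneg p.snd).eq_or_lt with h0 | h0
  · rw [← h0]
    positivity
  · rw [div_mul_eq_mul_div, le_div_iff₀ ha]
    refine le_of_mul_le_mul_right ?_ h0
    nlinarith

/-- Testing the difference with itself kills its gradient by coercivity, and Poincaré then kills the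
function. -/
theorem IsPairSolution.eq (hS : ∀ w, a * ‖w‖ ^ 2 ≤ inner ℝ (S w) w) (ha : 0 < a)
    (hV : ∀ p ∈ V, ‖p.fst‖ ≤ C * ‖p.snd‖) {p q : PairSpace Ω} (hp : IsPairSolution S V h p)
    (hq : IsPairSolution S V h q) : p.fst = q.fst := by
  have hm := V.sub_mem hp.1 hq.1
  have h0 : inner ℝ (S (p - q).snd) (p - q).snd = 0 := by
    rw [WithLp.sub_snd, map_sub, inner_sub_left, ← WithLp.sub_snd, hp.2 _ hm, hq.2 _ hm, sub_self]
  have h1 : ‖(p - q).snd‖ = 0 := by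
    have := hS (p - q).snd
    rw [h0] at this
    have h2 : ‖(p - q).snd‖ ^ 2 ≤ 0 := by nlinarith
    nlinarith [norm_nonneg (p - q).snd]
  have h2 := hV _ hm
  rw [h1, mul_zero, WithLp.sub_fst] at h2
  exact sub_eq_zero.1 (norm_le_zero_iff.1 h2)

theorem exists_pairSolution (hS : ∀ w, a * ‖w‖ ^ 2 ≤ inner ℝ (S w) w) (ha : 0 < a)
    (hVc : IsClosed (V : Set (PairSpace Ω))) (hV : ∀ p ∈ V, ‖p.fst‖ ≤ C * ‖p.snd‖) :
    ∃ T : L2 Ω →L[ℝ] L2 Ω, ∀ h, ∃ p, IsPairSolution S V h p ∧ p.fst = T h := by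
  have : CompleteSpace V := hVc.completeSpace_coe
  have hbound : ∀ p : V, ‖p‖ ^ 2 ≤ (C ^ 2 + 1) * ‖(p : PairSpace Ω).snd‖ ^ 2 := fun p => by
    have h1 : ‖p‖ ^ 2 = ‖(p : PairSpace Ω).fst‖ ^ 2 + ‖(p : PairSpace Ω).snd‖ ^ 2 :=
      WithLp.prod_norm_sq_eq_of_L2 (p : PairSpace Ω)
    have h2 := pow_le_pow_left₀ (norm_nonneg _) (hV p p.2) 2
    rw [h1]
    linarith
  obtain ⟨R, hR⟩ := exists_laxMilgram_operator ((WithLp.fstL 2 ℝ _ _).comp V.subtypeL)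
    ((WithLp.sndL 2 ℝ _ _).comp V.subtypeL) S ha (by positivity) hS hbound
  exact ⟨((WithLp.fstL 2 ℝ _ _).comp V.subtypeL).comp R, fun h =>
    ⟨R h, ⟨Subtype.coe_prop _, fun q hq => hR h ⟨q, hq⟩⟩, rfl⟩⟩

theorem setIntegral_mul_eq_inner (h : L2 Ω) {v : E d → ℝ} {u : L2 Ω}
    (hu : u =ᵐ[volume.restrict Ω] v) : ∫ x in Ω, h x * v x = inner ℝ h u := by
  rw [L2.inner_def]
  refine integral_congr_ae ?_
  filter_upwards [hu] with x hx
  rw [hx]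
  simp [mul_comm]

theorem isWeakSolution_iff (hd : 0 < d) {s : ℝ} (hs : s ∈ Ioc (0 : ℝ) 1) (hΩ : IsOpen Ω)
    {A : E d → Matrix (Fin d) (Fin d) ℝ}
    (hS : ∀ w z, inner ℝ (S w) z = ∫ x, (A x *ᵥ (w x).ofLp) ⬝ᵥ (z x).ofLp) {u : L2 Ω} :
    IsWeakSolution Ω A s h u ↔
      ∃ p, IsPairSolution S (sobolevPairs hd hs Ω) h p ∧ p.fst = u := by
  have hind : ∀ u : L2 Ω, u =ᵐ[volume.restrict Ω] Ω.indicator u := fun u => by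
    filter_upwards [ae_restrict_mem hΩ.measurableSet] with x hx
    rw [indicator_of_mem hx]
  constructor
  · rintro ⟨hu, w, hw, heq⟩
    obtain ⟨p, hp, hp1, hp2⟩ := exists_mem_of_memHs0 hd hs hu hw
    refine ⟨p, ⟨hp, fun q hq => ?_⟩, Lp.ext (hp1.trans (hind u).symm)⟩
    rw [← setIntegral_mul_eq_inner h (hind q.fst), ← heq _ _ (memHs0_of_mem hd hs hΩ hq)
      (isRieszGradient_of_mem hd hs hΩ hq), hS]
    refine integral_congr_ae ?_
    filter_upwards [hp2] with x hx
    rw [hx]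
  · rintro ⟨p, ⟨hp, heq⟩, rfl⟩
    refine ⟨memHs0_of_mem hd hs hΩ hp, p.snd, isRieszGradient_of_mem hd hs hΩ hp,
      fun v z hv hz => ?_⟩
    obtain ⟨q, hq, hq1, hq2⟩ := exists_mem_of_memHs0 hd hs hv hz
    rw [setIntegral_mul_eq_inner h hq1, ← heq q hq, hS]
    refine integral_congr_ae ?_
    filter_upwards [hq2] with x hx
    rw [hx]

end Solutions

/-! ### Passage to the limit in the order -/

section Convergence

variable {d : ℕ} {Ω : Set (E d)}

theorem sobolevNorm_le_enorm_add_rieszSeminorm (hΩ : IsOpen Ω) (hΩb : Bornology.IsBounded Ω)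
    {s : ℝ} (hs : 0 < s) (u : L2 Ω) :
    sobolevNorm s (Ω.indicator u) ≤ ‖u‖ₑ + rieszSeminorm s (Ω.indicator u) := by
  have hc := continuous_ft (integrable_indicator_L2 hΩ hΩb u)
  rw [← eLpNorm_ft_indicator hΩ hΩb u, ← eLpNorm_norm]
  refine le_trans (le_of_eq ?_) (eLpNorm_add_le hc.norm.aestronglyMeasurable
    (((Real.continuous_rpow_const hs.le).comp (by fun_prop)).mul hc.norm).aestronglyMeasurable
    one_le_two)
  rw [sobolevNorm]
  congr 1
  ext ξ
  simp only [sobolevWeight, Pi.add_apply]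
  ring

/-- Lower semicontinuity of the Riesz seminorm, jointly in the function and the order. -/
theorem rieszSeminorm_le_of_tendsto (hΩ : IsOpen Ω) (hΩb : Bornology.IsBounded Ω) {ι : Type*}
    {l : Filter ι} [l.NeBot] {s : ι → ℝ} {r : ℝ} (hs : ∀ i, 0 < s i) (hr : 0 < r)
    (hsr : Tendsto s l (𝓝 r)) {u : ι → L2 Ω} {v : L2 Ω} (hu : Tendsto u l (𝓝 v)) {M : ℝ≥0∞}
    (hM : ∀ i, rieszSeminorm (s i) (Ω.indicator (u i)) ≤ M) :
    rieszSeminorm r (Ω.indicator v) ≤ M := by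
  -- Fatou is a statement about sequences, and l may be an ultrafilter. The limit (v, r) lies in the
  -- closure of the range of (u i, s i), which is enough to extract a sequence.
  obtain ⟨x, hx, hlim⟩ := mem_closure_iff_seq_limit.1 (mem_closure_of_tendsto
    (hu.prodMk_nhds hsr) (Eventually.of_forall mem_range_self))
  choose i hi using hx
  obtain rfl : (fun n => (u (i n), s (i n))) = x := funext hi
  have hu' : Tendsto (fun n => u (i n)) atTop (𝓝 v) := (continuous_fst.tendsto _).comp hlim
  have hs' : Tendsto (fun n => s (i n)) atTop (𝓝 r) := (continuous_snd.tendsto _).comp hlim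
  refine (Lp.eLpNorm_lim_le_liminf_eLpNorm (p := 2) (μ := (volume : Measure (E d)))
    (f := fun n ξ => (2 * Real.pi * ‖ξ‖) ^ s (i n) * ‖ft (Ω.indicator (u (i n))) ξ‖)
    (fun n => ?_) (fun ξ => (2 * Real.pi * ‖ξ‖) ^ r * ‖ft (Ω.indicator v) ξ‖)
    (Eventually.of_forall fun ξ => ?_)).trans ?_
  · exact (((Real.continuous_rpow_const (hs _).le).comp (by fun_prop)).mul
      (continuous_ft (integrable_indicator_L2 hΩ hΩb _)).norm).aestronglyMeasurable
  -- The base vanishes at ξ = 0; there r > 0 keeps the power continuous in the exponent.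
  · exact (tendsto_const_nhds.rpow hs' (Or.inr hr)).mul
      (((ftEval hΩ hΩb ξ).continuous.tendsto _).comp hu').norm
  · exact (liminf_le_liminf (Eventually.of_forall fun n => hM (i n))).trans
      (liminf_const M).le

theorem tendsto_inner_of_weak {ι H : Type*} [NormedAddCommGroup H] [InnerProductSpace ℝ H]
    {l : Filter ι} {x y : ι → H} {x₀ y₀ : H} {M : ℝ} (hM : ∀ i, ‖x i‖ ≤ M)
    (hx : ∀ ℓ : H →L[ℝ] ℝ, Tendsto (fun i => ℓ (x i)) l (𝓝 (ℓ x₀))) (hy : Tendsto y l (𝓝 y₀)) :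
    Tendsto (fun i => inner ℝ (x i) (y i)) l (𝓝 (inner ℝ x₀ y₀)) := by
  have h1 : Tendsto (fun i => inner ℝ (x i) y₀) l (𝓝 (inner ℝ x₀ y₀)) := by
    have := hx (innerSL ℝ y₀)
    simpa only [innerSL_apply_apply, real_inner_comm] using this
  have h2 : Tendsto (fun i => inner ℝ (x i) (y i - y₀)) l (𝓝 0) := by
    refine squeeze_zero_norm (a := fun i => M * ‖y i - y₀‖) (fun i => ?_) ?_
    · exact (norm_inner_le_norm _ _).trans (mul_le_mul_of_nonneg_right (hM i) (norm_nonneg _))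
    · simpa using ((hy.sub_const y₀).norm).const_mul M
  simpa [inner_sub_right] using h1.add h2

variable {S : Lp (E d) 2 (volume : Measure (E d)) →L[ℝ] Lp (E d) 2 (volume : Measure (E d))}

theorem tendsto_snd_of_isTestPair (hd : 0 < d) {ι : Type*} {l : Filter ι} {s : ι → ℝ} {r : ℝ}
    (hs : ∀ i, s i ∈ Ioc (0 : ℝ) 1) (hr : r ∈ Ioc (0 : ℝ) 1) (hsr : Tendsto s l (𝓝 r))
    {φ : E d → ℝ} {q : ι → PairSpace Ω} {q₀ : PairSpace Ω} (hq : ∀ i, IsTestPair (s i) (q i) φ)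
    (hq₀ : IsTestPair r q₀ φ) : Tendsto (fun i => (q i).snd) l (𝓝 q₀.snd) := by
  rw [tendsto_iff_edist_tendsto_0]
  have h := (hq₀.isTestFunction.tendsto_eLpNorm_rieszGrad_sub hd hr.1 hr.2).comp
    (tendsto_nhdsWithin_iff.2 ⟨hsr, Eventually.of_forall hs⟩)
  refine h.congr fun i => ?_
  simp only [Function.comp, Lp.edist_def]
  refine eLpNorm_congr_ae ?_
  filter_upwards [(hq i).snd_ae, hq₀.snd_ae] with x h1 h2
  rw [Pi.sub_apply, h1, h2]

/-- A weak limit of Riesz gradients, of varying order, of a strongly convergent family is the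
Riesz gradient of the limit. -/
theorem isRieszGradient_of_tendsto (hd : 0 < d) (hΩ : IsOpen Ω) {ι : Type*} {l : Filter ι}
    [l.NeBot] {s : ι → ℝ} {r : ℝ} (hs : ∀ i, s i ∈ Ioc (0 : ℝ) 1) (hr : r ∈ Ioc (0 : ℝ) 1)
    (hsr : Tendsto s l (𝓝 r)) {p : ι → PairSpace Ω} (hp : ∀ i, p i ∈ sobolevPairs hd (hs i) Ω)
    {u : L2 Ω} {w : Lp (E d) 2 (volume : Measure (E d))}
    (hu : Tendsto (fun i => (p i).fst) l (𝓝 u))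
    (hw : ∀ ℓ : Lp (E d) 2 (volume : Measure (E d)) →L[ℝ] ℝ,
      Tendsto (fun i => ℓ (p i).snd) l (𝓝 (ℓ w))) :
    IsRieszGradient r (Ω.indicator u) w := by
  refine ⟨memLp_indicator hΩ _, Lp.memLp _, fun Φ hΦ hc => ?_⟩
  have hΦ2 : MemLp Φ 2 := hΦ.continuous.memLp_of_hasCompactSupport hc
  have hD : ∀ i, MemLp (rieszDiv (s i) Φ) 2 := fun i => memLp_rieszDiv hd (hs i).1 (hs i).2 hΦ hc
  have hDr : MemLp (rieszDiv r Φ) 2 := memLp_rieszDiv hd hr.1 hr.2 hΦ hc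
  rw [← inner_toLp_vector_eq _ hΦ2, ← inner_toLp_eq hΩ _ hDr]
  have hlim : Tendsto (fun i => ((hD i).restrict Ω).toLp) l (𝓝 (hDr.restrict Ω).toLp) := by
    rw [Lp.tendsto_Lp_iff_tendsto_eLpNorm'']
    have h := (tendsto_eLpNorm_rieszDiv_sub hd hr.1 hr.2 hΦ hc).comp
      (tendsto_nhdsWithin_iff.2 ⟨hsr, Eventually.of_forall hs⟩)
    exact tendsto_of_tendsto_of_tendsto_of_le_of_le tendsto_const_nhds h (fun _ => zero_le)
      fun i => eLpNorm_mono_measure _ Measure.restrict_le_self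
  have h1 : Tendsto (fun i => inner ℝ (p i).snd (hΦ2.toLp Φ)) l (𝓝 (inner ℝ w (hΦ2.toLp Φ))) := by
    have := hw (innerSL ℝ (hΦ2.toLp Φ))
    simpa only [innerSL_apply_apply, real_inner_comm] using this
  refine tendsto_nhds_unique h1 ((hu.inner hlim).neg.congr fun i => ?_)
  have h := (isRieszGradient_of_mem hd (hs i) hΩ (hp i)).2.2 Φ hΦ hc
  rw [← inner_toLp_vector_eq _ hΦ2, ← inner_toLp_eq hΩ _ (hD i)] at h
  exact h.symm

theorem norm_fst_le_of_mem (hd : 0 < d) (hΩ : IsOpen Ω) (hΩb : Bornology.IsBounded Ω) :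
    ∃ C : ℝ, 0 < C ∧ ∀ (s : ℝ) (hs : s ∈ Ioc (0 : ℝ) 1), ∀ p ∈ sobolevPairs hd hs Ω,
      ‖p.fst‖ ≤ C * ‖p.snd‖ := by
  obtain ⟨C, hC0, hC⟩ := exists_poincare hd hΩ hΩb
  exact ⟨C, hC0, fun s hs p hp =>
    hC s hs _ _ (norm_nonneg _) (rieszSeminorm_le_of_mem hd hs hΩ hΩb hp)⟩

/-- Solutions of varying order with weakly convergent right-hand sides converge strongly. -/
theorem exists_tendsto_of_isPairSolution (hd : 0 < d) (hΩ : IsOpen Ω)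
    (hΩb : Bornology.IsBounded Ω) (hΩL : HasLipschitzBoundary Ω) {a : ℝ} (ha : 0 < a)
    (hS : ∀ w, a * ‖w‖ ^ 2 ≤ inner ℝ (S w) w) {σ : ℝ} (hσ : 0 < σ) {ι : Type*}
    (𝒰 : Ultrafilter ι) {s : ι → ℝ} {r : ℝ} (hs : ∀ i, s i ∈ Icc σ 1) (hr : r ∈ Ioc (0 : ℝ) 1)
    (hsr : Tendsto s 𝒰 (𝓝 r)) {h : ι → L2 Ω} {h₀ : L2 Ω} (hh : ∀ i, ‖h i‖ ≤ 1)
    (hw : ∀ ℓ : L2 Ω →L[ℝ] ℝ, Tendsto (fun i => ℓ (h i)) 𝒰 (𝓝 (ℓ h₀))) {p : ι → PairSpace Ω}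
    (hp : ∀ i, IsPairSolution S (sobolevPairs hd ⟨hσ.trans_le (hs i).1, (hs i).2⟩ Ω) (h i) (p i)) :
    ∃ p₀, IsPairSolution S (sobolevPairs hd hr Ω) h₀ p₀ ∧
      Tendsto (fun i => (p i).fst) 𝒰 (𝓝 p₀.fst) := by
  have hs' : ∀ i, s i ∈ Ioc (0 : ℝ) 1 := fun i => ⟨hσ.trans_le (hs i).1, (hs i).2⟩
  obtain ⟨C, hC0, hC⟩ := norm_fst_le_of_mem hd hΩ hΩb
  have hsnd : ∀ i, ‖(p i).snd‖ ≤ C / a := fun i =>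
    ((hp i).norm_snd_le hS ha hC0.le (hC _ (hs' i))).trans
      (mul_le_of_le_one_right (by positivity) (hh i))
  have hfst : ∀ i, ‖(p i).fst‖ ≤ C * (C / a) := fun i =>
    (hC _ (hs' i) _ (hp i).1).trans (mul_le_mul_of_nonneg_left (hsnd i) hC0.le)
  have hsemi : ∀ i, rieszSeminorm (s i) (Ω.indicator (p i).fst) ≤ ENNReal.ofReal (C / a) := fun i =>
    (rieszSeminorm_le_of_mem hd (hs' i) hΩ hΩb (hp i).1).trans (ENNReal.ofReal_le_ofReal (hsnd i))
  obtain ⟨u, hu⟩ := exists_weak_limit 𝒰 hfst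
  obtain ⟨w, hwlim⟩ := exists_weak_limit 𝒰 hsnd
  have hulim := tendsto_of_weak_of_rieszSeminorm_le hd hΩ hΩb hσ hs (by positivity) hsemi hu
  -- Orders below r give no direct membership of the approximants in H^r_0(Ω). The limit has finite
  -- norm of order r by lower semicontinuity and vanishes off Ω, and the Lipschitz boundary converts
  -- this into membership.
  have hunorm : sobolevNorm r (Ω.indicator u) < ⊤ :=
    (sobolevNorm_le_enorm_add_rieszSeminorm hΩ hΩb hr.1 u).trans_lt (ENNReal.add_lt_top.2
      ⟨enorm_lt_top, (rieszSeminorm_le_of_tendsto hΩ hΩb (fun i => (hs' i).1) hr.1 hsr hulim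
        hsemi).trans_lt ENNReal.ofReal_lt_top⟩)
  obtain ⟨p₀, hp₀, rfl⟩ := exists_mem_of_sobolevNorm_lt_top hd hr hΩ hΩb hΩL hunorm
  obtain rfl : w = p₀.snd := Lp.ext (ae_eq_of_isRieszGradient
    (isRieszGradient_of_tendsto hd hΩ hs' hr hsr (fun i => (hp i).1) hulim hwlim)
    (isRieszGradient_of_mem hd hr hΩ hp₀))
  refine ⟨p₀, ⟨hp₀, fun q hq => ?_⟩, hulim⟩
  have hcl : IsClosed {q : PairSpace Ω | inner ℝ (S p₀.snd) q.snd = inner ℝ h₀ q.fst} :=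
    isClosed_eq (continuous_const.inner (WithLp.continuous_snd ..))
      (continuous_const.inner (WithLp.continuous_fst ..))
  refine closure_minimal ?_ hcl hq
  rintro q ⟨φ, hqφ⟩
  -- The equation of order s i is tested with the same φ and its gradient of order s i: the first
  -- component is fixed and the gradient converges strongly, which pairs with the weak convergence
  -- of S (p i).snd.
  choose q' hq' using fun i => exists_isTestPair hd (hs' i) hqφ.isTestFunction
  have hlim := tendsto_snd_of_isTestPair hd hs' hr hsr hq' hqφ
  have h1 : Tendsto (fun i => inner ℝ (S (p i).snd) (q' i).snd) 𝒰
      (𝓝 (inner ℝ (S p₀.snd) q.snd)) :=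
    tendsto_inner_of_weak (M := ‖S‖ * (C / a))
      (fun i => (S.le_opNorm _).trans (mul_le_mul_of_nonneg_left (hsnd i) (norm_nonneg _)))
      (fun ℓ => hwlim (ℓ.comp S)) hlim
  have h2 : Tendsto (fun i => inner ℝ (h i) q.fst) 𝒰 (𝓝 (inner ℝ h₀ q.fst)) :=
    tendsto_inner_of_weak hh hw tendsto_const_nhds
  refine tendsto_nhds_unique h1 (h2.congr fun i => ?_)
  rw [(hp i).2 _ ((hq' i).mem_sobolevPairs hd (hs' i)),
    Lp.ext (hqφ.fst_ae.trans (hq' i).fst_ae.symm)]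

theorem exists_norm_le_one_opNorm_le {H : Type*} [NormedAddCommGroup H] [NormedSpace ℝ H]
    (T : H →L[ℝ] H) : ∃ x, ‖x‖ ≤ 1 ∧ ‖T‖ ≤ 2 * ‖T x‖ := by
  rcases (norm_nonneg T).eq_or_lt with h0 | h0
  · exact ⟨0, by simp, by simp [← h0]⟩
  · obtain ⟨x, hx1, hx2⟩ := T.exists_lt_apply_of_lt_opNorm (half_lt_self h0)
    exact ⟨x, hx1.le, by linarith⟩

end Convergence

end RieszDirichlet

end

/-! ### Solution operators and their convergence in norm -/

open RieszDirichlet in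
theorem theoremC1 {d : ℕ} (hd : 0 < d) (Ω : Set (RieszDirichlet.E d)) (hΩ : IsOpen Ω)
    (hΩb : Bornology.IsBounded Ω) (hΩL : RieszDirichlet.HasLipschitzBoundary Ω)
    (A : RieszDirichlet.E d → Matrix (Fin d) (Fin d) ℝ) (aLow aUp : ℝ) (haLow : 0 < aLow)
    (hA : RieszDirichlet.IsEllipticMatrix A aLow aUp) (σ : ℝ) (hσ : 0 < σ) :
    (∀ s ∈ Set.Icc σ 1, ∃ T : RieszDirichlet.L2 Ω →L[ℝ] RieszDirichlet.L2 Ω,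
      RieszDirichlet.IsSolutionOperator Ω A s T) ∧
    ∀ T : ℝ → (RieszDirichlet.L2 Ω →L[ℝ] RieszDirichlet.L2 Ω),
      (∀ s ∈ Set.Icc σ 1, RieszDirichlet.IsSolutionOperator Ω A s (T s)) →
      ∀ r ∈ Set.Icc σ 1,
        Filter.Tendsto (fun s => ‖T s - T r‖) (nhdsWithin r (Set.Icc σ 1)) (nhds 0) := by
  obtain ⟨S, hSA, hS⟩ := exists_coefficientOperator haLow hA
  obtain ⟨C, hC0, hC⟩ := norm_fst_le_of_mem hd hΩ hΩb
  have hIoc : ∀ s ∈ Set.Icc σ 1, s ∈ Set.Ioc (0 : ℝ) 1 := fun s hs => ⟨hσ.trans_le hs.1, hs.2⟩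
  refine ⟨fun s hs => ?_, fun T hT r hr => ?_⟩
  · obtain ⟨T, hT⟩ := exists_pairSolution hS haLow
      (Submodule.isClosed_topologicalClosure (testPairs hd (hIoc s hs) Ω)) (hC s (hIoc s hs))
    refine ⟨T, fun h u => ?_⟩
    obtain ⟨p, hp, hpT⟩ := hT h
    rw [isWeakSolution_iff hd (hIoc s hs) hΩ hSA]
    constructor
    · rintro ⟨q, hq, rfl⟩
      rw [← hpT]
      exact hq.eq hS haLow (hC s (hIoc s hs)) hp
    · rintro rfl
      exact ⟨p, hp, hpT⟩
  · have hsol : ∀ s (hs : s ∈ Set.Icc σ 1) (h u : L2 Ω),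
        (∃ p, IsPairSolution S (sobolevPairs hd (hIoc s hs) Ω) h p ∧ p.fst = u) ↔ u = T s h :=
      fun s hs h u => (isWeakSolution_iff hd (hIoc s hs) hΩ hSA).symm.trans (hT s hs h u)
    rw [tendsto_nhdsWithin_iff_subtype hr, tendsto_iff_ultrafilter]
    intro 𝒰 h𝒰
    -- Near-maximisers replace maximisers of the operator norm, at the cost of a factor 2; they
    -- reduce norm convergence to one family of right-hand sides.
    choose h hh1 hh2 using fun s : Set.Icc σ 1 => exists_norm_le_one_opNorm_le (T s - T r)
    obtain ⟨h₀, hh₀⟩ := exists_weak_limit 𝒰 hh1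
    -- Stated for arbitrary orders tending to r so as to serve twice with the same h: the moving
    -- order gives T^s h_s and the constant order r gives T^r h_s. The common limit T^r h₀ cancels
    -- in the difference.
    have key : ∀ s : Set.Icc σ 1 → ℝ, (∀ i, s i ∈ Set.Icc σ 1) →
        Filter.Tendsto s 𝒰 (nhds r) →
        Filter.Tendsto (fun i => T (s i) (h i)) 𝒰 (nhds (T r h₀)) := by
      intro s hs hsr
      choose p hp hpT using fun i => (hsol (s i) (hs i) (h i) _).2 rfl
      obtain ⟨p₀, hp₀, hlim⟩ := exists_tendsto_of_isPairSolution hd hΩ hΩb hΩL haLow hS hσ 𝒰 hs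
        (hIoc r hr) hsr hh1 hh₀ hp
      rw [(hsol r hr h₀ _).1 ⟨p₀, hp₀, rfl⟩] at hlim
      exact hlim.congr hpT
    have h1 := key (fun i => i) (fun i => i.2)
      ((continuous_subtype_val.tendsto (⟨r, hr⟩ : Set.Icc σ 1)).mono_left h𝒰)
    have h2 := key (fun _ => r) (fun _ => hr) tendsto_const_nhds
    have h3 := ((h1.sub h2).norm).const_mul 2
    rw [sub_self, norm_zero, mul_zero] at h3
    exact squeeze_zero (fun _ => norm_nonneg _) hh2 h3
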